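/- Let $\Delta\subset\mathbb C$ be a domain and let $\phi,\psi$ be analytic in $\Delta$. Assume that there are constants $c,\rho>0$ such that one of the following two conditions holds for all $\xi\in\Delta$: (1) $|\phi(\xi)|\le \dfrac{c}{1+|\xi|^{1+\rho}}$ and $|\psi(\xi)|\le \dfrac{c}{1+|\xi|^{1+\rho}}$; (2) $|\phi(\xi)|\le \dfrac{c}{1+|\xi|^{1/2+\rho}}$, $|\phi'(\xi)|\le \dfrac{c}{1+|\xi|^{1+\rho}}$ and $|\psi(\xi)|\le \dfrac{c}{1+|\xi|^{1+\rho}}$. Let $d>0$ and let $\Gamma^{\pm}(d)\subset\Delta$ be non-empty subdomains such that every point of $\Gamma^\pm(d)$ has distance at least $d$ from every boundary point of $\Delta$, and such that $\xi\in\Gamma^\pm(d)$ implies $\xi\mp x\in\Gamma^\pm(d)$ for all $x>0$. For $\xi\in\Gamma^\pm(d)$ let $\mathscr P(\mp\infty,\xi)$ be the horizontal half-line from $\mp\infty+\mathrm i\,\mathrm{Im}\,\xi$ to $\xi$. (Upper signs and lower signs are taken together throughout.) Put $A_0^\pm=1$ and, for $n\ge 0$, $\xi\in\Gamma^\pm(d)$,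 $$A_{n+1}^\pm(\xi)=-\tfrac12\phi(\xi)A_n^\pm(\xi)\mp\tfrac12\frac{\mathrm dA_n^\pm(\xi)}{\mathrm d\xi}\mp\tfrac12\int_{\mathscr P(\mp\infty,\xi)}\Big(\tfrac14\phi^2(t)\mp\tfrac12\phi'(t)-\psi(t)\Big)A_n^\pm(t)\,\mathrm dt .$$ Let $B(r)=\{t:|t|<r\}$, $U(r)=\{t:\mathrm{Re}\,t>0,\ |\mathrm{Im}\,t|<r\}\cup B(r)$ and $M^\pm(\xi)=\max\big(1,\mp\mathrm{sgn}(\mathrm{Re}\,\xi)\,|\mathrm{Re}\,\xi|^\rho\big)$. The functions $A_n^\pm$ are well defined and analytic in $\Gamma^\pm(d)$, and there are functions $\eta^\pm(u,\xi)$, analytic in $\{\mathrm{Re}\,u>0\}\times\Gamma^\pm(d)$, and $F^\pm(t,\xi)$, analytic in $U(2d)\times\Gamma^\pm(d)$, with the following properties: (a) with $\Phi^\pm$ a primitive of $\phi$ on $\Gamma^\pm(d)$, the functions $W^\pm(u,\xi)=\exp\big(\pm u\xi\pm\tfrac12\Phi^\pm(\xi)\big)\big(1+\eta^\pm(u,\xi)\big)$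 satisfy $\dfrac{\mathrm d^2W}{\mathrm d\xi^2}=\big(u^2+u\phi(\xi)+\psi(\xi)\big)W$, and $\eta^\pm(u,\xi)\to0$ as $\mathrm{Re}\,\xi\to\mp\infty$ in $\Gamma^\pm(d)$, for each $u$ with $\mathrm{Re}\,u>0$; (b) $\eta^\pm(u,\xi)=\displaystyle\int_0^{+\infty}\mathrm e^{-ut}F^\pm(t,\xi)\,\mathrm dt$ for $\mathrm{Re}\,u>0$, $\xi\in\Gamma^\pm(d)$; (c) $F^\pm(t,\xi)=\displaystyle\sum_{n=0}^\infty\frac{A_{n+1}^\pm(\xi)}{n!}t^n$ for $(t,\xi)\in B(2d)\times\Gamma^\pm(d)$. For $\sigma>0$, $0<r<d$ and $\xi\in\Gamma^\pm(d)$ define $$V^\pm(\sigma,\xi)=\begin{cases}\displaystyle\frac6\sigma\int_{\mathscr P(\mp\infty,\xi)}\Big(\tfrac14|\phi^2(t)|+\big|\tfrac12\phi'(t)\pm\psi(t)\big|\Big)|\mathrm dt|&\text{if }\phi\not\equiv0,\\[2ex]\displaystyle\frac1\sigma\int_{\mathscr P(\mp\infty,\xi)}|\psi(t)|\,|\mathrm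 dt|&\text{if }\phi\equiv0,\end{cases}$$ $$C^\pm(r)=2\sup_{|t|=2r,\ \xi\in\Gamma^\pm(d)}\big(M^\pm(\xi)\,|F^\pm(t,\xi)|\big).$$ The integrals and the supremum are finite. For any functions $\eta^\pm,F^\pm$ as above and any integer $N\ge1$ write $$\eta^\pm(u,\xi)=\sum_{n=1}^{N-1}\frac{A_n^\pm(\xi)}{u^n}+R_N^\pm(u,\xi).$$ Then for all $\sigma>0$ and $0<r<d$, $$|R_N^\pm(u,\xi)|\le C^\pm(r)\left(\frac{2r}{N}+\frac1{\mathrm{Re}\,u-\sigma}\right)\frac{\mathrm e^{V^\pm(\sigma,\xi)}}{M^\pm(\xi)}\,\frac{N!}{(2r|u|)^N}$$ whenever $\mathrm{Re}\,u>\sigma$ and $\xi\in\Gamma^\pm(d)$. -/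

import Mathlib

open Complex Set Filter Topology MeasureTheory

noncomputable section

namespace WKB

/-! Throughout, `ε = 1` encodes the upper signs and `ε = -1` the lower signs. -/

/-- Decay condition of the first kind on `φ, ψ` in `Δ`. -/
def Condition1 (φ ψ : ℂ → ℂ) (Δ : Set ℂ) (c ρ : ℝ) : Prop :=
  ∀ ξ ∈ Δ, ‖φ ξ‖ ≤ c / (1 + ‖ξ‖ ^ (1 + ρ)) ∧ ‖ψ ξ‖ ≤ c / (1 + ‖ξ‖ ^ (1 + ρ))

/-- Decay condition of the second kind on `φ, ψ` in `Δ`. -/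
def Condition2 (φ ψ : ℂ → ℂ) (Δ : Set ℂ) (c ρ : ℝ) : Prop :=
  ∀ ξ ∈ Δ, ‖φ ξ‖ ≤ c / (1 + ‖ξ‖ ^ (1 / 2 + ρ)) ∧
    ‖deriv φ ξ‖ ≤ c / (1 + ‖ξ‖ ^ (1 + ρ)) ∧ ‖ψ ξ‖ ≤ c / (1 + ‖ξ‖ ^ (1 + ρ))

/-- `Γ` is an admissible choice of the domain `Γ^±(d)` inside `Δ`: a (non-empty) subdomain, at
distance at least `d` from the boundary of `Δ`, and closed under the translations
`ξ ↦ ξ ∓ x`, `x > 0`. -/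
structure IsGamma (Δ : Set ℂ) (ε d : ℝ) (Γ : Set ℂ) : Prop where
  isOpen : IsOpen Γ
  isConnected : IsConnected Γ
  subset : Γ ⊆ Δ
  le_dist : ∀ ξ ∈ Γ, ∀ b ∈ frontier Δ, d ≤ dist ξ b
  translate : ∀ ξ ∈ Γ, ∀ x : ℝ, 0 < x → ξ - ε * x ∈ Γ

/-- `∫_{𝒫(∓∞, ξ)} g(t) dt`: the integral along the horizontal half-line from `∓∞ + i Im ξ`
to `ξ`, parametrised by `t = ξ ∓ s`, `s > 0` (so that `dt` contributes the factor `±1`). -/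
def halfLineIntegral (ε : ℝ) (g : ℂ → ℂ) (ξ : ℂ) : ℂ :=
  ε * ∫ s in Ioi (0 : ℝ), g (ξ - ε * s)

/-- `∫_{𝒫(∓∞, ξ)} g(t) |dt|`, the integral of a real function with respect to arc length. -/
def halfLineArcIntegral (ε : ℝ) (g : ℂ → ℝ) (ξ : ℂ) : ℝ :=
  ∫ s in Ioi (0 : ℝ), g (ξ - ε * s)

/-- The function `φ² / 4 ∓ φ' / 2 - ψ` in the recurrence for the coefficients. -/
def coeffKernel (φ ψ : ℂ → ℂ) (ε : ℝ) (t : ℂ) : ℂ :=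
  1 / 4 * φ t ^ 2 - ε * (1 / 2) * deriv φ t - ψ t

/-- The WKB coefficients `A_n^±`. -/
def coeffA (φ ψ : ℂ → ℂ) (ε : ℝ) : ℕ → ℂ → ℂ
  | 0 => fun _ => 1
  | n + 1 => fun ξ =>
      -(1 / 2) * φ ξ * coeffA φ ψ ε n ξ - ε * (1 / 2) * deriv (coeffA φ ψ ε n) ξ
        - ε * (1 / 2) *
          halfLineIntegral ε (fun t => coeffKernel φ ψ ε t * coeffA φ ψ ε n t) ξ

/-- The strip `U(r)` of points at distance less than `r` from the positive real axis. -/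
def stripU (r : ℝ) : Set ℂ := {t : ℂ | 0 < t.re ∧ |t.im| < r} ∪ Metric.ball 0 r

/-- The weight `max (1, ∓ sgn (Re ξ) |Re ξ|^ρ)`. -/
def weight (ε ρ : ℝ) (ξ : ℂ) : ℝ := max 1 (-ε * (Real.sign ξ.re * |ξ.re| ^ ρ))

/-- The density `|φ²| / 4 + |φ' / 2 ± ψ|`. -/
def density (φ ψ : ℂ → ℂ) (ε : ℝ) (t : ℂ) : ℝ :=
  1 / 4 * ‖φ t ^ 2‖ + ‖1 / 2 * deriv φ t + ε * ψ t‖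

open Classical in
/-- The quantity `V^±(σ, ξ)`. -/
def V (φ ψ : ℂ → ℂ) (Δ : Set ℂ) (ε σ : ℝ) (ξ : ℂ) : ℝ :=
  if ∀ t ∈ Δ, φ t = 0 then 1 / σ * halfLineArcIntegral ε (fun t => ‖ψ t‖) ξ
  else 6 / σ * halfLineArcIntegral ε (density φ ψ ε) ξ

/-- The set of values whose supremum enters the constant `C^±(r)`. -/
def constSet (F : ℂ → ℂ → ℂ) (Γ : Set ℂ) (ε ρ r : ℝ) : Set ℝ :=
  {x | ∃ t ξ : ℂ, ‖t‖ = 2 * r ∧ ξ ∈ Γ ∧ x = weight ε ρ ξ * ‖F t ξ‖}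

/-- The constant `C^±(r)`. -/
def constC (F : ℂ → ℂ → ℂ) (Γ : Set ℂ) (ε ρ r : ℝ) : ℝ := 2 * sSup (constSet F Γ ε ρ r)

/-- `W^±(u, ξ) = exp (± u ξ ± Φ(ξ) / 2) (1 + η(u, ξ))`, where `Φ` is a primitive of `φ`. -/
def solutionW (Φ : ℂ → ℂ) (ε : ℝ) (η : ℂ → ℂ → ℂ) (u ξ : ℂ) : ℂ :=
  cexp (ε * u * ξ + ε * (1 / 2) * Φ ξ) * (1 + η u ξ)

/-- `η` is the Borel re-summed WKB correction `η^±` on `{Re u > 0} × Γ` and `F` is its Borel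
transform `F^±`. -/
structure IsBorelPair (φ ψ : ℂ → ℂ) (Γ : Set ℂ) (ε d : ℝ) (η F : ℂ → ℂ → ℂ) : Prop where
  /-- `η` is holomorphic in both variables. -/
  eta_holo : DifferentiableOn ℂ (fun p : ℂ × ℂ => η p.1 p.2) ({u : ℂ | 0 < u.re} ×ˢ Γ)
  /-- `W'' = (u² + u φ + ψ) W`, for some choice of the primitive of `φ`. -/
  ode : ∃ Φ : ℂ → ℂ, (∀ ξ ∈ Γ, HasDerivAt Φ (φ ξ) ξ) ∧
    ∀ u : ℂ, 0 < u.re → ∀ ξ ∈ Γ,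
      deriv (deriv (solutionW Φ ε η u)) ξ = (u ^ 2 + u * φ ξ + ψ ξ) * solutionW Φ ε η u ξ
  /-- `η(u, ξ) → 0` as `Re ξ → ∓∞` in `Γ`. -/
  eta_lim : ∀ u : ℂ, 0 < u.re →
    Tendsto (η u) (comap (fun ξ : ℂ => -ε * ξ.re) atTop ⊓ 𝓟 Γ) (𝓝 0)
  /-- `F` is holomorphic in both variables. -/
  F_holo : DifferentiableOn ℂ (fun p : ℂ × ℂ => F p.1 p.2) (stripU (2 * d) ×ˢ Γ)
  /-- The power series of `F` about `t = 0`. -/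
  F_series : ∀ t ∈ Metric.ball (0 : ℂ) (2 * d), ∀ ξ ∈ Γ,
    HasSum (fun n : ℕ => coeffA φ ψ ε (n + 1) ξ / (n.factorial : ℂ) * t ^ n) (F t ξ)
  /-- `η` is the Laplace transform of `F`. -/
  laplace : ∀ u : ℂ, 0 < u.re → ∀ ξ ∈ Γ,
    IntegrableOn (fun t : ℝ => cexp (-u * t) * F t ξ) (Ioi 0) ∧
      η u ξ = ∫ t in Ioi (0 : ℝ), cexp (-u * t) * F t ξ

end WKB

end

/-!
The lower signs reduce to the upper ones by the reflection `ξ ↦ -ξ`, so let `ε = 1` and write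
`k = φ² / 4 - φ' / 2 - ψ`. Inserting `W = exp (u ξ + Φ / 2) (1 + η)` in the differential equation
and integrating once from `-∞` gives the first-order equation
`2 u η + η' + φ (1 + η) + ∫_{x > 0} k(ξ - x) (1 + η(u, ξ - x)) dx = 0`. If `η` is to be a Laplace
transform, its Borel transform `F` has to solve the transport equation
`2 F_t + F_ξ = -(φ F + ∫_{x > 0} k(ξ - x) F(t, ξ - x) dx)` with `F(0, ξ) = A₁(ξ)`, whose
characteristics are the lines `t - 2 ξ = const`, traversed by `(t, ξ) ↦ (t + 2 s, ξ + s)`.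

* Existence. Along characteristics the equation becomes an integral equation, in which the point
  `(t, ξ)` only depends on the segment from `ξ - t / 2` to `ξ` and on the half-lines to the left of
  it. For `t ∈ U(2 r)` and `ξ ∈ Γ` these stay in the `r`-neighbourhood of `Γ`, hence in `Δ` if
  `r < d`. There `φ` is bounded by a multiple of `(1 + max (0, -Re ξ))^(-ρ)`, and `φ²`, `φ'`, `k` by
  a multiple of the integrable rate `(1 + |Re ξ|)^(-1-ρ)`, with Cauchy's estimate for `φ'` under the
  first decay condition. Picard iteration converges (`exists_solution_integral_equation`,
  `exists_borelSol`), and gives holomorphy and the decay of `F` as `Re ξ → -∞`.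
* Coefficients. Comparing Taylor coefficients at `t = 0` in the transport equation yields the
  recurrence of the `A_n` (`BorelSol.coeffA_succ_eq`). This determines `F` near `t = 0`, hence on
  the whole strip by the identity theorem, and then `η`.
* Growth (`BorelSol.growth_bound`). Let `p` be the density in `V`, let
  `D(ξ) = ∫_{x > 0} p(ξ - x) dx`, and let `S` bound `M(ξ) |F(w, ξ)|`. One use of the equation along
  characteristics improves a bound `|F(T + w, ξ)| ≤ P exp (σ T + a D(ξ)) / M(ξ)` to the same bound
  with `S + P / 2` for `P`: integrating both exponentials gives the integral term a factor
  proportional to `1 / (a σ)`, and the term `φ F` is split by the inequality of arithmetic and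
  geometric means, using `|φ|² ≤ 4 p`. The factor `1 / 2` results from `a σ = 6`, or from `a σ = 1`
  if `φ = 0`. Iteration gives `P = 2 S`.
* Laplace transform. The transport equation turns into the first-order equation for `η`
  (`BorelSol.deriv_laplaceBorel`), hence into the equation for `W`
  (`deriv_deriv_exp_mul_of_firstOrder`). Integrating by parts `N` times gives the partial sum of the
  expansion, with remainder `u^(-N) (A_N + ∫ exp (-u t) ∂_t^N F dt)` (`laplace_expansion`). Cauchy's
  estimate on the circles of radius `2 r` about `t ≥ 0`, with the growth bound, yields the error
  bound (`BorelSol.norm_laplaceBorel_sub_sum_le`).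
-/

noncomputable section

namespace WKB

/-! ### Holomorphic dependence of integrals on parameters -/

theorem norm_fderiv_le_of_norm_le_ball {E : Type*} [NormedAddCommGroup E] [NormedSpace ℂ E]
    {f : E → ℂ} {x : E} {R M : ℝ} (hR : 0 < R) (hf : DifferentiableOn ℂ f (Metric.ball x R))
    (hM : ∀ y ∈ Metric.ball x R, ‖f y‖ ≤ M) : ‖fderiv ℂ f x‖ ≤ 2 * M / R := by
  refine Complex.norm_fderiv_le_div_of_mapsTo_ball hf (fun y hy => ?_) hR
  rw [Metric.mem_closedBall, dist_eq_norm]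
  calc ‖f y - f x‖ ≤ ‖f y‖ + ‖f x‖ := norm_sub_le _ _
    _ ≤ 2 * M := by linarith [hM y hy, hM x (Metric.mem_ball_self hR)]

/-- The derivative at `x` is measurable in the parameter; no measurability jointly in `(y, a)` is
needed. -/
theorem aestronglyMeasurable_fderiv_param {E α : Type*} [NormedAddCommGroup E] [NormedSpace ℂ E]
    [FiniteDimensional ℂ E] [MeasurableSpace α] {μ : Measure α} {U : Set E} (hU : IsOpen U)
    {f : E → α → ℂ} (hf : ∀ᵐ a ∂μ, DifferentiableOn ℂ (fun y => f y a) U)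
    (hm : ∀ y ∈ U, AEStronglyMeasurable (f y) μ) {x : E} (hx : x ∈ U) :
    AEStronglyMeasurable (fun a => fderiv ℂ (fun y => f y a) x) μ := by
  -- directional derivatives are limits of difference quotients
  have key : ∀ v : E, AEStronglyMeasurable (fun a => fderiv ℂ (fun y => f y a) x v) μ := by
    intro v
    have hlim : Tendsto (fun n : ℕ => x + ((n : ℂ) + 1)⁻¹ • v) atTop (𝓝 x) := by
      have h0 : Tendsto (fun n : ℕ => ((n : ℂ) + 1)⁻¹) atTop (𝓝 0) := by
        have := tendsto_one_div_add_atTop_nhds_zero_nat (𝕜 := ℂ)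
        simpa using this
      simpa using (h0.smul_const v).const_add x
    obtain ⟨n₀, hn₀⟩ := eventually_atTop.1 (hlim.eventually (hU.mem_nhds hx))
    refine aestronglyMeasurable_of_tendsto_ae atTop
      (f := fun (n : ℕ) a => ((↑(n + n₀) : ℂ) + 1) *
        (f (x + ((↑(n + n₀) : ℂ) + 1)⁻¹ • v) a - f x a)) (fun n => ?_) ?_
    · exact ((hm _ (hn₀ _ (by omega))).sub (hm x hx)).const_mul _
    · filter_upwards [hf] with a ha
      have hd := (ha.differentiableAt (hU.mem_nhds hx)).hasFDerivAt
      have h1 : Tendsto (fun n : ℕ => ‖((n : ℂ) + 1)‖) atTop atTop := by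
        have h : ∀ n : ℕ, ‖((n : ℂ) + 1)‖ = (n : ℝ) + 1 := fun n => by
          rw [← Nat.cast_succ, Complex.norm_natCast]; simp
        simp only [h]
        exact tendsto_atTop_add_const_right _ _ tendsto_natCast_atTop_atTop
      have h2 := hd.lim v (c := fun n : ℕ => (n : ℂ) + 1) (l := atTop) h1
      have h3 := h2.comp (tendsto_add_atTop_nat n₀)
      simpa [Function.comp_def] using h3
  let b := Module.finBasis ℂ E
  have hrep : ∀ L : E →L[ℂ] ℂ,
      L = ∑ i, L (b i) • (LinearMap.toContinuousLinearMap (b.coord i)) := by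
    intro L
    ext y
    conv_lhs => rw [← b.sum_repr y, map_sum]
    simp [mul_comm]
  have : (fun a => fderiv ℂ (fun y => f y a) x) = fun a => ∑ i,
      fderiv ℂ (fun y => f y a) x (b i) • (LinearMap.toContinuousLinearMap (b.coord i)) := by
    funext a
    exact hrep _
  rw [this]
  refine Finset.aestronglyMeasurable_fun_sum _ (fun i _ => ?_)
  exact (key (b i)).smul_const _

/-- An integral of holomorphic functions of `x` that is locally dominated may be differentiated
under the integral sign; no bound on the derivatives is needed, thanks to Cauchy's estimate. -/
theorem hasFDerivAt_integral_of_locally_dominated {E α : Type*} [NormedAddCommGroup E]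
    [NormedSpace ℂ E] [FiniteDimensional ℂ E] [MeasurableSpace α] {μ : Measure α} {U : Set E}
    (hU : IsOpen U) {f : E → α → ℂ} (hf : ∀ᵐ a ∂μ, DifferentiableOn ℂ (fun y => f y a) U)
    (hm : ∀ y ∈ U, AEStronglyMeasurable (f y) μ) {x : E} (hx : x ∈ U) {r : ℝ} (hr : 0 < r)
    {g : α → ℝ} (hg : Integrable g μ)
    (hb : ∀ᵐ a ∂μ, ∀ y ∈ Metric.ball x r ∩ U, ‖f y a‖ ≤ g a) :
    Integrable (fun a => fderiv ℂ (fun y => f y a) x) μ ∧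
    HasFDerivAt (fun y => ∫ a, f y a ∂μ) (∫ a, fderiv ℂ (fun y => f y a) x ∂μ) x := by
  obtain ⟨R, hR, hRU⟩ := Metric.isOpen_iff.1 (hU.inter Metric.isOpen_ball) x
    ⟨hx, Metric.mem_ball_self hr⟩
  have hbd : ∀ᵐ a ∂μ, ∀ y ∈ Metric.ball x (R / 2),
      ‖fderiv ℂ (fun z => f z a) y‖ ≤ 2 * g a / (R / 2) := by
    filter_upwards [hf, hb] with a ha hba y hy
    have hsub : Metric.ball y (R / 2) ⊆ Metric.ball x R := by
      refine Metric.ball_subset_ball' ?_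
      rw [Metric.mem_ball] at hy
      linarith
    refine norm_fderiv_le_of_norm_le_ball (half_pos hR)
      (ha.mono (hsub.trans (hRU.trans inter_subset_left))) (fun z hz => ?_)
    exact hba z ⟨(hRU (hsub hz)).2, (hRU (hsub hz)).1⟩
  have hgi : Integrable (fun a => 2 * g a / (R / 2)) μ := (hg.const_mul 2).div_const _
  have hmeas := aestronglyMeasurable_fderiv_param hU hf hm hx
  refine ⟨hgi.mono' hmeas ?_, ?_⟩
  · filter_upwards [hbd] with a ha using ha x (Metric.mem_ball_self (half_pos hR))
  · refine hasFDerivAt_integral_of_dominated_of_fderiv_le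
      (Metric.ball_mem_nhds x (half_pos hR)) ?_ ?_ hmeas hbd hgi ?_
    · filter_upwards [hU.mem_nhds hx] with y hy using hm y hy
    · refine hg.mono' (hm x hx) ?_
      filter_upwards [hb] with a ha using ha x ⟨Metric.mem_ball_self hr, hx⟩
    · filter_upwards [hf] with a ha y hy
      refine (ha.differentiableAt (hU.mem_nhds (hRU ?_).1)).hasFDerivAt
      exact Metric.ball_subset_ball (by linarith) hy

theorem differentiableOn_integral_of_locally_dominated {E α : Type*} [NormedAddCommGroup E]
    [NormedSpace ℂ E] [FiniteDimensional ℂ E] [MeasurableSpace α] {μ : Measure α} {U : Set E}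
    (hU : IsOpen U) {f : E → α → ℂ} (hf : ∀ᵐ a ∂μ, DifferentiableOn ℂ (fun y => f y a) U)
    (hm : ∀ y ∈ U, AEStronglyMeasurable (f y) μ)
    (hb : ∀ x ∈ U, ∃ r : ℝ, 0 < r ∧ ∃ g : α → ℝ, Integrable g μ ∧
      ∀ᵐ a ∂μ, ∀ y ∈ Metric.ball x r ∩ U, ‖f y a‖ ≤ g a) :
    DifferentiableOn ℂ (fun y => ∫ a, f y a ∂μ) U := by
  intro x hx
  obtain ⟨r, hr, g, hg, hbg⟩ := hb x hx
  exact (hasFDerivAt_integral_of_locally_dominated hU hf hm hx hr hg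
    hbg).2.differentiableAt.differentiableWithinAt

theorem hasDerivAt_integral_of_locally_dominated {α : Type*} [MeasurableSpace α] {μ : Measure α}
    {U : Set ℂ} (hU : IsOpen U) {f : ℂ → α → ℂ}
    (hf : ∀ᵐ a ∂μ, DifferentiableOn ℂ (fun y => f y a) U)
    (hm : ∀ y ∈ U, AEStronglyMeasurable (f y) μ) {x : ℂ} (hx : x ∈ U) {r : ℝ} (hr : 0 < r)
    {g : α → ℝ} (hg : Integrable g μ)
    (hb : ∀ᵐ a ∂μ, ∀ y ∈ Metric.ball x r ∩ U, ‖f y a‖ ≤ g a) :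
    Integrable (fun a => deriv (fun y => f y a) x) μ ∧
    HasDerivAt (fun y => ∫ a, f y a ∂μ) (∫ a, deriv (fun y => f y a) x ∂μ) x := by
  obtain ⟨h1, h2⟩ := hasFDerivAt_integral_of_locally_dominated hU hf hm hx hr hg hb
  refine ⟨h1.apply_continuousLinearMap 1, ?_⟩
  have h3 := h2.hasDerivAt
  rw [ContinuousLinearMap.integral_apply h1] at h3
  exact h3

theorem exists_locally_bounded_of_continuousOn {E : Type*} [NormedAddCommGroup E] [ProperSpace E]
    {U : Set E} (hU : IsOpen U) {a b : ℝ} {f : E → ℝ → ℂ}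
    (hc : ContinuousOn (fun p : E × ℝ => f p.1 p.2) (U ×ˢ Icc a b)) {x : E} (hx : x ∈ U) :
    ∃ r : ℝ, 0 < r ∧ ∃ B : ℝ, ∀ y ∈ Metric.ball x r, ∀ l ∈ Icc a b, ‖f y l‖ ≤ B := by
  obtain ⟨R, hR, hRU⟩ := Metric.isOpen_iff.1 hU x hx
  have hK : IsCompact (Metric.closedBall x (R / 2) ×ˢ Icc a b) :=
    (isCompact_closedBall _ _).prod isCompact_Icc
  have hsub : Metric.closedBall x (R / 2) ⊆ U :=
    (Metric.closedBall_subset_ball (by linarith)).trans hRU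
  obtain ⟨B, hB⟩ := hK.exists_bound_of_continuousOn (hc.mono (prod_mono hsub subset_rfl))
  exact ⟨R / 2, half_pos hR, B, fun y hy l hl =>
    hB (y, l) ⟨Metric.ball_subset_closedBall hy, hl⟩⟩

theorem differentiableOn_setIntegral_Ioc {E : Type*} [NormedAddCommGroup E] [NormedSpace ℂ E]
    [FiniteDimensional ℂ E] [ProperSpace E] {U : Set E} (hU : IsOpen U) {a b : ℝ} {f : E → ℝ → ℂ}
    (hc : ContinuousOn (fun p : E × ℝ => f p.1 p.2) (U ×ˢ Icc a b))
    (hf : ∀ l ∈ Icc a b, DifferentiableOn ℂ (fun y => f y l) U) :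
    DifferentiableOn ℂ (fun y => ∫ l in Ioc a b, f y l) U := by
  refine differentiableOn_integral_of_locally_dominated hU ?_ (fun y hy => ?_) (fun x hx => ?_)
  · filter_upwards [ae_restrict_mem measurableSet_Ioc] with l hl using hf l (Ioc_subset_Icc_self hl)
  · refine ContinuousOn.aestronglyMeasurable ?_ measurableSet_Ioc
    exact hc.comp (f := fun l : ℝ => (y, l)) (by fun_prop)
      (fun l hl => ⟨hy, Ioc_subset_Icc_self hl⟩)
  · obtain ⟨r, hr, B, hB⟩ := exists_locally_bounded_of_continuousOn hU hc hx
    refine ⟨r, hr, fun _ => B, integrable_const _, ?_⟩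
    filter_upwards [ae_restrict_mem measurableSet_Ioc] with l hl y hy
    exact hB y hy.1 l (Ioc_subset_Icc_self hl)

/-- On an open set that is star-shaped about `0`, the integral of `H` over the segment `[0, τ]`
is a primitive of `H`. -/
theorem hasDerivAt_segment_integral {Y : Set ℂ} (hY : IsOpen Y)
    (hstar : ∀ ν ∈ Y, ∀ l ∈ Icc (0 : ℝ) 1, (l : ℂ) * ν ∈ Y) {H : ℂ → ℂ}
    (hH : DifferentiableOn ℂ H Y) {τ : ℂ} (hτ : τ ∈ Y) :
    HasDerivAt (fun τ : ℂ => τ * ∫ l in Ioc (0 : ℝ) 1, H (l * τ)) (H τ) τ := by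
  have hcH : ContinuousOn (fun p : ℂ × ℝ => H (p.2 * p.1)) (Y ×ˢ Icc 0 1) :=
    hH.continuousOn.comp (by fun_prop) (fun p hp => hstar _ hp.1 _ hp.2)
  have hdf : ∀ l ∈ Icc (0 : ℝ) 1, DifferentiableOn ℂ (fun y : ℂ => H (l * y)) Y := fun l hl =>
    hH.comp (by fun_prop) (fun y hy => hstar y hy l hl)
  obtain ⟨r, hr, B, hB⟩ := exists_locally_bounded_of_continuousOn hY
    (f := fun y l => H (l * y)) hcH hτ
  obtain ⟨hi, hd⟩ := hasDerivAt_integral_of_locally_dominated (μ := volume.restrict (Ioc (0 : ℝ) 1))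
    hY (f := fun y l => H (l * y))
    (by filter_upwards [ae_restrict_mem measurableSet_Ioc] with l hl
          using hdf l (Ioc_subset_Icc_self hl))
    (fun y hy => ContinuousOn.aestronglyMeasurable
      (hcH.comp (f := fun l : ℝ => (y, l)) (by fun_prop)
        (fun l hl => ⟨hy, Ioc_subset_Icc_self hl⟩)) measurableSet_Ioc)
    hτ hr (g := fun _ => B) (integrable_const _)
    (by filter_upwards [ae_restrict_mem measurableSet_Ioc] with l hl y hy
          using hB y hy.1 l (Ioc_subset_Icc_self hl))
  have hderiv : ∀ l ∈ Icc (0 : ℝ) 1, deriv (fun y : ℂ => H (l * y)) τ = l * deriv H (l * τ) := by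
    intro l hl
    have h1 := (hH.differentiableAt (hY.mem_nhds (hstar τ hτ l hl))).hasDerivAt
    have h2 : HasDerivAt (fun y : ℂ => (l : ℂ) * y) l τ := by
      simpa using (hasDerivAt_id τ).const_mul (l : ℂ)
    rw [mul_comm (l : ℂ)]
    exact (h1.comp τ h2).deriv
  have hHi : IntegrableOn (fun l : ℝ => H (l * τ)) (Ioc 0 1) := by
    have h : ContinuousOn (fun l : ℝ => H (l * τ)) (Icc 0 1) :=
      hcH.comp (f := fun l : ℝ => (τ, l)) (by fun_prop) (fun l hl => ⟨hτ, hl⟩)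
    exact h.integrableOn_Icc.mono_set Ioc_subset_Icc_self
  -- the integrand is the derivative of `l ↦ l H(l τ)`
  have hFTC : ∫ l in (0 : ℝ)..1, (H (l * τ) + τ * deriv (fun y : ℂ => H (l * y)) τ) = H τ := by
    have hder : ∀ l ∈ uIcc (0 : ℝ) 1, HasDerivAt (fun l : ℝ => (l : ℂ) * H (l * τ))
        (H (l * τ) + τ * deriv (fun y : ℂ => H (l * y)) τ) l := by
      intro l hl
      rw [uIcc_of_le zero_le_one] at hl
      rw [hderiv l hl]
      have h1 := (hH.differentiableAt (hY.mem_nhds (hstar τ hτ l hl))).hasDerivAt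
      have h0 : HasDerivAt (fun l : ℝ => (l : ℂ)) 1 l := Complex.ofRealCLM.hasDerivAt
      have h2 : HasDerivAt (fun l : ℝ => (l : ℂ) * τ) τ l := by
        simpa using h0.mul_const τ
      have h3 := h0.mul (HasDerivAt.comp (h₂ := H) l h1 h2)
      refine h3.congr_deriv ?_
      simp only [Function.comp_apply]
      ring
    rw [intervalIntegral.integral_eq_sub_of_hasDerivAt hder]
    · simp
    · rw [intervalIntegrable_iff_integrableOn_Ioc_of_le zero_le_one]
      exact hHi.add (hi.const_mul τ)
  have h := (hasDerivAt_id τ).mul hd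
  rw [intervalIntegral.integral_of_le zero_le_one, integral_add hHi (hi.const_mul τ),
    integral_const_mul] at hFTC
  simp only [id, one_mul] at h
  rw [hFTC] at h
  exact h

/-- The partial derivative in the first variable of a holomorphic function of two variables is
holomorphic in both variables. -/
theorem differentiableOn_deriv_fst {W : Set (ℂ × ℂ)} (hW : IsOpen W) {f : ℂ × ℂ → ℂ}
    (hf : DifferentiableOn ℂ f W) :
    DifferentiableOn ℂ (fun p : ℂ × ℂ => deriv (fun z => f (z, p.2)) p.1) W := by
  intro p hp
  obtain ⟨R, hR, hRW⟩ := Metric.isOpen_iff.1 hW p hp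
  set ρ : ℝ := R / 3 with hρ
  have hρ0 : 0 < ρ := by positivity
  have hmem : ∀ q ∈ Metric.ball p ρ, ∀ w : ℂ, ‖w‖ < 2 * ρ → (q.1 + w, q.2) ∈ W := by
    intro q hq w hw
    apply hRW
    rw [Metric.mem_ball, Prod.dist_eq, max_lt_iff] at hq ⊢
    refine ⟨?_, by simpa using hq.2.trans (by linarith)⟩
    have h1 := hq.1
    simp only [dist_eq_norm] at h1 ⊢
    have h2 : q.1 + w - p.1 = (q.1 - p.1) + w := by ring
    rw [h2]
    linarith [norm_add_le (q.1 - p.1) w]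
  have hnc : ∀ θ : ℝ, ‖circleMap 0 ρ θ‖ < 2 * ρ := fun θ => by
    simp [abs_of_pos hρ0, hρ0]
  -- Cauchy's formula turns the derivative into an integral with holomorphic parameter `q`
  have hkey : ∀ q ∈ Metric.ball p ρ, deriv (fun z => f (z, q.2)) q.1 = (2 * Real.pi * I)⁻¹ *
      ∫ θ in Ioc 0 (2 * Real.pi), deriv (circleMap 0 ρ) θ *
        ((circleMap 0 ρ θ ^ 2)⁻¹ * f (q.1 + circleMap 0 ρ θ, q.2)) := by
    intro q hq
    have hd : DifferentiableOn ℂ (fun z => f (z, q.2)) (Metric.ball q.1 (2 * ρ)) := by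
      refine hf.comp (by fun_prop) (fun z hz => ?_)
      have := hmem q hq (z - q.1) (by simpa [dist_eq_norm] using hz)
      simpa using this
    rw [← Complex.cderiv_eq_deriv Metric.isOpen_ball hd hρ0
      (Metric.closedBall_subset_ball (by linarith)), Complex.cderiv, smul_eq_mul, circleIntegral,
      intervalIntegral.integral_of_le (by positivity)]
    simp [circleMap, deriv_circleMap]
  have hdiff : DifferentiableOn ℂ (fun q : ℂ × ℂ => (2 * Real.pi * I : ℂ)⁻¹ *
      ∫ θ in Ioc 0 (2 * Real.pi), deriv (circleMap 0 ρ) θ *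
        ((circleMap 0 ρ θ ^ 2)⁻¹ * f (q.1 + circleMap 0 ρ θ, q.2))) (Metric.ball p ρ) := by
    refine DifferentiableOn.const_mul (differentiableOn_setIntegral_Ioc Metric.isOpen_ball
      (f := fun (q : ℂ × ℂ) (θ : ℝ) => deriv (circleMap 0 ρ) θ *
        ((circleMap 0 ρ θ ^ 2)⁻¹ * f (q.1 + circleMap 0 ρ θ, q.2))) ?_ ?_) _
    · refine ContinuousOn.mul (by simp only [deriv_circleMap]; fun_prop) (ContinuousOn.mul
        (ContinuousOn.inv₀ (by fun_prop) (fun q hq => ?_)) ?_)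
      · exact pow_ne_zero _ (circleMap_ne_center hρ0.ne')
      · exact hf.continuousOn.comp (f := fun x : (ℂ × ℂ) × ℝ => (x.1.1 + circleMap 0 ρ x.2, x.1.2))
          (by fun_prop) (fun q hq => hmem _ hq.1 _ (hnc _))
    · intro θ _
      refine DifferentiableOn.const_mul (DifferentiableOn.const_mul ?_ _) _
      exact hf.comp (f := fun q : ℂ × ℂ => (q.1 + circleMap 0 ρ θ, q.2)) (by fun_prop)
        (fun q hq => hmem _ hq _ (hnc _))
  exact ((hdiff.congr hkey).differentiableAt
    (Metric.ball_mem_nhds p hρ0)).differentiableWithinAt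

/-! ### Decay rates along horizontal half-lines -/

/-- The integrable rate `(1 + |y|)^(-(1 + ρ))`. -/
def decayK (ρ y : ℝ) : ℝ := (1 + |y|) ^ (-(1 + ρ))

/-- The rate `(1 + max (0, -y))^(-ρ)`, comparable with the reciprocal of the weight. -/
def decayM (ρ y : ℝ) : ℝ := (1 + max 0 (-y)) ^ (-ρ)

theorem decayK_pos (ρ y : ℝ) : 0 < decayK ρ y := Real.rpow_pos_of_pos (by positivity) _

theorem one_le_one_add_max (y : ℝ) : 1 ≤ 1 + max 0 (-y) := by
  linarith [le_max_left 0 (-y)]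

theorem decayM_pos (ρ y : ℝ) : 0 < decayM ρ y :=
  Real.rpow_pos_of_pos (by linarith [one_le_one_add_max y]) _

theorem decayM_le_one {ρ : ℝ} (hρ : 0 < ρ) (y : ℝ) : decayM ρ y ≤ 1 :=
  Real.rpow_le_one_of_one_le_of_nonpos (one_le_one_add_max y) (by linarith)

theorem decayM_mono {ρ : ℝ} (hρ : 0 < ρ) {y y' : ℝ} (h : y ≤ y') : decayM ρ y ≤ decayM ρ y' := by
  refine Real.rpow_le_rpow_of_nonpos (by linarith [one_le_one_add_max y']) ?_ (by linarith)
  have : max 0 (-y') ≤ max 0 (-y) := max_le_max le_rfl (by linarith)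
  linarith

theorem decayM_add_le {ρ : ℝ} (hρ : 0 < ρ) (y : ℝ) {a : ℝ} (ha : 0 ≤ a) :
    decayM ρ (y + a) ≤ (1 + a) ^ ρ * decayM ρ y := by
  have h1 := one_le_one_add_max y
  have h2 := one_le_one_add_max (y + a)
  have h3 : 1 + max 0 (-y) ≤ (1 + a) * (1 + max 0 (-(y + a))) := by
    rcases le_total 0 (-y) with h | h
    · rw [max_eq_right h]
      nlinarith [le_max_left 0 (-(y + a)), le_max_right 0 (-(y + a))]
    · rw [max_eq_left h]
      nlinarith
  unfold decayM
  have h4 : (1 + max 0 (-y)) ^ ρ ≤ (1 + a) ^ ρ * (1 + max 0 (-(y + a))) ^ ρ := by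
    rw [← Real.mul_rpow (by linarith) (by linarith)]
    exact Real.rpow_le_rpow (by linarith) h3 hρ.le
  rw [Real.rpow_neg (by linarith), Real.rpow_neg (by linarith), ← div_eq_mul_inv,
    inv_eq_one_div, div_le_div_iff₀ (by positivity) (by positivity)]
  linarith

theorem decayK_near {ρ : ℝ} (hρ : 0 < ρ) {y y' : ℝ} (h : |y - y'| ≤ 1) :
    decayK ρ y' ≤ 2 ^ (1 + ρ) * decayK ρ y := by
  unfold decayK
  have h4 : (1 + |y|) ^ (1 + ρ) ≤ 2 ^ (1 + ρ) * (1 + |y'|) ^ (1 + ρ) := by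
    rw [← Real.mul_rpow (by norm_num) (by positivity)]
    refine Real.rpow_le_rpow (by positivity) ?_ (by linarith)
    have := abs_sub_abs_le_abs_sub y y'
    linarith [abs_nonneg y']
  rw [Real.rpow_neg (by positivity), Real.rpow_neg (by positivity), ← div_eq_mul_inv,
    inv_eq_one_div, div_le_div_iff₀ (by positivity) (by positivity)]
  linarith

theorem integrable_decayK {ρ : ℝ} (hρ : 0 < ρ) : Integrable (decayK ρ) := by
  have h := integrable_one_add_norm (E := ℝ) (μ := volume) (r := 1 + ρ) (by simp [hρ])
  exact h

theorem integrableOn_decayK_sub {ρ : ℝ} (hρ : 0 < ρ) (y : ℝ) :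
    IntegrableOn (fun x => decayK ρ (y - x)) (Ioi 0) :=
  ((integrable_decayK hρ).comp_sub_left y).integrableOn

/-- Integrating the rate `decayK` over a half-line costs one power and leaves `decayM`. -/
theorem exists_integral_decayK_le {ρ : ℝ} (hρ : 0 < ρ) :
    ∃ C : ℝ, 0 < C ∧ ∀ y : ℝ, ∫ x in Ioi (0 : ℝ), decayK ρ (y - x) ≤ C * decayM ρ y := by
  have hI : 0 ≤ ∫ x, decayK ρ x := integral_nonneg (fun x => (decayK_pos ρ x).le)
  refine ⟨(∫ x, decayK ρ x) + 1 / ρ, by positivity, fun y => ?_⟩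
  rcases le_or_gt y 0 with hy | hy
  -- for `y ≤ 0` the integral equals `(1 - y)^(-ρ) / ρ`
  · have h1 : ∀ x ∈ Ioi (0 : ℝ), decayK ρ (y - x) = (x + (1 - y)) ^ (-(1 + ρ)) := by
      intro x hx
      unfold decayK
      rw [mem_Ioi] at hx
      rw [abs_of_nonpos (by linarith)]
      congr 1
      ring
    rw [setIntegral_congr_fun measurableSet_Ioi h1]
    have h2 : ∫ x in Ioi (0 : ℝ), (x + (1 - y)) ^ (-(1 + ρ)) =
        ∫ x in Ioi (0 + (1 - y)), x ^ (-(1 + ρ)) := by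
      have h := (measurePreserving_add_right volume (1 - y)).setIntegral_preimage_emb
        (measurableEmbedding_addRight _) (fun x : ℝ => x ^ (-(1 + ρ))) (Ioi (0 + (1 - y)))
      rw [← h]
      congr 2
      ext x
      simp
    rw [h2, integral_Ioi_rpow_of_lt (by linarith) (by linarith)]
    unfold decayM
    rw [max_eq_right (by linarith), zero_add, show -(1 + ρ) + 1 = -ρ by ring,
      show 1 + -y = 1 - y by ring, neg_div_neg_eq, div_eq_mul_one_div, mul_comm]
    refine mul_le_mul_of_nonneg_right (by linarith) (Real.rpow_nonneg (by linarith) _)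
  · have h1 : decayM ρ y = 1 := by
      unfold decayM
      rw [max_eq_left (by linarith)]
      simp
    rw [h1, mul_one]
    have h2 : ∫ x in Ioi (0 : ℝ), decayK ρ (y - x) ≤ ∫ x, decayK ρ (y - x) :=
      setIntegral_le_integral ((integrable_decayK hρ).comp_sub_left y)
        (Eventually.of_forall fun x => (decayK_pos ρ _).le)
    rw [integral_sub_left_eq_self (decayK ρ) volume y] at h2
    have : 0 < 1 / ρ := by positivity
    linarith

theorem tendsto_decayM_atBot {ρ : ℝ} (hρ : 0 < ρ) : Tendsto (decayM ρ) atBot (𝓝 0) := by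
  have h1 : Tendsto (fun y : ℝ => 1 + max 0 (-y)) atBot atTop := by
    refine tendsto_atTop_mono (fun y => ?_) tendsto_neg_atBot_atTop
    linarith [le_max_right 0 (-y)]
  exact (tendsto_rpow_neg_atTop hρ).comp h1

theorem one_le_weight (ε ρ : ℝ) (ξ : ℂ) : 1 ≤ weight ε ρ ξ := le_max_left _ _

theorem weight_eq {ρ : ℝ} (hρ : 0 < ρ) (ξ : ℂ) : weight 1 ρ ξ = max 1 ((max 0 (-ξ.re)) ^ ρ) := by
  unfold weight
  rcases lt_trichotomy ξ.re 0 with h | h | h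
  · rw [Real.sign_of_neg h, abs_of_neg h, max_eq_right (by linarith : (0 : ℝ) ≤ -ξ.re)]
    simp
  · simp [h, Real.zero_rpow hρ.ne']
  · rw [Real.sign_of_pos h, abs_of_pos h, max_eq_left (by linarith : -ξ.re ≤ (0 : ℝ)),
      Real.zero_rpow hρ.ne']
    have := Real.rpow_nonneg h.le ρ
    rw [max_eq_left (by linarith), max_eq_left (by linarith)]

theorem weight_mul_decayM_le {ρ : ℝ} (hρ : 0 < ρ) (ξ : ℂ) :
    weight 1 ρ ξ * decayM ρ ξ.re ≤ 1 := by
  rw [weight_eq hρ]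
  have h1 := one_le_one_add_max ξ.re
  unfold decayM
  rw [Real.rpow_neg (by linarith), ← div_eq_mul_inv, div_le_one (by positivity)]
  refine max_le (Real.one_le_rpow h1 hρ.le) (Real.rpow_le_rpow (le_max_left _ _) ?_ hρ.le)
  linarith

theorem weight_le_of_re_le {ρ : ℝ} (hρ : 0 < ρ) {ξ ξ' : ℂ} (h : ξ'.re ≤ ξ.re) :
    weight 1 ρ ξ ≤ weight 1 ρ ξ' := by
  rw [weight_eq hρ, weight_eq hρ]
  refine max_le_max le_rfl (Real.rpow_le_rpow (le_max_left _ _) ?_ hρ.le)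
  exact max_le_max le_rfl (by linarith)

theorem tendsto_inv_weight {ρ : ℝ} (hρ : 0 < ρ) :
    Tendsto (fun ξ => (weight 1 ρ ξ)⁻¹) (comap Complex.re atBot) (𝓝 0) := by
  refine Tendsto.inv_tendsto_atTop ?_
  have h1 : Tendsto (fun y : ℝ => (max 0 (-y)) ^ ρ) atBot atTop :=
    (tendsto_rpow_atTop hρ).comp
      (tendsto_atTop_mono (fun y => le_max_right 0 (-y)) tendsto_neg_atBot_atTop)
  refine tendsto_atTop_mono (fun ξ => ?_) (h1.comp tendsto_comap)
  rw [weight_eq hρ]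
  exact le_max_right _ _

/-! ### The standing hypotheses on a left-invariant domain -/

/-- `S` is open and invariant under translations to the left, and `φ`, `k` are holomorphic on `S`
with the decay on which the whole argument rests. -/
structure HasDecay (φ k : ℂ → ℂ) (S : Set ℂ) (ρ c : ℝ) : Prop where
  rho_pos : 0 < ρ
  c_pos : 0 < c
  isOpen : IsOpen S
  translate : ∀ s ∈ S, ∀ x : ℝ, 0 ≤ x → s - x ∈ S
  phi_diff : DifferentiableOn ℂ φ S
  k_diff : DifferentiableOn ℂ k S
  phi_le : ∀ s ∈ S, ‖φ s‖ ≤ c * decayM ρ s.re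
  phi_sq_le : ∀ s ∈ S, ‖φ s‖ ^ 2 ≤ c * decayK ρ s.re
  dphi_le : ∀ s ∈ S, ‖deriv φ s‖ ≤ c * decayK ρ s.re
  k_le : ∀ s ∈ S, ‖k s‖ ≤ c * decayK ρ s.re

theorem HasDecay.mono {φ k : ℂ → ℂ} {S T : Set ℂ} {ρ c : ℝ} (h : HasDecay φ k S ρ c)
    (hT : IsOpen T) (htr : ∀ s ∈ T, ∀ x : ℝ, 0 ≤ x → s - x ∈ T) (hTS : T ⊆ S) :
    HasDecay φ k T ρ c where
  rho_pos := h.rho_pos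
  c_pos := h.c_pos
  isOpen := hT
  translate := htr
  phi_diff := h.phi_diff.mono hTS
  k_diff := h.k_diff.mono hTS
  phi_le s hs := h.phi_le s (hTS hs)
  phi_sq_le s hs := h.phi_sq_le s (hTS hs)
  dphi_le s hs := h.dphi_le s (hTS hs)
  k_le s hs := h.k_le s (hTS hs)

theorem continuousOn_halfLine {S : Set ℂ} (htr : ∀ s ∈ S, ∀ x : ℝ, 0 ≤ x → s - x ∈ S)
    {E : Type*} [TopologicalSpace E] {f : ℂ → E}
    (hf : ContinuousOn f S) {ξ : ℂ} (hξ : ξ ∈ S) :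
    ContinuousOn (fun x : ℝ => f (ξ - x)) (Ici 0) :=
  hf.comp (by fun_prop) (fun x hx => htr ξ hξ x hx)

theorem integrableOn_halfLine_of_norm_le {S : Set ℂ}
    (htr : ∀ s ∈ S, ∀ x : ℝ, 0 ≤ x → s - x ∈ S) {E : Type*} [NormedAddCommGroup E] {f : ℂ → E}
    (hf : ContinuousOn f S) {ρ C : ℝ} (hρ : 0 < ρ) (hb : ∀ s ∈ S, ‖f s‖ ≤ C * decayK ρ s.re)
    {ξ : ℂ} (hξ : ξ ∈ S) : IntegrableOn (fun x : ℝ => f (ξ - x)) (Ioi 0) := by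
  refine ((integrableOn_decayK_sub hρ ξ.re).const_mul C).mono' ?_ ?_
  · exact ((continuousOn_halfLine htr hf hξ).mono Ioi_subset_Ici_self).aestronglyMeasurable
      measurableSet_Ioi
  · filter_upwards [ae_restrict_mem measurableSet_Ioi] with x hx
    simpa using hb _ (htr ξ hξ x (mem_Ioi.1 hx).le)

/-- The integral of `k · g(ν, ·)` over the half-line that ends at `s` is holomorphic in `(ν, s)`. -/
theorem differentiableOn_halfLine_integral {k : ℂ → ℂ} {S : Set ℂ} {ρ c : ℝ} (hρ : 0 < ρ)
    (hc : 0 < c)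
    (hk : DifferentiableOn ℂ k S) (hkb : ∀ s ∈ S, ‖k s‖ ≤ c * decayK ρ s.re)
    {W : Set (ℂ × ℂ)} (hW : IsOpen W) (hWS : ∀ p ∈ W, p.2 ∈ S)
    (htr : ∀ p ∈ W, ∀ x : ℝ, 0 ≤ x → (p.1, p.2 - x) ∈ W)
    {g : ℂ × ℂ → ℂ} (hg : DifferentiableOn ℂ g W) {b : ℂ → ℝ} (hb : Continuous b)
    (hgb : ∀ p ∈ W, ‖g p‖ ≤ b p.1) :
    DifferentiableOn ℂ (fun p : ℂ × ℂ => ∫ x in Ioi (0 : ℝ), k (p.2 - x) * g (p.1, p.2 - x)) W := by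
  have hcont : ContinuousOn (fun q : ℂ × ℂ => k q.2 * g q) W :=
    (hk.continuousOn.comp (by fun_prop) hWS).mul hg.continuousOn
  refine differentiableOn_integral_of_locally_dominated hW ?_ (fun p hp => ?_) (fun p hp => ?_)
  · filter_upwards [ae_restrict_mem measurableSet_Ioi] with x hx
    refine DifferentiableOn.mul (hk.comp (by fun_prop) fun p hp => ?_)
      (hg.comp (by fun_prop) fun p hp => htr p hp x (mem_Ioi.1 hx).le)
    exact hWS _ (htr p hp x (mem_Ioi.1 hx).le)
  · refine ContinuousOn.aestronglyMeasurable (s := Ioi (0 : ℝ)) ?_ measurableSet_Ioi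
    exact hcont.comp (f := fun x : ℝ => (p.1, p.2 - (x : ℂ))) (by fun_prop)
      (fun x hx => htr p hp x (mem_Ioi.1 hx).le)
  · obtain ⟨r, hr, hrb⟩ := Metric.eventually_nhds_iff_ball.1
      ((hb.tendsto p.1).eventually (gt_mem_nhds (lt_add_one (b p.1))))
    refine ⟨min r 1, by positivity,
      fun x => c * (2 ^ (1 + ρ) * decayK ρ (p.2.re - x)) * (b p.1 + 1),
      ((((integrableOn_decayK_sub hρ p.2.re).const_mul _).const_mul _).mul_const _), ?_⟩
    filter_upwards [ae_restrict_mem measurableSet_Ioi] with x hx q hq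
    have hqx := htr q hq.2 x (mem_Ioi.1 hx).le
    have hq1 : dist q.1 p.1 < r ∧ dist q.2 p.2 < 1 := by
      have h := hq.1
      rw [Metric.mem_ball, Prod.dist_eq, max_lt_iff, lt_min_iff, lt_min_iff] at h
      exact ⟨h.1.1, h.2.2⟩
    rw [norm_mul]
    refine mul_le_mul ((hkb _ (hWS _ hqx)).trans ?_) ((hgb _ hqx).trans (hrb q.1 hq1.1).le)
      (norm_nonneg _) (by have := decayK_pos ρ (p.2.re - x); positivity)
    refine mul_le_mul_of_nonneg_left (decayK_near hρ ?_) hc.le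
    have h2 := (Complex.abs_re_le_norm (q.2 - p.2)).trans (dist_eq_norm q.2 p.2 ▸ hq1.2.le)
    rw [abs_sub_comm]
    simpa using h2

/-- The integral over the half-line that ends at `ξ` is a primitive. -/
theorem hasDerivAt_halfLine_integral {f : ℂ → ℂ} {S : Set ℂ} {ρ c : ℝ} (hρ : 0 < ρ) (hc : 0 < c)
    (hS : IsOpen S) (htr : ∀ s ∈ S, ∀ x : ℝ, 0 ≤ x → s - x ∈ S) (hf : DifferentiableOn ℂ f S)
    (hb : ∀ s ∈ S, ‖f s‖ ≤ c * decayK ρ s.re) {ξ : ℂ} (hξ : ξ ∈ S) :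
    HasDerivAt (fun ξ => ∫ x in Ioi (0 : ℝ), f (ξ - x)) (f ξ) ξ := by
  obtain ⟨hi, hd⟩ := hasDerivAt_integral_of_locally_dominated
    (μ := volume.restrict (Ioi (0 : ℝ))) hS (f := fun ξ x => f (ξ - x))
    (by filter_upwards [ae_restrict_mem measurableSet_Ioi] with x hx
          using hf.comp (by fun_prop) fun p hp => htr p hp x (mem_Ioi.1 hx).le)
    (fun y hy => ((continuousOn_halfLine htr hf.continuousOn hy).mono
      Ioi_subset_Ici_self).aestronglyMeasurable measurableSet_Ioi) hξ one_pos
    (g := fun x => c * (2 ^ (1 + ρ) * decayK ρ (ξ.re - x)))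
    (((integrableOn_decayK_sub hρ ξ.re).const_mul _).const_mul _)
    (by
      filter_upwards [ae_restrict_mem measurableSet_Ioi] with x hx q hq
      refine (hb _ (htr q hq.2 x (mem_Ioi.1 hx).le)).trans
        (mul_le_mul_of_nonneg_left (decayK_near hρ ?_) hc.le)
      have h1 := hq.1
      rw [Metric.mem_ball, dist_eq_norm] at h1
      have h2 := (Complex.abs_re_le_norm (q - ξ)).trans h1.le
      rw [abs_sub_comm]
      simpa using h2)
  have hder : ∀ x ∈ Ici (0 : ℝ), HasDerivAt (fun x : ℝ => f (ξ - x)) (-deriv f (ξ - x)) x := by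
    intro x hx
    have h1 := (hf.differentiableAt (hS.mem_nhds (htr ξ hξ x hx))).hasDerivAt
    have h0 : HasDerivAt (fun x : ℝ => ξ - (x : ℂ)) (-1) x := by
      simpa using (Complex.ofRealCLM.hasDerivAt (x := x)).const_sub ξ
    exact (HasDerivAt.comp (h₂ := f) x h1 h0).congr_deriv (by ring)
  have hdx : ∀ x : ℝ, deriv (fun y => f (y - x)) ξ = deriv f (ξ - x) := fun x =>
    deriv_comp_sub_const f (x : ℂ) ξ
  simp only [hdx] at hi hd
  have hlim : Tendsto (fun x : ℝ => f (ξ - x)) atTop (𝓝 0) := by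
    have h1 : Tendsto (fun x : ℝ => c * decayK ρ (ξ.re - x)) atTop (𝓝 0) := by
      have h2 : Tendsto (fun x : ℝ => 1 + |ξ.re - x|) atTop atTop :=
        tendsto_atTop_add_const_left _ _ (tendsto_abs_atBot_atTop.comp
          (tendsto_atBot_add_const_left _ _ tendsto_neg_atTop_atBot))
      have h3 := ((tendsto_rpow_neg_atTop (by linarith : 0 < 1 + ρ)).comp h2).const_mul c
      rwa [mul_zero] at h3
    refine squeeze_zero_norm' ?_ h1
    filter_upwards [eventually_ge_atTop 0] with x hx
    simpa using hb _ (htr ξ hξ x hx)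
  have hft := integral_Ioi_of_hasDerivAt_of_tendsto' hder hi.neg hlim
  rw [integral_neg] at hft
  simp only [Complex.ofReal_zero, sub_zero, zero_sub, neg_inj] at hft
  rw [hft] at hd
  exact hd

/-! ### The integral equation along characteristics -/

/-- The pairs `(τ, ξ)` for which the segment from `ξ - τ` to `ξ` lies in `S`: the natural domain of
the Borel transform, as a function of `τ = t / 2` and `ξ`. -/
def charDomain (S : Set ℂ) : Set (ℂ × ℂ) := {p | ∀ l ∈ Icc (0 : ℝ) 1, p.2 - l * p.1 ∈ S}

theorem isOpen_charDomain {S : Set ℂ} (hS : IsOpen S) : IsOpen (charDomain S) := by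
  rw [isOpen_iff_mem_nhds]
  intro p hp
  refine (isCompact_Icc (a := (0 : ℝ)) (b := 1)).eventually_forall_of_forall_eventually
    (P := fun (q : ℂ × ℂ) (l : ℝ) => q.2 - l * q.1 ∈ S) (fun l hl => ?_)
  have hc : Continuous fun z : (ℂ × ℂ) × ℝ => z.1.2 - (z.2 : ℂ) * z.1.1 := by fun_prop
  exact hc.continuousAt.eventually_mem (hS.mem_nhds (hp l hl))

theorem snd_mem_of_mem_charDomain {S : Set ℂ} {p : ℂ × ℂ} (hp : p ∈ charDomain S) : p.2 ∈ S := by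
  simpa using hp 0 (by simp)

theorem sub_mem_of_mem_charDomain {S : Set ℂ} {p : ℂ × ℂ} (hp : p ∈ charDomain S) :
    p.2 - p.1 ∈ S := by
  simpa using hp 1 (by simp)

theorem charDomain_translate {S : Set ℂ} (htr : ∀ s ∈ S, ∀ x : ℝ, 0 ≤ x → s - x ∈ S) {p : ℂ × ℂ}
    (hp : p ∈ charDomain S) {x : ℝ} (hx : 0 ≤ x) : (p.1, p.2 - (x : ℂ)) ∈ charDomain S := by
  intro l hl
  have h := htr _ (hp l hl) x hx
  rwa [sub_right_comm] at h

theorem charDomain_retract {S : Set ℂ} {p : ℂ × ℂ} (hp : p ∈ charDomain S) {l : ℝ}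
    (hl : l ∈ Icc (0 : ℝ) 1) : (l * p.1, p.2 - (1 - l) * p.1) ∈ charDomain S := by
  intro l' hl'
  have h := hp (1 - l + l' * l) ⟨by nlinarith [hl.1, hl.2, hl'.1], by nlinarith [hl.1, hl.2, hl'.2]⟩
  convert h using 1
  push_cast
  ring

/-- The zeroth-order part `φ g + ∫ k g` of the equation for the Borel transform. -/
def bulk (φ k : ℂ → ℂ) (g : ℂ × ℂ → ℂ) (p : ℂ × ℂ) : ℂ :=
  φ p.2 * g p + ∫ x in Ioi (0 : ℝ), k (p.2 - x) * g (p.1, p.2 - x)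

/-- The integral of `bulk φ k g` along the characteristic that ends at `p`, with a minus sign. -/
def picard (φ k : ℂ → ℂ) (g : ℂ × ℂ → ℂ) (p : ℂ × ℂ) : ℂ :=
  -p.1 * ∫ l in Ioc (0 : ℝ) 1, bulk φ k g (l * p.1, p.2 - (1 - l) * p.1)

/-- `g` is holomorphic on `charDomain S`, of exponential type in the first variable, and decays in
`ξ - τ`, the quantity that is constant along characteristics. -/
structure Controlled (S : Set ℂ) (ρ L K : ℝ) (g : ℂ × ℂ → ℂ) : Prop where
  diff : DifferentiableOn ℂ g (charDomain S)
  bound : ∀ p ∈ charDomain S, ‖g p‖ ≤ K * (Real.exp (L * ‖p.1‖) * decayM ρ (p.2.re - p.1.re))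

section

variable {φ k : ℂ → ℂ} {S : Set ℂ} {ρ c L K K' : ℝ} {g g' : ℂ × ℂ → ℂ}

theorem Controlled.congr (h : Controlled S ρ L K g) (he : EqOn g' g (charDomain S)) :
    Controlled S ρ L K g' :=
  ⟨h.diff.congr he, fun p hp => by rw [he hp]; exact h.bound p hp⟩

theorem Controlled.bound_fst (h : Controlled S ρ L K g) (hρ : 0 < ρ) (hK : 0 ≤ K) {p : ℂ × ℂ}
    (hp : p ∈ charDomain S) : ‖g p‖ ≤ K * Real.exp (L * ‖p.1‖) := by
  refine (h.bound p hp).trans (mul_le_mul_of_nonneg_left ?_ hK)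
  have := decayM_le_one hρ (p.2.re - p.1.re)
  nlinarith [Real.exp_pos (L * ‖p.1‖)]

theorem Controlled.bulk_integrable (h : Controlled S ρ L K g) (hD : HasDecay φ k S ρ c)
    (hK : 0 ≤ K) {p : ℂ × ℂ} (hp : p ∈ charDomain S) :
    IntegrableOn (fun x : ℝ => k (p.2 - x) * g (p.1, p.2 - x)) (Ioi 0) := by
  have hmem : ∀ x ∈ Ioi (0 : ℝ), (p.1, p.2 - (x : ℂ)) ∈ charDomain S := fun x hx =>
    charDomain_translate hD.translate hp (mem_Ioi.1 hx).le
  refine ((integrableOn_decayK_sub hD.rho_pos p.2.re).const_mul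
    (c * (K * Real.exp (L * ‖p.1‖)))).mono' ?_ ?_
  · refine ContinuousOn.aestronglyMeasurable (s := Ioi (0 : ℝ)) (ContinuousOn.mul ?_ ?_)
      measurableSet_Ioi
    · exact hD.k_diff.continuousOn.comp (f := fun x : ℝ => p.2 - (x : ℂ)) (by fun_prop)
        (fun x hx => snd_mem_of_mem_charDomain (hmem x hx))
    · exact h.diff.continuousOn.comp (f := fun x : ℝ => (p.1, p.2 - (x : ℂ))) (by fun_prop) hmem
  · filter_upwards [ae_restrict_mem measurableSet_Ioi] with x hx
    have h1 := hD.k_le _ (snd_mem_of_mem_charDomain (hmem x hx))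
    have h2 := h.bound_fst hD.rho_pos hK (hmem x hx)
    rw [norm_mul]
    refine (mul_le_mul h1 h2 (norm_nonneg _) ((norm_nonneg _).trans h1)).trans (le_of_eq ?_)
    simp
    ring

theorem Controlled.bulk_diff (h : Controlled S ρ L K g) (hD : HasDecay φ k S ρ c)
    (hK : 0 ≤ K) : DifferentiableOn ℂ (bulk φ k g) (charDomain S) := by
  refine DifferentiableOn.add (DifferentiableOn.mul (hD.phi_diff.comp (by fun_prop)
    (fun p hp => snd_mem_of_mem_charDomain hp)) h.diff) ?_
  exact differentiableOn_halfLine_integral hD.rho_pos hD.c_pos hD.k_diff hD.k_le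
    (isOpen_charDomain hD.isOpen) (fun p hp => snd_mem_of_mem_charDomain hp)
    (fun p hp x hx => charDomain_translate hD.translate hp hx) h.diff
    (b := fun ν => K * Real.exp (L * ‖ν‖)) (by fun_prop)
    (fun p hp => h.bound_fst hD.rho_pos hK hp)

theorem Controlled.bulk_bound (h : Controlled S ρ L K g) (hD : HasDecay φ k S ρ c)
    (hK : 0 ≤ K) {C : ℝ} (hC : 0 < C)
    (hCb : ∀ y : ℝ, ∫ x in Ioi (0 : ℝ), decayK ρ (y - x) ≤ C * decayM ρ y) {p : ℂ × ℂ}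
    (hp : p ∈ charDomain S) : ‖bulk φ k g p‖ ≤
      c * (1 + C) * K * (Real.exp (L * ‖p.1‖) * decayM ρ (p.2.re - p.1.re)) := by
  have hmem : ∀ x ∈ Ioi (0 : ℝ), (p.1, p.2 - (x : ℂ)) ∈ charDomain S := fun x hx =>
    charDomain_translate hD.translate hp (mem_Ioi.1 hx).le
  set Q := K * (Real.exp (L * ‖p.1‖) * decayM ρ (p.2.re - p.1.re)) with hQ
  have hQ0 : 0 ≤ Q := by
    have := decayM_pos ρ (p.2.re - p.1.re)
    positivity
  have h1 : ‖φ p.2 * g p‖ ≤ c * Q := by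
    rw [norm_mul]
    refine mul_le_mul ?_ (h.bound p hp) (norm_nonneg _) hD.c_pos.le
    refine (hD.phi_le _ (snd_mem_of_mem_charDomain hp)).trans ?_
    exact mul_le_of_le_one_right hD.c_pos.le (decayM_le_one hD.rho_pos _)
  have h2 : ‖∫ x in Ioi (0 : ℝ), k (p.2 - x) * g (p.1, p.2 - x)‖ ≤ c * C * Q := by
    have h3 : ‖∫ x in Ioi (0 : ℝ), k (p.2 - x) * g (p.1, p.2 - x)‖ ≤
        ∫ x in Ioi (0 : ℝ), c * Q * decayK ρ (p.2.re - x) := by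
      refine norm_integral_le_of_norm_le
        ((integrableOn_decayK_sub hD.rho_pos p.2.re).const_mul _) ?_
      filter_upwards [ae_restrict_mem measurableSet_Ioi] with x hx
      have h4 := hD.k_le _ (snd_mem_of_mem_charDomain (hmem x hx))
      have h5 : ‖g (p.1, p.2 - x)‖ ≤ Q := by
        refine (h.bound _ (hmem x hx)).trans (mul_le_mul_of_nonneg_left
          (mul_le_mul_of_nonneg_left (decayM_mono hD.rho_pos ?_) (Real.exp_pos _).le) hK)
        have := mem_Ioi.1 hx
        simp only [sub_re, ofReal_re]
        linarith
      rw [norm_mul]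
      refine (mul_le_mul h4 h5 (norm_nonneg _) ((norm_nonneg _).trans h4)).trans (le_of_eq ?_)
      simp
      ring
    refine h3.trans ?_
    rw [integral_const_mul]
    have h6 := (hCb p.2.re).trans (mul_le_of_le_one_right hC.le (decayM_le_one hD.rho_pos _))
    have : 0 ≤ c * Q := mul_nonneg hD.c_pos.le hQ0
    nlinarith
  calc ‖bulk φ k g p‖ ≤ c * Q + c * C * Q := (norm_add_le _ _).trans (add_le_add h1 h2)
    _ = _ := by rw [hQ]; ring

theorem mul_integral_exp_le {L T : ℝ} (hL : 0 < L) :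
    T * ∫ l in Ioc (0 : ℝ) 1, Real.exp (L * (l * T)) ≤ Real.exp (L * T) / L := by
  have hder : ∀ l ∈ uIcc (0 : ℝ) 1, HasDerivAt (fun l : ℝ => Real.exp (L * (l * T)) / L)
      (T * Real.exp (L * (l * T))) l := by
    intro l _
    have h1 : HasDerivAt (fun l : ℝ => L * (l * T)) (L * T) l := by
      simpa using ((hasDerivAt_id l).mul_const T).const_mul L
    refine (h1.exp.div_const L).congr_deriv ?_
    field_simp
  have h := intervalIntegral.integral_eq_sub_of_hasDerivAt hder
    (by apply Continuous.intervalIntegrable; fun_prop)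
  rw [← integral_const_mul, ← intervalIntegral.integral_of_le zero_le_one, h]
  simp
  positivity

theorem Controlled.bulk_char_continuousOn (h : Controlled S ρ L K g) (hD : HasDecay φ k S ρ c)
    (hK : 0 ≤ K) : ContinuousOn (fun q : (ℂ × ℂ) × ℝ =>
      bulk φ k g (q.2 * q.1.1, q.1.2 - (1 - q.2) * q.1.1)) (charDomain S ×ˢ Icc 0 1) :=
  (h.bulk_diff hD hK).continuousOn.comp
    (f := fun q : (ℂ × ℂ) × ℝ => ((q.2 : ℂ) * q.1.1, q.1.2 - (1 - (q.2 : ℂ)) * q.1.1))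
    (by fun_prop) (fun _ hq => charDomain_retract hq.1 hq.2)

theorem Controlled.picard (h : Controlled S ρ L K g) (hD : HasDecay φ k S ρ c)
    (hK : 0 ≤ K) {C : ℝ} (hC : 0 < C)
    (hCb : ∀ y : ℝ, ∫ x in Ioi (0 : ℝ), decayK ρ (y - x) ≤ C * decayM ρ y)
    (hL : L = 2 * (c * (1 + C))) : Controlled S ρ L (K / 2) (picard φ k g) := by
  have hc := hD.c_pos
  have hL0 : 0 < L := by rw [hL]; positivity
  refine ⟨?_, fun p hp => ?_⟩
  · refine DifferentiableOn.mul (by fun_prop) ?_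
    refine differentiableOn_setIntegral_Ioc (isOpen_charDomain hD.isOpen)
      (f := fun (p : ℂ × ℂ) (l : ℝ) => bulk φ k g (l * p.1, p.2 - (1 - l) * p.1))
      (h.bulk_char_continuousOn hD hK) (fun l hl => ?_)
    exact (h.bulk_diff hD hK).comp
      (f := fun p : ℂ × ℂ => ((l : ℂ) * p.1, p.2 - (1 - (l : ℂ)) * p.1)) (by fun_prop)
      (fun p hp => charDomain_retract hp hl)
  · set m := decayM ρ (p.2.re - p.1.re) with hm
    have hm0 : 0 < m := decayM_pos _ _
    have h1 : ‖∫ l in Ioc (0 : ℝ) 1, bulk φ k g (l * p.1, p.2 - (1 - l) * p.1)‖ ≤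
        ∫ l in Ioc (0 : ℝ) 1, c * (1 + C) * K * m * Real.exp (L * (l * ‖p.1‖)) := by
      refine norm_integral_le_of_norm_le ?_ ?_
      · apply Continuous.integrableOn_Ioc
        fun_prop
      · filter_upwards [ae_restrict_mem measurableSet_Ioc] with l hl
        have hl' : l ∈ Icc (0 : ℝ) 1 := Ioc_subset_Icc_self hl
        refine (h.bulk_bound hD hK hC hCb (charDomain_retract hp hl')).trans (le_of_eq ?_)
        have e1 : (p.2 - (1 - (l : ℂ)) * p.1).re - ((l : ℂ) * p.1).re = p.2.re - p.1.re := by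
          simp
          ring
        simp only [e1, norm_mul, Complex.norm_real, Real.norm_of_nonneg hl'.1]
        ring
    rw [integral_const_mul] at h1
    have h2 := mul_integral_exp_le (T := ‖p.1‖) hL0
    have hA : 0 ≤ c * (1 + C) * K * m := by positivity
    calc ‖WKB.picard φ k g p‖ = ‖p.1‖ *
        ‖∫ l in Ioc (0 : ℝ) 1, bulk φ k g (l * p.1, p.2 - (1 - l) * p.1)‖ := by
          rw [WKB.picard, norm_mul, norm_neg]
      _ ≤ ‖p.1‖ * (c * (1 + C) * K * m * ∫ l in Ioc (0 : ℝ) 1, Real.exp (L * (l * ‖p.1‖))) :=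
          mul_le_mul_of_nonneg_left h1 (norm_nonneg _)
      _ = c * (1 + C) * K * m * (‖p.1‖ * ∫ l in Ioc (0 : ℝ) 1, Real.exp (L * (l * ‖p.1‖))) := by
          ring
      _ ≤ c * (1 + C) * K * m * (Real.exp (L * ‖p.1‖) / L) := mul_le_mul_of_nonneg_left h2 hA
      _ = K / 2 * (Real.exp (L * ‖p.1‖) * m) := by
          rw [hL]
          field_simp

theorem bulk_sub (h : Controlled S ρ L K g) (h' : Controlled S ρ L K' g')
    (hD : HasDecay φ k S ρ c) (hK : 0 ≤ K) (hK' : 0 ≤ K') {p : ℂ × ℂ} (hp : p ∈ charDomain S) :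
    bulk φ k (fun q => g q - g' q) p = bulk φ k g p - bulk φ k g' p := by
  unfold bulk
  simp only [mul_sub]
  rw [integral_sub (h.bulk_integrable hD hK hp) (h'.bulk_integrable hD hK' hp)]
  ring

theorem picard_sub (h : Controlled S ρ L K g) (h' : Controlled S ρ L K' g')
    (hD : HasDecay φ k S ρ c) (hK : 0 ≤ K) (hK' : 0 ≤ K') {p : ℂ × ℂ} (hp : p ∈ charDomain S) :
    picard φ k (fun q => g q - g' q) p = picard φ k g p - picard φ k g' p := by
  have hint : ∀ {G : ℂ × ℂ → ℂ} {B : ℝ}, Controlled S ρ L B G → 0 ≤ B →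
      IntegrableOn (fun l : ℝ => bulk φ k G (l * p.1, p.2 - (1 - l) * p.1)) (Ioc 0 1) := by
    intro G B hG hB
    have h1 : ContinuousOn (fun l : ℝ => bulk φ k G (l * p.1, p.2 - (1 - l) * p.1)) (Icc 0 1) :=
      (hG.bulk_char_continuousOn hD hB).comp (f := fun l : ℝ => (p, l)) (by fun_prop)
        (fun l hl => ⟨hp, hl⟩)
    exact h1.integrableOn_Icc.mono_set Ioc_subset_Icc_self
  have h2 : ∫ l in Ioc (0 : ℝ) 1, bulk φ k (fun q => g q - g' q) (l * p.1, p.2 - (1 - l) * p.1) =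
      ∫ l in Ioc (0 : ℝ) 1, (bulk φ k g (l * p.1, p.2 - (1 - l) * p.1) -
        bulk φ k g' (l * p.1, p.2 - (1 - l) * p.1)) :=
    setIntegral_congr_fun measurableSet_Ioc (fun l hl =>
      bulk_sub h h' hD hK hK' (charDomain_retract hp (Ioc_subset_Icc_self hl)))
  unfold picard
  rw [h2, integral_sub (hint h hK) (hint h' hK')]
  ring

/-- The coefficient `A_1` (for the upper signs): the initial value of the Borel transform. -/
def initialA (φ k : ℂ → ℂ) (s : ℂ) : ℂ :=
  -(1 / 2) * φ s - 1 / 2 * ∫ x in Ioi (0 : ℝ), k (s - x)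

theorem differentiableOn_initialA (hD : HasDecay φ k S ρ c) :
    DifferentiableOn ℂ (initialA φ k) S := by
  refine DifferentiableOn.sub (hD.phi_diff.const_mul _) (DifferentiableOn.const_mul ?_ _)
  intro s hs
  exact (hasDerivAt_halfLine_integral hD.rho_pos hD.c_pos hD.isOpen hD.translate hD.k_diff hD.k_le
    hs).differentiableAt.differentiableWithinAt

theorem norm_initialA_le (hD : HasDecay φ k S ρ c) {C : ℝ}
    (hCb : ∀ y : ℝ, ∫ x in Ioi (0 : ℝ), decayK ρ (y - x) ≤ C * decayM ρ y) {s : ℂ} (hs : s ∈ S) :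
    ‖initialA φ k s‖ ≤ c * (1 + C) * decayM ρ s.re := by
  have h1 := hD.phi_le s hs
  have h2 : ‖∫ x in Ioi (0 : ℝ), k (s - x)‖ ≤ c * (C * decayM ρ s.re) := by
    refine (norm_integral_le_of_norm_le ((integrableOn_decayK_sub hD.rho_pos s.re).const_mul c)
      ?_).trans ?_
    · filter_upwards [ae_restrict_mem measurableSet_Ioi] with x hx
      simpa using hD.k_le _ (hD.translate s hs x (mem_Ioi.1 hx).le)
    · rw [integral_const_mul]
      exact mul_le_mul_of_nonneg_left (hCb _) hD.c_pos.le
  calc ‖initialA φ k s‖ ≤ ‖-(1 / 2) * φ s‖ + ‖1 / 2 * ∫ x in Ioi (0 : ℝ), k (s - x)‖ :=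
        norm_sub_le _ _
    _ = 1 / 2 * ‖φ s‖ + 1 / 2 * ‖∫ x in Ioi (0 : ℝ), k (s - x)‖ := by
        rw [norm_mul, norm_mul]
        norm_num
    _ ≤ _ := by nlinarith [norm_nonneg (φ s), norm_nonneg (∫ x in Ioi (0 : ℝ), k (s - x))]

end

/-- A series of holomorphic functions of several variables with a summable bound, up to a continuous
factor, has a holomorphic sum: Cauchy's estimate bounds the derivatives locally uniformly. -/
theorem differentiableOn_tsum_of_norm_le_mul {E : Type*} [NormedAddCommGroup E] [NormedSpace ℂ E]
    {U : Set E} (hU : IsOpen U) {f : ℕ → E → ℂ} (hf : ∀ n, DifferentiableOn ℂ (f n) U)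
    {u : ℕ → ℝ} (hu : Summable u) (hu0 : ∀ n, 0 ≤ u n) {b : E → ℝ} (hb : Continuous b)
    (hfb : ∀ n, ∀ x ∈ U, ‖f n x‖ ≤ u n * b x) :
    DifferentiableOn ℂ (fun x => ∑' n, f n x) U := by
  let : NormedSpace ℝ E := NormedSpace.restrictScalars ℝ ℂ E
  intro x hx
  have hev := (hU.eventually_mem hx).and
    ((hb.tendsto x).eventually (gt_mem_nhds (lt_add_one (b x))))
  obtain ⟨R, hR, hRU⟩ := Metric.eventually_nhds_iff_ball.1 hev
  have hsub : ∀ y ∈ Metric.ball x (R / 2), Metric.ball y (R / 2) ⊆ Metric.ball x R := by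
    intro y hy
    refine Metric.ball_subset_ball' ?_
    rw [Metric.mem_ball] at hy
    linarith
  have hx' : x ∈ Metric.ball x (R / 2) := Metric.mem_ball_self (half_pos hR)
  refine (hasFDerivAt_tsum_of_isPreconnected (𝕜 := ℂ)
    (u := fun n => 2 * (u n * (b x + 1)) / (R / 2))
    (((hu.mul_right _).mul_left 2).div_const _) (Metric.isOpen_ball (x := x) (ε := R / 2))
    (convex_ball x (R / 2)).isPreconnected
    (f := f) (f' := fun n y => fderiv ℂ (f n) y) (fun n y hy => ?_) (fun n y hy => ?_) hx' ?_
    hx').differentiableAt.differentiableWithinAt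
  · exact ((hf n).differentiableAt (hU.mem_nhds
      (hRU y (Metric.ball_subset_ball (by linarith) hy)).1)).hasFDerivAt
  · refine norm_fderiv_le_of_norm_le_ball (half_pos hR)
      ((hf n).mono (fun z hz => (hRU z (hsub y hy hz)).1)) (fun z hz => ?_)
    have hz' := hRU z (hsub y hy hz)
    exact (hfb n z hz'.1).trans (mul_le_mul_of_nonneg_left hz'.2.le (hu0 n))
  · exact Summable.of_norm_bounded (hu.mul_right (b x)) (fun n => hfb n x hx)

section

variable {φ k : ℂ → ℂ} {S : Set ℂ} {ρ c : ℝ}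

/-- The successive approximations converge to a solution of the integral equation. -/
theorem exists_solution_integral_equation (hD : HasDecay φ k S ρ c) :
    ∃ L K : ℝ, ∃ g : ℂ × ℂ → ℂ, 0 < L ∧ 0 < K ∧ Controlled S ρ L K g ∧
      ∀ p ∈ charDomain S, g p = initialA φ k (p.2 - p.1) + picard φ k g p := by
  obtain ⟨C, hC, hCb⟩ := exists_integral_decayK_le hD.rho_pos
  have hc := hD.c_pos
  -- with this exponential rate, `picard` contracts with factor `1 / 2`
  obtain ⟨L, hL⟩ : ∃ L, L = 2 * (c * (1 + C)) := ⟨_, rfl⟩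
  obtain ⟨K, hK⟩ : ∃ K, K = c * (1 + C) := ⟨_, rfl⟩
  have hL0 : 0 < L := by rw [hL]; positivity
  have hK0 : 0 < K := by rw [hK]; positivity
  set g0 : ℂ × ℂ → ℂ := fun p => initialA φ k (p.2 - p.1) with hg0
  have hg0c : Controlled S ρ L K g0 := by
    refine ⟨(differentiableOn_initialA hD).comp (by fun_prop)
      (fun p hp => sub_mem_of_mem_charDomain hp), fun p hp => ?_⟩
    refine (norm_initialA_le hD hCb (sub_mem_of_mem_charDomain hp)).trans ?_
    rw [← hK, sub_re]
    refine mul_le_mul_of_nonneg_left ?_ hK0.le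
    refine le_mul_of_one_le_left (decayM_pos _ _).le (Real.one_le_exp (by positivity))
  set P : ℕ → ℂ × ℂ → ℂ := fun n => Nat.rec (fun _ => 0) (fun _ G p => g0 p + picard φ k G p) n
    with hP
  have hP0 : P 0 = fun _ => 0 := rfl
  have hPs : ∀ n, P (n + 1) = fun p => g0 p + picard φ k (P n) p := fun n => rfl
  -- each iterate is controlled, and so are the differences, with geometrically decreasing constants
  have hPc : ∀ n, ∃ B, 0 ≤ B ∧ Controlled S ρ L B (P n) := by
    intro n
    induction n with
    | zero => exact ⟨0, le_rfl, by rw [hP0]; exact differentiableOn_const _, fun p _ => by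
        rw [hP0]; simp⟩
    | succ n ih =>
      obtain ⟨B, hB, hBc⟩ := ih
      have h1 := hBc.picard hD hB hC hCb hL
      refine ⟨K + B / 2, by positivity, hg0c.diff.add h1.diff, fun p hp => ?_⟩
      rw [hPs, add_mul]
      exact (norm_add_le _ _).trans (add_le_add (hg0c.bound p hp) (h1.bound p hp))
  have hdc : ∀ n, Controlled S ρ L (K / 2 ^ n) (fun p => P (n + 1) p - P n p) := by
    intro n
    induction n with
    | zero =>
      have h1 : EqOn (fun p => P (0 + 1) p - P 0 p) g0 (charDomain S) := by
        intro p hp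
        simp [hPs, hP0, picard, bulk]
      simpa using hg0c.congr h1
    | succ n ih =>
      obtain ⟨B, hB, hBc⟩ := hPc n
      obtain ⟨B', hB', hBc'⟩ := hPc (n + 1)
      have h1 : EqOn (fun p => P (n + 1 + 1) p - P (n + 1) p)
          (picard φ k (fun p => P (n + 1) p - P n p)) (charDomain S) := by
        intro p hp
        rw [picard_sub hBc' hBc hD hB' hB hp]
        simp only [hPs]
        ring
      have h2 := (ih.picard hD (by positivity) hC hCb hL).congr h1
      rwa [div_div, ← pow_succ] at h2
  set w : ℂ × ℂ → ℝ := fun p => Real.exp (L * ‖p.1‖) * decayM ρ (p.2.re - p.1.re) with hw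
  have hw0 : ∀ p, 0 < w p := fun p => mul_pos (Real.exp_pos _) (decayM_pos _ _)
  have hwc : Continuous w := by
    have h1 : Continuous (decayM ρ) := by
      unfold decayM
      refine Continuous.rpow_const (by fun_prop) (fun y => Or.inl ?_)
      linarith [one_le_one_add_max y]
    rw [hw]
    exact Continuous.mul (by fun_prop) (h1.comp (by fun_prop))
  have hu : Summable (fun n : ℕ => K / 2 ^ n) := by
    have := (summable_geometric_two).mul_left K
    refine this.congr (fun n => ?_)
    rw [one_div, inv_pow, div_eq_mul_inv]
  set g : ℂ × ℂ → ℂ := fun p => ∑' n, (P (n + 1) p - P n p) with hg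
  have hgd : DifferentiableOn ℂ g (charDomain S) :=
    differentiableOn_tsum_of_norm_le_mul (isOpen_charDomain hD.isOpen)
      (f := fun n p => P (n + 1) p - P n p) (fun n => (hdc n).diff) hu
      (fun n => by positivity) hwc (fun n p hp => (hdc n).bound p hp)
  have hlim : ∀ p ∈ charDomain S, Tendsto (fun n => P n p) atTop (𝓝 (g p)) := by
    intro p hp
    have h1 : Summable (fun n => P (n + 1) p - P n p) :=
      Summable.of_norm_bounded (hu.mul_right (w p)) (fun n => (hdc n).bound p hp)
    have h2 := h1.hasSum.tendsto_sum_nat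
    refine h2.congr (fun n => ?_)
    rw [Finset.sum_range_sub (fun n => P n p)]
    simp [hP0]
  have hgP : ∀ n, Controlled S ρ L (2 * K / 2 ^ n) (fun p => P n p - g p) := by
    intro n
    obtain ⟨B, hB, hBc⟩ := hPc n
    refine ⟨hBc.diff.sub hgd, fun p hp => ?_⟩
    have h1 := dist_le_of_le_geometric_two_of_tendsto (f := fun n => P n p)
      (C := 2 * K * w p) (fun n => ?_) (hlim p hp) n
    · rw [dist_eq_norm] at h1
      refine h1.trans (le_of_eq ?_)
      rw [hw]
      ring
    · rw [dist_comm, dist_eq_norm]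
      refine ((hdc n).bound p hp).trans (le_of_eq ?_)
      rw [hw]
      ring
  have hgc : Controlled S ρ L (2 * K) g := by
    refine ⟨hgd, fun p hp => ?_⟩
    simpa [hP0] using (hgP 0).bound p hp
  refine ⟨L, 2 * K, g, hL0, by positivity, hgc, fun p hp => ?_⟩
  have h1 : Tendsto (fun n => P (n + 1) p - (g0 p + picard φ k g p)) atTop (𝓝 0) := by
    refine squeeze_zero_norm (a := fun n : ℕ => K * w p * (1 / 2) ^ n) (fun n => ?_) ?_
    · obtain ⟨B, hB, hBc⟩ := hPc n
      have h2 := ((hgP n).picard hD (by positivity) hC hCb hL).bound p hp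
      rw [picard_sub hBc hgc hD hB (by positivity) hp] at h2
      simp only [hPs, add_sub_add_left_eq_sub]
      refine h2.trans (le_of_eq ?_)
      simp only [hw, one_div, inv_pow]
      field_simp
    · have := (tendsto_pow_atTop_nhds_zero_of_lt_one (r := (1 / 2 : ℝ)) (by norm_num)
        (by norm_num)).const_mul (K * w p)
      simpa using this
  have h2 := ((hlim p hp).comp (tendsto_add_atTop_nat 1)).sub_const (g0 p + picard φ k g p)
  have h3 := tendsto_nhds_unique h2 h1
  exact sub_eq_zero.1 h3

/-- Along characteristics the integral equation becomes a differential equation. -/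
theorem fderiv_characteristic (hD : HasDecay φ k S ρ c) {L K : ℝ} {g : ℂ × ℂ → ℂ} (hK : 0 ≤ K)
    (hg : Controlled S ρ L K g)
    (heq : ∀ p ∈ charDomain S, g p = initialA φ k (p.2 - p.1) + picard φ k g p) {p : ℂ × ℂ}
    (hp : p ∈ charDomain S) : fderiv ℂ g p (1, 1) = -bulk φ k g p := by
  obtain ⟨y, hy⟩ : ∃ y, y = p.2 - p.1 := ⟨_, rfl⟩
  have hpy : (p.1, y + p.1) = p := by rw [hy]; ext <;> simp
  set Y : Set ℂ := {ν | (ν, y + ν) ∈ charDomain S} with hYdef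
  have hYo : IsOpen Y := (isOpen_charDomain hD.isOpen).preimage (by fun_prop)
  have hstar : ∀ ν ∈ Y, ∀ l ∈ Icc (0 : ℝ) 1, (l : ℂ) * ν ∈ Y := by
    intro ν hν l hl
    have h := charDomain_retract hν hl
    simp only [hYdef, mem_ofPred_eq]
    convert h using 2
    ring
  have hH : DifferentiableOn ℂ (fun ν => bulk φ k g (ν, y + ν)) Y :=
    (hg.bulk_diff hD hK).comp (by fun_prop) (fun ν hν => hν)
  have hpY : p.1 ∈ Y := by rw [hYdef, mem_ofPred_eq, hpy]; exact hp
  have h1 := (hasDerivAt_segment_integral hYo hstar hH hpY).const_sub (initialA φ k y)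
  have h2 : (fun ν => g (ν, y + ν)) =ᶠ[𝓝 p.1] fun ν => initialA φ k y -
      ν * ∫ l in Ioc (0 : ℝ) 1, bulk φ k g (l * ν, y + l * ν) := by
    filter_upwards [hYo.mem_nhds hpY] with ν hν
    rw [heq _ hν, picard]
    have h3 : ∀ l : ℝ, y + ν - (1 - (l : ℂ)) * ν = y + l * ν := fun l => by ring
    simp only [h3, add_sub_cancel_right]
    ring
  have h4 := h1.congr_of_eventuallyEq h2
  have h5 : HasFDerivAt g (fderiv ℂ g p) (p.1, y + p.1) := by
    rw [hpy]
    exact (hg.diff.differentiableAt ((isOpen_charDomain hD.isOpen).mem_nhds hp)).hasFDerivAt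
  have h6 : HasDerivAt (fun ν : ℂ => (ν, y + ν)) (1, 1) p.1 :=
    (hasDerivAt_id p.1).prodMk ((hasDerivAt_id p.1).const_add y)
  have h7 := h5.comp_hasDerivAt p.1 h6
  have h8 := h7.unique h4
  rw [hpy] at h8
  exact h8

end

/-! ### The strip -/

theorem isOpen_stripU (r : ℝ) : IsOpen (stripU r) := by
  refine IsOpen.union ?_ Metric.isOpen_ball
  exact (isOpen_lt continuous_const Complex.continuous_re).inter
    (isOpen_lt (continuous_abs.comp Complex.continuous_im) continuous_const)

theorem ball_subset_stripU (r : ℝ) : Metric.ball 0 r ⊆ stripU r := subset_union_right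

theorem stripU_mono {r r' : ℝ} (h : r ≤ r') : stripU r ⊆ stripU r' :=
  union_subset_union (fun _ ht => ⟨ht.1, ht.2.trans_le h⟩) (Metric.ball_subset_ball h)

theorem isPreconnected_stripU {r : ℝ} (hr : 0 < r) : IsPreconnected (stripU r) := by
  have h : StarConvex ℝ 0 (stripU r) := by
    intro t ht a b ha hb hab
    rw [smul_zero, zero_add]
    rcases ht with ht | ht
    · rcases hb.eq_or_lt with rfl | hb
      · right
        simpa using hr
      · left
        refine ⟨by simpa using mul_pos hb ht.1, ?_⟩
        have h1 : |(b • t).im| = b * |t.im| := by simp [abs_mul, abs_of_pos hb]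
        rw [h1]
        exact lt_of_le_of_lt (mul_le_of_le_one_left (abs_nonneg _) (by linarith)) ht.2
    · right
      rw [mem_ball_zero_iff] at ht ⊢
      rw [norm_smul, Real.norm_of_nonneg hb]
      exact lt_of_le_of_lt (mul_le_of_le_one_left (norm_nonneg _) (by linarith)) ht
  exact (h.isPathConnected (Or.inr (by simpa using hr))).isConnected.isPreconnected

theorem ofReal_mem_stripU {r : ℝ} (hr : 0 < r) {t : ℝ} (ht : 0 ≤ t) : (t : ℂ) ∈ stripU r := by
  rcases ht.eq_or_lt with rfl | ht
  · right
    simpa using hr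
  · left
    simpa using ⟨ht, hr⟩

theorem add_mem_stripU {r : ℝ} {t w : ℂ} (ht : 0 ≤ t.re) (ht' : t.im = 0)
    (hw : w ∈ stripU r) : t + w ∈ stripU r := by
  rcases ht.eq_or_lt with h0 | h0
  · have : t = 0 := Complex.ext h0.symm ht'
    simpa [this] using hw
  rcases hw with hw | hw
  · left
    simp only [mem_ofPred_eq, add_re, add_im, ht', zero_add]
    exact ⟨by linarith [hw.1], hw.2⟩
  · by_cases hre : 0 < (t + w).re
    · left
      refine ⟨hre, ?_⟩
      rw [add_im, ht', zero_add]
      exact lt_of_le_of_lt (abs_im_le_norm w) (by simpa using hw)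
    · right
      rw [mem_ball_zero_iff] at hw ⊢
      refine lt_of_le_of_lt ?_ hw
      rw [add_re] at hre
      rw [Complex.norm_def, Complex.norm_def]
      refine Real.sqrt_le_sqrt ?_
      rw [Complex.normSq_apply, Complex.normSq_apply, add_re, add_im, ht', zero_add]
      nlinarith

theorem exists_lt_mem_stripU {d : ℝ} (hd : 0 < d) {t : ℂ} (ht : t ∈ stripU (2 * d)) :
    ∃ r, 0 < r ∧ r < d ∧ t ∈ stripU (2 * r) := by
  rcases ht with ht | ht
  · obtain ⟨r, h1, h2⟩ := exists_between (max_lt (by linarith [ht.2] : |t.im| / 2 < d) hd)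
    rw [max_lt_iff] at h1
    exact ⟨r, h1.2, h2, Or.inl ⟨ht.1, by linarith [h1.1]⟩⟩
  · rw [mem_ball_zero_iff] at ht
    obtain ⟨r, h1, h2⟩ := exists_between (max_lt (by linarith : ‖t‖ / 2 < d) hd)
    rw [max_lt_iff] at h1
    refine ⟨r, h1.2, h2, Or.inr ?_⟩
    rw [mem_ball_zero_iff]
    linarith [h1.1]

/-- Functions that are holomorphic on the strip and have the same power series about `0` agree. -/
theorem eqOn_stripU_of_hasSum {r r' : ℝ} (hr : 0 < r) (hr' : 0 < r') {f f' : ℂ → ℂ}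
    (hf : DifferentiableOn ℂ f (stripU r)) (hf' : DifferentiableOn ℂ f' (stripU r)) {a : ℕ → ℂ}
    (h : ∀ t ∈ Metric.ball (0 : ℂ) r', HasSum (fun n : ℕ => a n * t ^ n) (f t))
    (h' : ∀ t ∈ Metric.ball (0 : ℂ) r', HasSum (fun n : ℕ => a n * t ^ n) (f' t)) :
    EqOn f f' (stripU r) := by
  refine (hf.analyticOnNhd (isOpen_stripU r)).eqOn_of_preconnected_of_eventuallyEq
    (hf'.analyticOnNhd (isOpen_stripU r)) (isPreconnected_stripU hr)
    (z₀ := 0) (Or.inr (by simpa using hr)) ?_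
  filter_upwards [Metric.ball_mem_nhds (0 : ℂ) hr'] with t ht
  exact (h t ht).unique (h' t ht)

theorem eq_zero_of_hasSum_zero {a : ℕ → ℂ} {r : ℝ} (hr : 0 < r)
    (h : ∀ t ∈ Metric.ball (0 : ℂ) r, HasSum (fun n : ℕ => a n * t ^ n) 0) (n : ℕ) : a n = 0 := by
  have h1 : HasFPowerSeriesAt (fun _ : ℂ => (0 : ℂ)) (FormalMultilinearSeries.ofScalars ℂ a) 0 := by
    rw [hasFPowerSeriesAt_iff]
    filter_upwards [Metric.ball_mem_nhds (0 : ℂ) hr] with t ht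
    simpa only [zero_add, smul_eq_mul, FormalMultilinearSeries.coeff_ofScalars, mul_comm] using
      h t ht
  have h2 := h1.eq_zero
  have h3 : (FormalMultilinearSeries.ofScalars ℂ a).coeff n = a n := by simp
  rw [← h3, h2]
  simp [FormalMultilinearSeries.coeff]

/-! ### The Borel transform -/

/-- `F` solves the equation for the Borel transform on `stripU (2 * d) ×ˢ Γ`, with the right initial
value, and is bounded by a multiple of `decayM` on narrower strips. -/
structure BorelSol (φ k : ℂ → ℂ) (Γ : Set ℂ) (ρ d : ℝ) (F : ℂ → ℂ → ℂ) : Prop where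
  holo : DifferentiableOn ℂ (fun p : ℂ × ℂ => F p.1 p.2) (stripU (2 * d) ×ˢ Γ)
  eq : ∀ t ∈ stripU (2 * d), ∀ ξ ∈ Γ, 2 * deriv (fun t => F t ξ) t + deriv (F t) ξ =
    -(φ ξ * F t ξ + ∫ x in Ioi (0 : ℝ), k (ξ - x) * F t (ξ - x))
  init : ∀ ξ ∈ Γ, F 0 ξ = initialA φ k ξ
  bound : ∀ r, 0 < r → r < d → ∃ K L : ℝ, 0 ≤ K ∧ 0 ≤ L ∧ ∀ t ∈ stripU (2 * r), ∀ ξ ∈ Γ,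
    ‖F t ξ‖ ≤ K * Real.exp (L * ‖t‖) * decayM ρ ξ.re

section

variable {φ k : ℂ → ℂ} {Γ : Set ℂ} {ρ c d : ℝ} {F : ℂ → ℂ → ℂ}

theorem thickening_translate {Γ : Set ℂ} (htr : ∀ s ∈ Γ, ∀ x : ℝ, 0 ≤ x → s - x ∈ Γ) (r : ℝ) :
    ∀ s ∈ Metric.thickening r Γ, ∀ x : ℝ, 0 ≤ x → s - x ∈ Metric.thickening r Γ := by
  intro s hs x hx
  rw [Metric.mem_thickening_iff] at hs ⊢
  obtain ⟨γ, hγ, hd⟩ := hs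
  exact ⟨γ - x, htr γ hγ x hx, by simpa using hd⟩

theorem mem_charDomain_of_mem_stripU (htr : ∀ s ∈ Γ, ∀ x : ℝ, 0 ≤ x → s - x ∈ Γ) {r : ℝ}
    {t : ℂ} (ht : t ∈ stripU (2 * r)) {ξ : ℂ} (hξ : ξ ∈ Γ) :
    (t / 2, ξ) ∈ charDomain (Metric.thickening r Γ) := by
  intro l hl
  rw [Metric.mem_thickening_iff]
  rcases ht with ht | ht
  · refine ⟨ξ - (l * (t.re / 2) : ℝ), htr ξ hξ _ (mul_nonneg hl.1 (by linarith [ht.1])), ?_⟩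
    have h1 : ξ - l * (t / 2) - (ξ - (l * (t.re / 2) : ℝ)) = ((-(l * t.im / 2) : ℝ) : ℂ) * I := by
      apply Complex.ext <;> simp; ring
    rw [dist_eq_norm, h1, norm_mul, norm_I, mul_one, Complex.norm_real, Real.norm_eq_abs, abs_neg,
      abs_div, abs_mul, abs_of_nonneg hl.1, abs_two]
    nlinarith [ht.2, hl.1, hl.2, abs_nonneg t.im]
  · refine ⟨ξ, hξ, ?_⟩
    rw [mem_ball_zero_iff] at ht
    rw [dist_eq_norm]
    simp only [sub_sub_cancel_left, norm_neg, norm_mul, norm_div, Complex.norm_real,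
      Real.norm_of_nonneg hl.1]
    norm_num
    nlinarith [hl.1, hl.2, norm_nonneg t]

/-- The solution of the integral equation on a neighbourhood of `Γ`, restricted to `Γ`. -/
theorem exists_borelSol_of_thickening (htr : ∀ s ∈ Γ, ∀ x : ℝ, 0 ≤ x → s - x ∈ Γ) {r : ℝ}
    (hr : 0 < r) (hD : HasDecay φ k (Metric.thickening r Γ) ρ c) :
    ∃ F, BorelSol φ k Γ ρ r F := by
  obtain ⟨L, K, g, hL, hK, hg, heq⟩ := exists_solution_integral_equation hD
  have hmem := fun {t} (ht : t ∈ stripU (2 * r)) {ξ} (hξ : ξ ∈ Γ) =>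
    mem_charDomain_of_mem_stripU htr ht hξ
  have hopen := isOpen_charDomain hD.isOpen
  refine ⟨fun t ξ => g (t / 2, ξ), ?_, fun t ht ξ hξ => ?_, fun ξ hξ => ?_, fun r' hr' hr'r => ?_⟩
  · exact hg.diff.comp (f := fun p : ℂ × ℂ => (p.1 / 2, p.2)) (by fun_prop)
      (fun p hp => hmem hp.1 hp.2)
  · have hp := hmem ht hξ
    have h1 := fderiv_characteristic hD hK.le hg heq hp
    have h2 := (hg.diff.differentiableAt (hopen.mem_nhds hp)).hasFDerivAt
    have h3 : HasDerivAt (fun t : ℂ => (t / 2, ξ)) (1 / 2, 0) t :=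
      ((hasDerivAt_id t).div_const 2).prodMk (hasDerivAt_const t ξ)
    have h4 : HasDerivAt (fun ξ : ℂ => (t / 2, ξ)) (0, 1) ξ :=
      (hasDerivAt_const ξ (t / 2)).prodMk (hasDerivAt_id ξ)
    have h5 := (h2.comp_hasDerivAt t h3).deriv
    have h6 := (HasFDerivAt.comp_hasDerivAt (f := fun ξ : ℂ => (t / 2, ξ)) ξ h2 h4).deriv
    simp only [Function.comp_def] at h5 h6
    rw [h5, h6]
    have h7 : ((1 : ℂ), (1 : ℂ)) = (2 : ℂ) • ((1 / 2 : ℂ), (0 : ℂ)) + (0, 1) := by ext <;> simp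
    rw [h7, map_add, map_smul, smul_eq_mul] at h1
    exact h1
  · have h0 : (0 : ℂ) ∈ stripU (2 * r) := Or.inr (by simpa using hr)
    rw [heq _ (hmem h0 hξ)]
    simp [picard]
  · refine ⟨K * (1 + r) ^ ρ, L / 2, by positivity, by positivity, fun t ht ξ hξ => ?_⟩
    have htr' := stripU_mono (by linarith : 2 * r' ≤ 2 * r) ht
    refine (hg.bound _ (hmem htr' hξ)).trans ?_
    have hre : -(2 * r) ≤ t.re := by
      rcases htr' with h | h
      · linarith [h.1]
      · rw [mem_ball_zero_iff] at h
        linarith [(abs_le.1 (Complex.abs_re_le_norm t)).1]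
    have h1 : decayM ρ (ξ.re - (t / 2).re) ≤ (1 + r) ^ ρ * decayM ρ ξ.re := by
      refine (decayM_mono hD.rho_pos ?_).trans (decayM_add_le hD.rho_pos ξ.re hr.le)
      have : (t / 2).re = t.re / 2 := by simp
      rw [this]
      linarith
    have h2 : L * ‖t / 2‖ = L / 2 * ‖t‖ := by
      rw [norm_div]
      norm_num
      ring
    simp only [h2]
    calc K * (Real.exp (L / 2 * ‖t‖) * decayM ρ (ξ.re - (t / 2).re))
        ≤ K * (Real.exp (L / 2 * ‖t‖) * ((1 + r) ^ ρ * decayM ρ ξ.re)) := by gcongr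
      _ = _ := by ring

theorem BorelSol.differentiableOn_fst (h : BorelSol φ k Γ ρ d F) {ξ : ℂ} (hξ : ξ ∈ Γ) :
    DifferentiableOn ℂ (fun t => F t ξ) (stripU (2 * d)) :=
  h.holo.comp (f := fun t : ℂ => (t, ξ)) (by fun_prop) (fun _ ht => ⟨ht, hξ⟩)

theorem BorelSol.differentiableOn_snd (h : BorelSol φ k Γ ρ d F) {t : ℂ}
    (ht : t ∈ stripU (2 * d)) : DifferentiableOn ℂ (F t) Γ :=
  h.holo.comp (f := fun ξ : ℂ => (t, ξ)) (by fun_prop) (fun _ hξ => ⟨ht, hξ⟩)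

theorem BorelSol.differentiableOn_iteratedDeriv (h : BorelSol φ k Γ ρ d F) (hΓ : IsOpen Γ) (n : ℕ) :
    DifferentiableOn ℂ (fun p : ℂ × ℂ => iteratedDeriv n (fun t => F t p.2) p.1)
      (stripU (2 * d) ×ˢ Γ) := by
  induction n with
  | zero => simpa using h.holo
  | succ n ih =>
    simp only [iteratedDeriv_succ]
    exact differentiableOn_deriv_fst ((isOpen_stripU _).prod hΓ) ih

/-- The Taylor coefficients at `t = 0` satisfy the recurrence of the WKB coefficients. -/
theorem BorelSol.taylor_recurrence (h : BorelSol φ k Γ ρ d F) (hd : 0 < d)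
    (hD : HasDecay φ k Γ ρ c) :
    ∃ K : ℝ, 0 ≤ K ∧ ∀ n : ℕ, ∀ ξ ∈ Γ,
      ‖iteratedDeriv n (fun t => F t ξ) 0‖ ≤ n.factorial * (K / d ^ n) ∧
      2 * iteratedDeriv (n + 1) (fun t => F t ξ) 0 +
          deriv (fun ξ => iteratedDeriv n (fun t => F t ξ) 0) ξ =
        -(φ ξ * iteratedDeriv n (fun t => F t ξ) 0 +
          ∫ x in Ioi (0 : ℝ), k (ξ - x) * iteratedDeriv n (fun t => F t (ξ - x)) 0) := by
  have hball : Metric.ball (0 : ℂ) (2 * d) ⊆ stripU (2 * d) := ball_subset_stripU _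
  have hsmall : Metric.ball (0 : ℂ) (d / 2) ⊆ Metric.ball 0 (2 * d) :=
    Metric.ball_subset_ball (by linarith)
  obtain ⟨K₀, L, hK₀, hL, hb⟩ := h.bound (3 * d / 4) (by linarith) (by linarith)
  set K := K₀ * Real.exp (L * d) with hK
  have hK0 : 0 ≤ K := by positivity
  set B : ℕ → ℂ → ℂ := fun n ξ => iteratedDeriv n (fun t => F t ξ) 0 with hB
  have hBd : ∀ n, DifferentiableOn ℂ (B n) Γ := fun n =>
    (h.differentiableOn_iteratedDeriv hD.isOpen n).comp (f := fun ξ : ℂ => ((0 : ℂ), ξ))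
      (by fun_prop) (fun ξ hξ => ⟨hball (by simpa using hd), hξ⟩)
  have hBb : ∀ n, ∀ ξ ∈ Γ, ‖B n ξ‖ ≤ n.factorial * (K / d ^ n) := by
    intro n ξ hξ
    rw [← mul_div_assoc]
    refine Complex.norm_iteratedDeriv_le_of_forall_mem_sphere_norm_le n hd
      (((h.differentiableOn_fst hξ).mono ?_).diffContOnCl) (fun t ht => ?_)
    · rw [closure_ball _ hd.ne']
      exact (Metric.closedBall_subset_ball (by linarith)).trans hball
    · have ht' : ‖t‖ = d := by simpa using ht
      have hts : t ∈ stripU (2 * (3 * d / 4)) :=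
        ball_subset_stripU _ (by rw [mem_ball_zero_iff, ht']; linarith)
      refine (hb t hts ξ hξ).trans ?_
      rw [ht', ← hK]
      exact mul_le_of_le_one_right hK0 (decayM_le_one hD.rho_pos _)
  -- Cauchy's estimate on `|t| = d` and the restriction to `|t| < d / 2` give a geometric majorant,
  -- which allows every term of the equation to be expanded in powers of `t`
  have hterm : ∀ t ∈ Metric.ball (0 : ℂ) (d / 2), ∀ n, ∀ ξ ∈ Γ,
      ‖B n ξ / (n.factorial : ℂ) * t ^ n‖ ≤ K * (1 / 2) ^ n := by
    intro t ht n ξ hξ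
    rw [mem_ball_zero_iff] at ht
    have hn : (0 : ℝ) < n.factorial := by exact_mod_cast n.factorial_pos
    rw [norm_mul, norm_div, norm_pow, Complex.norm_natCast]
    calc ‖B n ξ‖ / n.factorial * ‖t‖ ^ n
        ≤ (n.factorial * (K / d ^ n)) / n.factorial * (d / 2) ^ n := by
          gcongr
          exact hBb n ξ hξ
      _ = K * (1 / 2) ^ n := by
          rw [mul_div_cancel_left₀ _ hn.ne', div_pow, div_pow, one_pow]
          field_simp
  have hsum : Summable (fun n : ℕ => K * (1 / 2 : ℝ) ^ n) := summable_geometric_two.mul_left K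
  have S1 : ∀ t ∈ Metric.ball (0 : ℂ) (d / 2), ∀ ξ ∈ Γ,
      HasSum (fun n : ℕ => B n ξ / (n.factorial : ℂ) * t ^ n) (F t ξ) := by
    intro t ht ξ hξ
    have h1 := Complex.hasSum_taylorSeries_on_ball ((h.differentiableOn_fst hξ).mono hball)
      (hsmall ht)
    refine h1.congr_fun (fun n => ?_)
    simp only [hB, sub_zero, smul_eq_mul]
    field_simp
  have S2 : ∀ t ∈ Metric.ball (0 : ℂ) (d / 2), ∀ ξ ∈ Γ,
      HasSum (fun n : ℕ => B (n + 1) ξ / (n.factorial : ℂ) * t ^ n)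
        (deriv (fun t => F t ξ) t) := by
    intro t ht ξ hξ
    have h1 := Complex.hasSum_taylorSeries_on_ball
      (((h.differentiableOn_fst hξ).mono hball).deriv Metric.isOpen_ball) (hsmall ht)
    refine h1.congr_fun (fun n => ?_)
    simp only [hB, sub_zero, smul_eq_mul, iteratedDeriv_succ']
    field_simp
  have S3 : ∀ t ∈ Metric.ball (0 : ℂ) (d / 2), ∀ ξ ∈ Γ,
      HasSum (fun n : ℕ => deriv (B n) ξ / (n.factorial : ℂ) * t ^ n) (deriv (F t) ξ) := by
    intro t ht ξ hξ
    have h1 := Complex.hasSum_deriv_of_summable_norm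
      (F := fun (n : ℕ) ξ => B n ξ / (n.factorial : ℂ) * t ^ n) hsum
      (fun n => ((hBd n).div_const _).mul_const _) hD.isOpen
      (fun n w hw => hterm t ht n w hw) hξ
    have h2 : (fun w => ∑' n : ℕ, B n w / (n.factorial : ℂ) * t ^ n) =ᶠ[𝓝 ξ] F t := by
      filter_upwards [hD.isOpen.mem_nhds hξ] with w hw using (S1 t ht w hw).tsum_eq
    rw [h2.deriv_eq] at h1
    refine h1.congr_fun (fun n => ?_)
    simp
  have hki : ∀ ξ ∈ Γ, ∀ n, IntegrableOn (fun x : ℝ => k (ξ - x) * B n (ξ - x)) (Ioi 0) := by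
    intro ξ hξ n
    refine integrableOn_halfLine_of_norm_le (f := fun s => k s * B n s) hD.translate
      (hD.k_diff.continuousOn.mul (hBd n).continuousOn) hD.rho_pos
      (C := c * (n.factorial * (K / d ^ n))) (fun s hs => ?_) hξ
    have h1 := hD.k_le s hs
    rw [norm_mul]
    refine (mul_le_mul h1 (hBb n s hs) (norm_nonneg _) ((norm_nonneg _).trans h1)).trans
      (le_of_eq ?_)
    ring
  have S4 : ∀ t ∈ Metric.ball (0 : ℂ) (d / 2), ∀ ξ ∈ Γ,
      HasSum (fun n : ℕ => (∫ x in Ioi (0 : ℝ), k (ξ - x) * B n (ξ - x)) /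
        (n.factorial : ℂ) * t ^ n) (∫ x in Ioi (0 : ℝ), k (ξ - x) * F t (ξ - x)) := by
    intro t ht ξ hξ
    have hint : ∀ n : ℕ, IntegrableOn (fun x : ℝ => k (ξ - x) *
        (B n (ξ - x) / (n.factorial : ℂ) * t ^ n)) (Ioi 0) := by
      intro n
      have := ((hki ξ hξ n).div_const (n.factorial : ℂ)).mul_const (t ^ n)
      refine this.congr (Eventually.of_forall fun x => ?_)
      simp only
      ring
    have hDI := integrableOn_decayK_sub hD.rho_pos ξ.re
    have h1 := hasSum_integral_of_summable_integral_norm hint (by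
      refine Summable.of_nonneg_of_le (fun n => integral_nonneg fun x => norm_nonneg _)
        (f := fun n : ℕ => (K * (1 / 2 : ℝ) ^ n) *
          ∫ x in Ioi (0 : ℝ), c * decayK ρ (ξ.re - x)) (fun n => ?_) (hsum.mul_right _)
      rw [← integral_const_mul]
      refine setIntegral_mono_on (hint n).norm ((hDI.const_mul c).const_mul _) measurableSet_Ioi
        (fun x hx => ?_)
      have hx' := hD.translate ξ hξ x (mem_Ioi.1 hx).le
      rw [norm_mul, mul_comm]
      exact mul_le_mul (hterm t ht n _ hx') (by simpa using hD.k_le _ hx') (norm_nonneg _)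
        (by positivity))
    have h2 : ∫ x in Ioi (0 : ℝ), (∑' n : ℕ, k (ξ - x) *
        (B n (ξ - x) / (n.factorial : ℂ) * t ^ n)) =
        ∫ x in Ioi (0 : ℝ), k (ξ - x) * F t (ξ - x) := by
      refine setIntegral_congr_fun measurableSet_Ioi (fun x hx => ?_)
      exact ((S1 t ht _ (hD.translate ξ hξ x (mem_Ioi.1 hx).le)).mul_left _).tsum_eq
    rw [h2] at h1
    refine h1.congr_fun (fun n => ?_)
    rw [← integral_div, ← integral_mul_const]
    congr 1
    funext x
    ring
  refine ⟨K, hK0, fun n ξ hξ => ⟨hBb n ξ hξ, ?_⟩⟩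
  have hz : ∀ t ∈ Metric.ball (0 : ℂ) (d / 2), HasSum (fun n : ℕ =>
      ((2 * B (n + 1) ξ + deriv (B n) ξ + (φ ξ * B n ξ +
        ∫ x in Ioi (0 : ℝ), k (ξ - x) * B n (ξ - x))) / (n.factorial : ℂ)) * t ^ n) 0 := by
    intro t ht
    have h1 := (((S2 t ht ξ hξ).mul_left 2).add (S3 t ht ξ hξ)).add
      (((S1 t ht ξ hξ).mul_left (φ ξ)).add (S4 t ht ξ hξ))
    rw [h.eq t (hball (hsmall ht)) ξ hξ, neg_add_cancel] at h1
    refine h1.congr_fun (fun n => ?_)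
    ring
  have h1 := eq_zero_of_hasSum_zero (half_pos hd) hz n
  rw [div_eq_zero_iff, or_iff_left (by exact_mod_cast n.factorial_ne_zero)] at h1
  exact eq_neg_of_add_eq_zero_left h1

end

/-! ### The WKB coefficients as Taylor coefficients -/

section

variable {φ ψ k : ℂ → ℂ} {Γ : Set ℂ} {ρ c d : ℝ} {F : ℂ → ℂ → ℂ}

theorem BorelSol.coeffA_succ_eq (h : BorelSol φ (coeffKernel φ ψ 1) Γ ρ d F) (hd : 0 < d)
    (hD : HasDecay φ (coeffKernel φ ψ 1) Γ ρ c) (n : ℕ) :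
    ∀ ξ ∈ Γ, coeffA φ ψ 1 (n + 1) ξ = iteratedDeriv n (fun t => F t ξ) 0 := by
  obtain ⟨K, hK, hrec⟩ := h.taylor_recurrence hd hD
  induction n with
  | zero =>
    intro ξ hξ
    simp only [coeffA, halfLineIntegral, iteratedDeriv_zero, h.init ξ hξ, initialA,
      Complex.ofReal_one, one_mul, mul_one, deriv_const, mul_zero, sub_zero]
  | succ n ih =>
    intro ξ hξ
    have h1 : coeffA φ ψ 1 (n + 1) =ᶠ[𝓝 ξ] fun ξ => iteratedDeriv n (fun t => F t ξ) 0 := by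
      filter_upwards [hD.isOpen.mem_nhds hξ] with w hw using ih w hw
    have h2 : ∫ x in Ioi (0 : ℝ), coeffKernel φ ψ 1 (ξ - x) * coeffA φ ψ 1 (n + 1) (ξ - x) =
        ∫ x in Ioi (0 : ℝ), coeffKernel φ ψ 1 (ξ - x) *
          iteratedDeriv n (fun t => F t (ξ - x)) 0 := by
      refine setIntegral_congr_fun measurableSet_Ioi (fun x hx => ?_)
      simp only [ih _ (hD.translate ξ hξ x (mem_Ioi.1 hx).le)]
    have h3 := (hrec n ξ hξ).2
    rw [coeffA]
    simp only [h1.deriv_eq, halfLineIntegral, ih ξ hξ, Complex.ofReal_one, one_mul]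
    rw [h2]
    linear_combination (-1 / 2 : ℂ) * h3

theorem BorelSol.hasSum_coeffA (h : BorelSol φ (coeffKernel φ ψ 1) Γ ρ d F) (hd : 0 < d)
    (hD : HasDecay φ (coeffKernel φ ψ 1) Γ ρ c) {t : ℂ} (ht : t ∈ Metric.ball (0 : ℂ) (2 * d))
    {ξ : ℂ} (hξ : ξ ∈ Γ) :
    HasSum (fun n : ℕ => coeffA φ ψ 1 (n + 1) ξ / (n.factorial : ℂ) * t ^ n) (F t ξ) := by
  have h1 := Complex.hasSum_taylorSeries_on_ball
    ((h.differentiableOn_fst hξ).mono (ball_subset_stripU _)) ht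
  refine h1.congr_fun (fun n => ?_)
  rw [h.coeffA_succ_eq hd hD n ξ hξ]
  simp only [sub_zero, smul_eq_mul]
  field_simp

theorem BorelSol.coeffA_properties (h : BorelSol φ (coeffKernel φ ψ 1) Γ ρ d F) (hd : 0 < d)
    (hD : HasDecay φ (coeffKernel φ ψ 1) Γ ρ c) (n : ℕ) :
    DifferentiableOn ℂ (coeffA φ ψ 1 n) Γ ∧ ∀ ξ ∈ Γ, IntegrableOn
      (fun x : ℝ => coeffKernel φ ψ 1 (ξ - x) * coeffA φ ψ 1 n (ξ - x)) (Ioi 0) := by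
  obtain ⟨K, hK, hrec⟩ := h.taylor_recurrence hd hD
  have hdiff : DifferentiableOn ℂ (coeffA φ ψ 1 n) Γ ∧ ∃ B, ∀ ξ ∈ Γ, ‖coeffA φ ψ 1 n ξ‖ ≤ B := by
    cases n with
    | zero => exact ⟨differentiableOn_const _, 1, fun ξ _ => by simp [coeffA]⟩
    | succ n =>
      refine ⟨?_, n.factorial * (K / d ^ n), fun ξ hξ => ?_⟩
      · refine DifferentiableOn.congr ?_ (h.coeffA_succ_eq hd hD n)
        exact (h.differentiableOn_iteratedDeriv hD.isOpen n).comp (f := fun ξ : ℂ => ((0 : ℂ), ξ))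
          (by fun_prop) (fun ξ hξ => ⟨ball_subset_stripU _ (by simpa using hd), hξ⟩)
      · rw [h.coeffA_succ_eq hd hD n ξ hξ]
        exact (hrec n ξ hξ).1
  obtain ⟨h1, B, hB⟩ := hdiff
  refine ⟨h1, fun ξ hξ => ?_⟩
  refine integrableOn_halfLine_of_norm_le (f := fun s => coeffKernel φ ψ 1 s * coeffA φ ψ 1 n s)
    hD.translate (hD.k_diff.continuousOn.mul h1.continuousOn) hD.rho_pos
    (C := c * B) (fun s hs => ?_) hξ
  have h2 := hD.k_le s hs
  rw [norm_mul]
  refine (mul_le_mul h2 (hB s hs) (norm_nonneg _) ((norm_nonneg _).trans h2)).trans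
    (le_of_eq ?_)
  ring

/-- The solutions obtained from neighbourhoods of `Γ` of all radii `r < d` agree where they are
defined, by the identity theorem, and so fit together to a solution on the whole strip. -/
theorem exists_borelSol (hd : 0 < d) (hDΓ : HasDecay φ (coeffKernel φ ψ 1) Γ ρ c)
    (hD : ∀ r, 0 < r → r < d → ∃ c',
      HasDecay φ (coeffKernel φ ψ 1) (Metric.thickening r Γ) ρ c') :
    ∃ F, BorelSol φ (coeffKernel φ ψ 1) Γ ρ d F := by
  have hex : ∀ r, ∃ F, 0 < r → r < d → BorelSol φ (coeffKernel φ ψ 1) Γ ρ r F := by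
    intro r
    by_cases hr : 0 < r ∧ r < d
    · obtain ⟨c', hc'⟩ := hD r hr.1 hr.2
      obtain ⟨F, hF⟩ := exists_borelSol_of_thickening hDΓ.translate hr.1 hc'
      exact ⟨F, fun _ _ => hF⟩
    · exact ⟨fun _ _ => 0, fun h1 h2 => absurd ⟨h1, h2⟩ hr⟩
  choose f hf using hex
  have hle : ∀ r r', 0 < r → r ≤ r' → r' < d → ∀ t ∈ stripU (2 * r), ∀ ξ ∈ Γ,
      f r t ξ = f r' t ξ := by
    intro r r' hr hrr hr' t ht ξ hξ
    have h1 := hf r hr (hrr.trans_lt hr')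
    have h2 := hf r' (hr.trans_le hrr) hr'
    refine eqOn_stripU_of_hasSum (f := fun t => f r t ξ) (f' := fun t => f r' t ξ)
      (mul_pos two_pos hr) (mul_pos two_pos hr) (h1.differentiableOn_fst hξ)
      ((h2.differentiableOn_fst hξ).mono (stripU_mono (by linarith)))
      (fun t ht => h1.hasSum_coeffA hr hDΓ ht hξ)
      (fun t ht => h2.hasSum_coeffA (hr.trans_le hrr) hDΓ
        (Metric.ball_subset_ball (by linarith) ht) hξ) ht
  have hr : ∀ t, ∃ r, t ∈ stripU (2 * d) → 0 < r ∧ r < d ∧ t ∈ stripU (2 * r) := by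
    intro t
    by_cases ht : t ∈ stripU (2 * d)
    · obtain ⟨r, h⟩ := exists_lt_mem_stripU hd ht
      exact ⟨r, fun _ => h⟩
    · exact ⟨0, fun h => absurd h ht⟩
  choose R hR using hr
  set F : ℂ → ℂ → ℂ := fun t ξ => f (R t) t ξ with hFdef
  have hFeq : ∀ r, 0 < r → r < d → ∀ t ∈ stripU (2 * r), ∀ ξ ∈ Γ, F t ξ = f r t ξ := by
    intro r hr hrd t ht ξ hξ
    obtain ⟨h1, h2, h3⟩ := hR t (stripU_mono (by linarith) ht)
    rcases le_total r (R t) with h | h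
    · exact (hle r (R t) hr h h2 t ht ξ hξ).symm
    · exact hle (R t) r h1 h hrd t h3 ξ hξ
  refine ⟨F, ?_, fun t ht ξ hξ => ?_, fun ξ hξ => ?_, fun r hr hrd => ?_⟩
  · intro p hp
    obtain ⟨r, h1, h2, h3⟩ := exists_lt_mem_stripU hd hp.1
    have hopen : IsOpen (stripU (2 * r) ×ˢ Γ) := (isOpen_stripU _).prod hDΓ.isOpen
    have h4 := ((hf r h1 h2).holo.congr
      (fun q hq => hFeq r h1 h2 q.1 hq.1 q.2 hq.2)).differentiableAt (hopen.mem_nhds ⟨h3, hp.2⟩)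
    exact h4.differentiableWithinAt
  · obtain ⟨r, h1, h2, h3⟩ := exists_lt_mem_stripU hd ht
    have e1 : (fun t => F t ξ) =ᶠ[𝓝 t] fun t => f r t ξ := by
      filter_upwards [(isOpen_stripU _).mem_nhds h3] with s hs using hFeq r h1 h2 s hs ξ hξ
    have e2 : F t =ᶠ[𝓝 ξ] f r t := by
      filter_upwards [hDΓ.isOpen.mem_nhds hξ] with s hs using hFeq r h1 h2 t h3 s hs
    have e3 : ∫ x in Ioi (0 : ℝ), coeffKernel φ ψ 1 (ξ - x) * F t (ξ - x) =
        ∫ x in Ioi (0 : ℝ), coeffKernel φ ψ 1 (ξ - x) * f r t (ξ - x) := by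
      refine setIntegral_congr_fun measurableSet_Ioi (fun x hx => ?_)
      simp only [hFeq r h1 h2 t h3 _ (hDΓ.translate ξ hξ x (mem_Ioi.1 hx).le)]
    rw [e1.deriv_eq, e2.deriv_eq, e3, hFeq r h1 h2 t h3 ξ hξ]
    exact (hf r h1 h2).eq t h3 ξ hξ
  · rw [hFeq (d / 2) (by linarith) (by linarith) 0 (Or.inr (by simpa using hd)) ξ hξ]
    exact (hf (d / 2) (by linarith) (by linarith)).init ξ hξ
  · obtain ⟨r', h1, h2⟩ := exists_between hrd
    obtain ⟨K, L, hK, hL, hb⟩ := (hf r' (hr.trans h1) h2).bound r hr h1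
    refine ⟨K, L, hK, hL, fun t ht ξ hξ => ?_⟩
    rw [hFeq r' (hr.trans h1) h2 t (stripU_mono (by linarith) ht) ξ hξ]
    exact hb t ht ξ hξ

/-! ### Growth of the Borel transform along the strip -/

/-- The integral of `p` over the half-line that ends at `ξ`. -/
def tailIntegral (p : ℂ → ℝ) (ξ : ℂ) : ℝ := ∫ x in Ioi (0 : ℝ), p (ξ - x)

theorem tailIntegral_sub (p : ℂ → ℝ) (ξ : ℂ) (x : ℝ) :
    tailIntegral p (ξ - x) = ∫ y in Ioi x, p (ξ - y) := by
  have h := (measurePreserving_add_right volume x).setIntegral_preimage_emb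
    (measurableEmbedding_addRight _) (fun y : ℝ => p (ξ - y)) (Ioi x)
  rw [← h, tailIntegral]
  have h1 : (fun y : ℝ => y + x) ⁻¹' Ioi x = Ioi 0 := by
    ext y
    simp
  rw [h1]
  refine setIntegral_congr_fun measurableSet_Ioi (fun y _ => ?_)
  have h2 : ξ - (x : ℂ) - y = ξ - ((y + x : ℝ) : ℂ) := by
    push_cast
    ring
  simp only [h2]

/-- With `E x = ∫_x^∞ q`, the function `q · exp (a E)` is the derivative of `-exp (a E) / a`. -/
theorem integral_mul_exp_tail_le {q : ℝ → ℝ} (hc : ContinuousOn q (Ici 0))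
    (hi : IntegrableOn q (Ioi 0)) (h0 : ∀ x, 0 ≤ x → 0 ≤ q x) {a : ℝ} (ha : 0 < a) :
    IntegrableOn (fun x => q x * Real.exp (a * ∫ y in Ioi x, q y)) (Ioi 0) ∧
    ∫ x in Ioi (0 : ℝ), q x * Real.exp (a * ∫ y in Ioi x, q y) ≤
      Real.exp (a * ∫ y in Ioi (0 : ℝ), q y) / a := by
  set E : ℝ → ℝ := fun x => ∫ y in Ioi x, q y with hE
  have hii : ∀ x, 0 ≤ x → IntervalIntegrable q volume 0 x := fun x hx =>
    (intervalIntegrable_iff_integrableOn_Ioc_of_le hx).2 (hi.mono_set Ioc_subset_Ioi_self)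
  have hEx : ∀ x ∈ Ici (0 : ℝ), E x = E 0 - ∫ y in (0 : ℝ)..x, q y := by
    intro x hx
    rw [intervalIntegral.integral_of_le hx, hE, eq_sub_iff_add_eq, add_comm]
    simp only
    rw [← setIntegral_union Ioc_disjoint_Ioi_same measurableSet_Ioi
      (hi.mono_set Ioc_subset_Ioi_self) (hi.mono_set (Ioi_subset_Ioi hx)),
      Ioc_union_Ioi_eq_Ioi hx]
  have hder : ∀ x ∈ Ioi (0 : ℝ), HasDerivAt E (-q x) x := by
    intro x hx
    have h1 := intervalIntegral.integral_hasDerivAt_right (hii x (mem_Ioi.1 hx).le)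
      (hc.mono Ioi_subset_Ici_self |>.stronglyMeasurableAtFilter isOpen_Ioi x hx)
      (hc.continuousAt (Ici_mem_nhds hx))
    refine (h1.const_sub (E 0)).congr_of_eventuallyEq ?_
    filter_upwards [Ioi_mem_nhds (mem_Ioi.1 hx)] with y hy using hEx y (mem_Ioi.1 hy).le
  have hcont : ContinuousWithinAt E (Ici 0) 0 := by
    have h1 : IntegrableOn q (Icc 0 1) :=
      (integrableOn_Icc_iff_integrableOn_Ioc).2 (hi.mono_set Ioc_subset_Ioi_self)
    have h2 := intervalIntegral.continuousOn_primitive_interval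
      (f := q) (a := 0) (b := 1) (by rwa [uIcc_of_le zero_le_one]) 0 (by simp)
    rw [uIcc_of_le zero_le_one] at h2
    have h3 : ContinuousWithinAt (fun x => E 0 - ∫ y in (0 : ℝ)..x, q y) (Ici 0) 0 :=
      continuousWithinAt_const.sub (h2.mono_of_mem_nhdsWithin (Icc_mem_nhdsGE zero_lt_one))
    exact h3.congr hEx (hEx 0 self_mem_Ici)
  have hlim : Tendsto E atTop (𝓝 0) := tendsto_integral_Ioi_zero tendsto_id (f := q)
    (μ := volume)
  have hder2 : ∀ x ∈ Ioi (0 : ℝ), HasDerivAt (fun x => Real.exp (a * E x) / a)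
      (-(q x * Real.exp (a * E x))) x := by
    intro x hx
    refine ((((hder x hx).const_mul a).exp).div_const a).congr_deriv ?_
    field_simp
  have hcont2 : ContinuousWithinAt (fun x => Real.exp (a * E x) / a) (Ici 0) 0 :=
    (Real.continuous_exp.continuousAt.comp_continuousWithinAt
      (continuousWithinAt_const.mul hcont)).div_const a
  have hneg : ∀ x ∈ Ioi (0 : ℝ), -(q x * Real.exp (a * E x)) ≤ 0 := fun x hx =>
    neg_nonpos.2 (mul_nonneg (h0 x (mem_Ioi.1 hx).le) (Real.exp_pos _).le)
  have hlim2 : Tendsto (fun x => Real.exp (a * E x) / a) atTop (𝓝 (Real.exp (a * 0) / a)) :=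
    ((Real.continuous_exp.tendsto _).comp (hlim.const_mul a)).div_const a
  have h1 := integrableOn_Ioi_deriv_of_nonpos hcont2 hder2 hneg hlim2
  have h2 := integral_Ioi_of_hasDerivAt_of_nonpos hcont2 hder2 hneg hlim2
  refine ⟨by simpa using h1.neg, ?_⟩
  rw [integral_neg] at h2
  have h3 : 0 < Real.exp (a * 0) / a := by positivity
  linarith

theorem tailIntegral_exp_bound {p : ℂ → ℝ} {C : ℝ} (hρ : 0 < ρ)
    (htr : ∀ s ∈ Γ, ∀ x : ℝ, 0 ≤ x → s - x ∈ Γ) (hpc : ContinuousOn p Γ)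
    (hp0 : ∀ s ∈ Γ, 0 ≤ p s) (hpb : ∀ s ∈ Γ, p s ≤ C * decayK ρ s.re) {a : ℝ} (ha : 0 < a) {ξ : ℂ}
    (hξ : ξ ∈ Γ) :
    IntegrableOn (fun x : ℝ => p (ξ - x) * Real.exp (a * tailIntegral p (ξ - x))) (Ioi 0) ∧
    ∫ x in Ioi (0 : ℝ), p (ξ - x) * Real.exp (a * tailIntegral p (ξ - x)) ≤
      Real.exp (a * tailIntegral p ξ) / a := by
  have h := integral_mul_exp_tail_le (q := fun x : ℝ => p (ξ - x))
    (continuousOn_halfLine htr hpc hξ)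
    (integrableOn_halfLine_of_norm_le htr hpc hρ
      (fun s hs => by rw [Real.norm_of_nonneg (hp0 s hs)]; exact hpb s hs) hξ)
    (fun x hx => hp0 _ (htr ξ hξ x hx)) ha
  simp only [← tailIntegral_sub, Complex.ofReal_zero, sub_zero] at h
  exact h

theorem tailIntegral_nonneg {p : ℂ → ℝ} (htr : ∀ s ∈ Γ, ∀ x : ℝ, 0 ≤ x → s - x ∈ Γ)
    (hp0 : ∀ s ∈ Γ, 0 ≤ p s) {ξ : ℂ} (hξ : ξ ∈ Γ) : 0 ≤ tailIntegral p ξ :=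
  setIntegral_nonneg measurableSet_Ioi (fun x hx => hp0 _ (htr ξ hξ x (mem_Ioi.1 hx).le))

/-- The zeroth-order part of the equation for `F`, holomorphic on narrower strips. -/
theorem BorelSol.differentiableOn_bulk (h : BorelSol φ k Γ ρ d F) (hD : HasDecay φ k Γ ρ c) {r : ℝ}
    (hr : 0 < r) (hrd : r < d) :
    DifferentiableOn ℂ (bulk φ k (fun p => F p.1 p.2)) (stripU (2 * r) ×ˢ Γ) := by
  obtain ⟨K, L, hK, hL, hb⟩ := h.bound r hr hrd
  have hF : DifferentiableOn ℂ (fun p : ℂ × ℂ => F p.1 p.2) (stripU (2 * r) ×ˢ Γ) :=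
    h.holo.mono (prod_mono (stripU_mono (by linarith)) subset_rfl)
  refine DifferentiableOn.add (DifferentiableOn.mul (hD.phi_diff.comp (by fun_prop)
    (fun p hp => hp.2)) hF) ?_
  refine differentiableOn_halfLine_integral hD.rho_pos hD.c_pos hD.k_diff hD.k_le
    ((isOpen_stripU _).prod hD.isOpen) (fun p hp => hp.2)
    (fun p hp x hx => ⟨hp.1, hD.translate _ hp.2 x hx⟩) hF
    (b := fun t => K * Real.exp (L * ‖t‖)) (by fun_prop) (fun p hp => ?_)
  exact (hb p.1 hp.1 p.2 hp.2).trans (mul_le_of_le_one_right (by positivity)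
    (decayM_le_one hD.rho_pos _))

/-- The equation for `F`, integrated along a characteristic in the real direction; the path stays
in `Γ`. -/
theorem BorelSol.integral_along_characteristic (h : BorelSol φ k Γ ρ d F) (hD : HasDecay φ k Γ ρ c)
    {r : ℝ} (hr : 0 < r) (hrd : r < d) {w : ℂ} (hw : w ∈ stripU (2 * r)) {T : ℝ} (hT : 0 ≤ T)
    {ξ : ℂ} (hξ : ξ ∈ Γ) :
    F (T + w) ξ = F w (ξ - (T / 2 : ℝ)) - ∫ y in Ioc (0 : ℝ) (T / 2),
      bulk φ k (fun p => F p.1 p.2) ((T - 2 * y : ℝ) + w, ξ - y) := by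
  have hmem : ∀ y ∈ Icc (0 : ℝ) (T / 2),
      (((T - 2 * y : ℝ) : ℂ) + w, ξ - (y : ℂ)) ∈ stripU (2 * r) ×ˢ Γ := fun y hy =>
    ⟨add_mem_stripU (by rw [Complex.ofReal_re]; linarith [hy.2]) (Complex.ofReal_im _) hw,
      hD.translate ξ hξ y hy.1⟩
  have hsub : stripU (2 * r) ⊆ stripU (2 * d) := stripU_mono (by linarith)
  have hopen : IsOpen (stripU (2 * d) ×ˢ Γ) := (isOpen_stripU _).prod hD.isOpen
  have hder : ∀ y ∈ uIcc (0 : ℝ) (T / 2), HasDerivAt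
      (fun y : ℝ => F (((T - 2 * y : ℝ) : ℂ) + w) (ξ - (y : ℂ)))
      (bulk φ k (fun p => F p.1 p.2) ((T - 2 * y : ℝ) + w, ξ - y)) y := by
    intro y hy
    rw [uIcc_of_le (by linarith)] at hy
    have hp := hmem y hy
    have hp' : (((T - 2 * y : ℝ) : ℂ) + w, ξ - (y : ℂ)) ∈ stripU (2 * d) ×ˢ Γ :=
      ⟨hsub hp.1, hp.2⟩
    have h1 := (h.holo.differentiableAt (hopen.mem_nhds hp')).hasFDerivAt
    obtain ⟨t, ht⟩ : ∃ t, t = ((T - 2 * y : ℝ) : ℂ) + w := ⟨_, rfl⟩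
    obtain ⟨s, hs⟩ : ∃ s, s = ξ - (y : ℂ) := ⟨_, rfl⟩
    have h2 : HasDerivAt (fun y : ℝ => (((T - 2 * y : ℝ) : ℂ) + w, ξ - (y : ℂ))) (-2, -1) y := by
      have h0 : HasDerivAt (fun y : ℝ => (y : ℂ)) 1 y := Complex.ofRealCLM.hasDerivAt
      refine HasDerivAt.prodMk ?_ (by simpa using h0.const_sub ξ)
      have h3 : (fun y : ℝ => ((T - 2 * y : ℝ) : ℂ) + w) = fun y : ℝ => (T : ℂ) - 2 * y + w := by
        funext y
        push_cast
        ring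
      rw [h3]
      simpa using ((h0.const_mul 2).const_sub (T : ℂ)).add_const w
    have h4 := (h1.restrictScalars ℝ).comp_hasDerivAt y h2
    refine h4.congr_deriv ?_
    simp only [← ht, ← hs] at h1 hp' ⊢
    have h5 : HasDerivAt (fun t : ℂ => (t, s)) (1, 0) t :=
      (hasDerivAt_id t).prodMk (hasDerivAt_const t s)
    have h6 : HasDerivAt (fun s : ℂ => (t, s)) (0, 1) s :=
      (hasDerivAt_const s t).prodMk (hasDerivAt_id s)
    have h7 := (HasFDerivAt.comp_hasDerivAt (f := fun t : ℂ => (t, s)) t h1 h5).deriv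
    have h8 := (HasFDerivAt.comp_hasDerivAt (f := fun s : ℂ => (t, s)) s h1 h6).deriv
    simp only [Function.comp_def] at h7 h8
    have h9 := h.eq t hp'.1 s hp'.2
    rw [h7, h8] at h9
    have h10 : ((-2 : ℂ), (-1 : ℂ)) = (-2 : ℂ) • ((1 : ℂ), (0 : ℂ)) - (0, 1) := by ext <;> simp
    rw [ContinuousLinearMap.coe_restrictScalars', h10, map_sub, map_smul, smul_eq_mul, bulk]
    linear_combination -h9
  have hcont : ContinuousOn (fun y : ℝ =>
      bulk φ k (fun p => F p.1 p.2) ((T - 2 * y : ℝ) + w, ξ - y)) (Icc 0 (T / 2)) :=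
    (h.differentiableOn_bulk hD hr hrd).continuousOn.comp
      (f := fun y : ℝ => (((T - 2 * y : ℝ) : ℂ) + w, ξ - (y : ℂ))) (by fun_prop) hmem
  have h1 := intervalIntegral.integral_eq_sub_of_hasDerivAt hder
    (hcont.intervalIntegrable_of_Icc (by linarith))
  rw [intervalIntegral.integral_of_le (by linarith)] at h1
  rw [h1]
  have e1 : T - 2 * (T / 2) = 0 := by ring
  simp [e1]

theorem integral_exp_neg_mul {b : ℝ} (hb : 0 < b) :
    IntegrableOn (fun y : ℝ => Real.exp (-b * y)) (Ioi 0) ∧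
    ∫ y in Ioi (0 : ℝ), Real.exp (-b * y) = 1 / b := by
  refine ⟨integrableOn_exp_mul_Ioi (by linarith) 0, ?_⟩
  rw [integral_exp_mul_Ioi (by linarith)]
  simp

/-- The contraction estimate behind the growth bound. If `a σ = 6`, the term with `φ` is estimated
by the inequality of arithmetic and geometric means; it contributes `1/6 + 1/8` and the term with
`k` contributes `1/12`, in total less than `1/2`. If `φ = 0` and `a σ = 1`, the term with `k` alone
contributes `1/2`. -/
theorem exists_contraction_majorant {p : ℂ → ℝ} {C σ a : ℝ} (hρ : 0 < ρ)
    (htr : ∀ s ∈ Γ, ∀ x : ℝ, 0 ≤ x → s - x ∈ Γ) (hpc : ContinuousOn p Γ)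
    (hp0 : ∀ s ∈ Γ, 0 ≤ p s) (hpb : ∀ s ∈ Γ, p s ≤ C * decayK ρ s.re)
    (hσ : 0 < σ) (ha : 0 < a)
    (hcase : ((∀ s ∈ Γ, ‖φ s‖ ^ 2 ≤ 4 * p s) ∧ a * σ = 6) ∨ ((∀ s ∈ Γ, φ s = 0) ∧ a * σ = 1))
    {ξ : ℂ} (hξ : ξ ∈ Γ) :
    ∃ Θ : ℝ → ℝ, IntegrableOn Θ (Ioi 0) ∧ (∀ y, 0 ≤ y → 0 ≤ Θ y) ∧
      ∫ y in Ioi (0 : ℝ), Θ y ≤ Real.exp (a * tailIntegral p ξ) / 2 ∧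
      ∀ y, 0 ≤ y → Real.exp (-(2 * σ) * y) * (‖φ (ξ - y)‖ *
        Real.exp (a * tailIntegral p (ξ - y)) + Real.exp (a * tailIntegral p (ξ - y)) / a) ≤
        Θ y := by
  set E := Real.exp (a * tailIntegral p ξ) with hE
  have hE0 : 0 < E := Real.exp_pos _
  have hmono : ∀ y : ℝ, 0 ≤ y → Real.exp (a * tailIntegral p (ξ - y)) ≤ E := by
    intro y hy
    refine Real.exp_le_exp.2 (mul_le_mul_of_nonneg_left ?_ ha.le)
    rw [tailIntegral_sub]
    refine setIntegral_mono_set ?_ ?_ (Ioi_subset_Ioi hy).eventuallyLE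
    · exact integrableOn_halfLine_of_norm_le htr hpc hρ
        (fun s hs => by rw [Real.norm_of_nonneg (hp0 s hs)]; exact hpb s hs) hξ
    · filter_upwards [ae_restrict_mem measurableSet_Ioi] with x hx
      exact hp0 _ (htr ξ hξ x (mem_Ioi.1 hx).le)
  obtain ⟨hi2, hI2⟩ := integral_exp_neg_mul (b := 2 * σ) (by positivity)
  have hlast : ∀ y : ℝ, 0 ≤ y → Real.exp (-(2 * σ) * y) *
      (Real.exp (a * tailIntegral p (ξ - y)) / a) ≤ E / a * Real.exp (-(2 * σ) * y) := by
    intro y hy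
    rw [mul_comm]
    gcongr
    exact hmono y hy
  rcases hcase with ⟨hφ, haσ⟩ | ⟨hφ, haσ⟩
  · obtain ⟨hi4, hI4⟩ := integral_exp_neg_mul (b := 4 * σ) (by positivity)
    obtain ⟨hip, hIp⟩ := tailIntegral_exp_bound hρ htr hpc hp0 hpb (a := 2 * a) (by positivity) hξ
    have hE2 : Real.exp (2 * a * tailIntegral p ξ) = E ^ 2 := by
      rw [hE, ← Real.exp_nat_mul]
      congr 1
      push_cast
      ring
    rw [hE2] at hIp
    refine ⟨fun y => 2 / (σ * E) *
      (p (ξ - y) * Real.exp (2 * a * tailIntegral p (ξ - y))) +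
      σ * E / 2 * Real.exp (-(4 * σ) * y) + E / a * Real.exp (-(2 * σ) * y),
      ((hip.const_mul _).add (hi4.const_mul _)).add (hi2.const_mul _), fun y hy => ?_, ?_,
      fun y hy => ?_⟩
    · have := hp0 _ (htr ξ hξ y hy)
      positivity
    · have hsplit := integral_add ((hip.const_mul (2 / (σ * E))).add
        (hi4.const_mul (σ * E / 2))) (hi2.const_mul (E / a))
      have hsplit' := integral_add (hip.const_mul (2 / (σ * E))) (hi4.const_mul (σ * E / 2))
      simp only [Pi.add_apply] at hsplit
      rw [hsplit, hsplit', integral_const_mul, integral_const_mul, integral_const_mul, hI4, hI2]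
      have h1 : 2 / (σ * E) * ∫ x in Ioi (0 : ℝ), p (ξ - x) *
          Real.exp (2 * a * tailIntegral p (ξ - x)) ≤ 2 / (σ * E) * (E ^ 2 / (2 * a)) :=
        mul_le_mul_of_nonneg_left hIp (by positivity)
      have h2 : 2 / (σ * E) * (E ^ 2 / (2 * a)) = E / 6 := by
        rw [← haσ]
        field_simp
      have h3 : σ * E / 2 * (1 / (4 * σ)) = E / 8 := by
        field_simp
        norm_num
      have h4 : E / a * (1 / (2 * σ)) = E / 12 := by
        rw [show (12 : ℝ) = 2 * (a * σ) by rw [haσ]; norm_num]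
        field_simp
      linarith
    · rw [mul_add]
      refine add_le_add ?_ (hlast y hy)
      set X := ‖φ (ξ - y)‖ * Real.exp (a * tailIntegral p (ξ - y)) with hX
      set Z := Real.exp (-(2 * σ) * y) with hZ
      have hZ2 : Real.exp (-(4 * σ) * y) = Z ^ 2 := by
        rw [hZ, ← Real.exp_nat_mul]
        congr 1
        push_cast
        ring
      have hX2 : X ^ 2 ≤ 4 * (p (ξ - y) * Real.exp (2 * a * tailIntegral p (ξ - y))) := by
        have h1 : Real.exp (2 * a * tailIntegral p (ξ - y)) =
            Real.exp (a * tailIntegral p (ξ - y)) ^ 2 := by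
          rw [← Real.exp_nat_mul]
          congr 1
          push_cast
          ring
        rw [h1, hX, mul_pow, ← mul_assoc]
        exact mul_le_mul_of_nonneg_right (hφ _ (htr ξ hξ y hy)) (by positivity)
      -- the weight `σ E` makes the two terms integrate to `E / 6` and `E / 8`
      have h1 : Z * X ≤ 1 / (2 * (σ * E)) * X ^ 2 + σ * E / 2 * Z ^ 2 := by
        have hs : 0 < σ * E := by positivity
        have h2 : 1 / (2 * (σ * E)) * X ^ 2 + σ * E / 2 * Z ^ 2 - Z * X =
            1 / (2 * (σ * E)) * (X - σ * E * Z) ^ 2 := by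
          field_simp
          ring
        have h3 : 0 ≤ 1 / (2 * (σ * E)) * (X - σ * E * Z) ^ 2 := by positivity
        linarith
      rw [hZ2]
      refine h1.trans (add_le_add ?_ le_rfl)
      refine (mul_le_mul_of_nonneg_left hX2 (by positivity)).trans (le_of_eq ?_)
      field_simp
      norm_num
  · refine ⟨fun y => E / a * Real.exp (-(2 * σ) * y), hi2.const_mul _, fun y _ => by positivity,
      ?_, fun y hy => ?_⟩
    · rw [integral_const_mul, hI2]
      refine le_of_eq ?_
      have h1 : E / a * (1 / (2 * σ)) = E / (2 * (a * σ)) := by field_simp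
      rw [h1, haσ, mul_one]
    · rw [hφ _ (htr ξ hξ y hy), norm_zero, zero_mul, zero_add]
      exact hlast y hy

/-- The Borel transform grows at most like `exp (σ t)` along the strip, with explicit constants. -/
theorem BorelSol.growth_bound (h : BorelSol φ k Γ ρ d F) (hD : HasDecay φ k Γ ρ c)
    {p : ℂ → ℝ} {C σ a : ℝ} (hpc : ContinuousOn p Γ)
    (hp0 : ∀ s ∈ Γ, 0 ≤ p s) (hpb : ∀ s ∈ Γ, p s ≤ C * decayK ρ s.re) (hkp : ∀ s ∈ Γ, ‖k s‖ ≤ p s)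
    (hσ : 0 < σ) (ha : 0 < a)
    (hcase : ((∀ s ∈ Γ, ‖φ s‖ ^ 2 ≤ 4 * p s) ∧ a * σ = 6) ∨ ((∀ s ∈ Γ, φ s = 0) ∧ a * σ = 1))
    {r : ℝ} (hr : 0 < r) (hrd : r < d) {w : ℂ} (hw : w ∈ stripU (2 * r)) {S : ℝ}
    (hS : ∀ ξ ∈ Γ, weight 1 ρ ξ * ‖F w ξ‖ ≤ S) {T : ℝ} (hT : 0 ≤ T) {ξ : ℂ} (hξ : ξ ∈ Γ) :
    ‖F (T + w) ξ‖ ≤ 2 * S * (Real.exp (σ * T) * Real.exp (a * tailIntegral p ξ) /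
      weight 1 ρ ξ) := by
  have hW0 : ∀ s, 0 < weight 1 ρ s := fun s => one_pos.trans_le (one_le_weight _ _ _)
  have hS0 : 0 ≤ S := (mul_nonneg (hW0 ξ).le (norm_nonneg _)).trans (hS ξ hξ)
  have htr := hD.translate
  set Q : ℝ → ℂ → ℝ := fun t ξ => Real.exp (σ * t) * Real.exp (a * tailIntegral p ξ) /
    weight 1 ρ ξ with hQ
  have hQ0 : ∀ t ξ, 0 < Q t ξ := fun t ξ => div_pos (by positivity) (hW0 ξ)
  -- one application of the integral equation improves a bound with constant `P` to `S + P / 2`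
  have step : ∀ P : ℝ, 0 ≤ P → (∀ t ∈ Icc (0 : ℝ) T, ∀ ξ ∈ Γ, ‖F (t + w) ξ‖ ≤ P * Q t ξ) →
      ∀ t ∈ Icc (0 : ℝ) T, ∀ ξ ∈ Γ, ‖F (t + w) ξ‖ ≤ (S + P / 2) * Q t ξ := by
    intro P hP hF t ht ξ hξ
    obtain ⟨Θ, hΘi, hΘ0, hΘI, hΘ⟩ := exists_contraction_majorant hD.rho_pos htr hpc hp0 hpb hσ ha
      hcase hξ
    set B := P * Real.exp (σ * t) / weight 1 ρ ξ with hB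
    have hB0 : 0 ≤ B := div_nonneg (by positivity) (hW0 ξ).le
    have hbulk : ∀ y ∈ Ioc (0 : ℝ) (t / 2),
        ‖bulk φ k (fun p => F p.1 p.2) ((t - 2 * y : ℝ) + w, ξ - y)‖ ≤ B * Θ y := by
      intro y hy
      have hy' : t - 2 * y ∈ Icc (0 : ℝ) T := ⟨by linarith [hy.2], by linarith [hy.1, ht.2]⟩
      have hsy := htr ξ hξ y hy.1.le
      obtain ⟨hki, hkI⟩ := tailIntegral_exp_bound hD.rho_pos htr hpc hp0 hpb ha hsy
      set A := Real.exp (a * tailIntegral p (ξ - y)) with hA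
      have hbd : ∀ x : ℝ, 0 ≤ x → ‖F ((t - 2 * y : ℝ) + w) (ξ - y - x)‖ ≤
          B * Real.exp (-(2 * σ) * y) * Real.exp (a * tailIntegral p (ξ - y - x)) := by
        intro x hx
        refine (hF _ hy' _ (htr _ hsy x hx)).trans ?_
        have h1 : weight 1 ρ ξ ≤ weight 1 ρ (ξ - y - x) :=
          weight_le_of_re_le hD.rho_pos (by simp; linarith [hy.1])
        have h2 : Real.exp (σ * (t - 2 * y)) = Real.exp (σ * t) * Real.exp (-(2 * σ) * y) := by
          rw [← Real.exp_add]
          congr 1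
          ring
        simp only [hQ, h2]
        calc P * (Real.exp (σ * t) * Real.exp (-(2 * σ) * y) *
              Real.exp (a * tailIntegral p (ξ - y - x)) / weight 1 ρ (ξ - y - x))
            ≤ P * (Real.exp (σ * t) * Real.exp (-(2 * σ) * y) *
              Real.exp (a * tailIntegral p (ξ - y - x)) / weight 1 ρ ξ) := by
              have := hW0 ξ
              gcongr
          _ = _ := by rw [hB]; ring
      have h1 : ‖φ (ξ - y) * F ((t - 2 * y : ℝ) + w) (ξ - y)‖ ≤
          B * (Real.exp (-(2 * σ) * y) * (‖φ (ξ - y)‖ * A)) := by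
        have h2 := hbd 0 le_rfl
        simp only [Complex.ofReal_zero, sub_zero] at h2
        rw [norm_mul]
        refine (mul_le_mul_of_nonneg_left h2 (norm_nonneg _)).trans (le_of_eq ?_)
        ring
      have h3 : ‖∫ x in Ioi (0 : ℝ), k (ξ - y - x) * F ((t - 2 * y : ℝ) + w) (ξ - y - x)‖ ≤
          B * (Real.exp (-(2 * σ) * y) * (A / a)) := by
        refine (norm_integral_le_of_norm_le
          (hki.const_mul (B * Real.exp (-(2 * σ) * y))) ?_).trans ?_
        · filter_upwards [ae_restrict_mem measurableSet_Ioi] with x hx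
          have hx0 := (mem_Ioi.1 hx).le
          rw [norm_mul]
          refine (mul_le_mul (hkp _ (htr _ hsy x hx0)) (hbd x hx0) (norm_nonneg _)
            (hp0 _ (htr _ hsy x hx0))).trans (le_of_eq ?_)
          ring
        · rw [integral_const_mul, ← mul_assoc]
          exact mul_le_mul_of_nonneg_left hkI (by positivity)
      refine (norm_add_le _ _).trans ((add_le_add h1 h3).trans ?_)
      rw [← mul_add, ← mul_add]
      exact mul_le_mul_of_nonneg_left (hΘ y hy.1.le) hB0
    rw [h.integral_along_characteristic hD hr hrd hw ht.1 hξ]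
    have h1 : ‖F w (ξ - (t / 2 : ℝ))‖ ≤ S * Q t ξ := by
      have h2 := hS _ (htr ξ hξ (t / 2) (by linarith [ht.1]))
      have h3 : weight 1 ρ ξ ≤ weight 1 ρ (ξ - (t / 2 : ℝ)) :=
        weight_le_of_re_le hD.rho_pos (by simp; linarith [ht.1])
      have h4 : ‖F w (ξ - (t / 2 : ℝ))‖ ≤ S / weight 1 ρ ξ := by
        rw [le_div_iff₀ (hW0 ξ), mul_comm]
        exact (mul_le_mul_of_nonneg_right h3 (norm_nonneg _)).trans h2
      refine h4.trans ?_
      rw [div_eq_mul_one_div]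
      refine mul_le_mul_of_nonneg_left ?_ hS0
      refine div_le_div_of_nonneg_right ?_ (hW0 ξ).le
      have h5 := tailIntegral_nonneg htr hp0 hξ
      have h6 := ht.1
      exact one_le_mul_of_one_le_of_one_le (Real.one_le_exp (by positivity))
        (Real.one_le_exp (by positivity))
    have h2 : ‖∫ y in Ioc (0 : ℝ) (t / 2),
        bulk φ k (fun p => F p.1 p.2) ((t - 2 * y : ℝ) + w, ξ - y)‖ ≤ P / 2 * Q t ξ := by
      have h3 : ‖∫ y in Ioc (0 : ℝ) (t / 2),
          bulk φ k (fun p => F p.1 p.2) ((t - 2 * y : ℝ) + w, ξ - y)‖ ≤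
          ∫ y in Ioc (0 : ℝ) (t / 2), B * Θ y := by
        refine norm_integral_le_of_norm_le ((hΘi.mono_set Ioc_subset_Ioi_self).const_mul B) ?_
        filter_upwards [ae_restrict_mem measurableSet_Ioc] with y hy using hbulk y hy
      have h4 : ∫ y in Ioc (0 : ℝ) (t / 2), Θ y ≤ ∫ y in Ioi (0 : ℝ), Θ y := by
        refine setIntegral_mono_set hΘi ?_ Ioc_subset_Ioi_self.eventuallyLE
        filter_upwards [ae_restrict_mem measurableSet_Ioi] with y hy using hΘ0 y (mem_Ioi.1 hy).le
      rw [integral_const_mul] at h3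
      refine h3.trans ((mul_le_mul_of_nonneg_left (h4.trans hΘI) hB0).trans (le_of_eq ?_))
      simp only [hB, hQ]
      ring
    refine (norm_sub_le _ _).trans ((add_le_add h1 h2).trans (le_of_eq ?_))
    ring
  -- some finite constant is available on `[0, T]` to start from
  obtain ⟨K, L, hK, hL, hb⟩ := h.bound r hr hrd
  obtain ⟨P₀, hP₀⟩ : ∃ P₀, P₀ = K * Real.exp (L * (T + ‖w‖)) := ⟨_, rfl⟩
  have hP₀0 : 0 ≤ P₀ := by rw [hP₀]; positivity
  have start : ∀ t ∈ Icc (0 : ℝ) T, ∀ ξ ∈ Γ, ‖F (t + w) ξ‖ ≤ P₀ * Q t ξ := by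
    intro t ht ξ hξ
    have hts : (t : ℂ) + w ∈ stripU (2 * r) :=
      add_mem_stripU (by simpa using ht.1) (Complex.ofReal_im _) hw
    have h1 : ‖(t : ℂ) + w‖ ≤ T + ‖w‖ := by
      refine (norm_add_le _ _).trans (add_le_add ?_ le_rfl)
      rw [Complex.norm_real, Real.norm_of_nonneg ht.1]
      exact ht.2
    have h2 : decayM ρ ξ.re ≤ Q t ξ := by
      have h3 : decayM ρ ξ.re ≤ 1 / weight 1 ρ ξ := by
        rw [le_div_iff₀ (hW0 ξ), mul_comm]
        exact weight_mul_decayM_le hD.rho_pos ξ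
      refine h3.trans (div_le_div_of_nonneg_right ?_ (hW0 ξ).le)
      have h5 := tailIntegral_nonneg htr hp0 hξ
      have h6 := ht.1
      exact one_le_mul_of_one_le_of_one_le (Real.one_le_exp (by positivity))
        (Real.one_le_exp (by positivity))
    refine (hb _ hts ξ hξ).trans (mul_le_mul ?_ h2 (decayM_pos _ _).le hP₀0)
    rw [hP₀]
    gcongr
  -- iterating, the constants tend to the fixed point `2 S` of `P ↦ S + P / 2`
  have iter : ∀ n : ℕ, ∀ t ∈ Icc (0 : ℝ) T, ∀ ξ ∈ Γ,
      ‖F (t + w) ξ‖ ≤ (2 * S + P₀ * (1 / 2) ^ n) * Q t ξ := by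
    intro n
    induction n with
    | zero =>
      intro t ht ξ hξ
      refine (start t ht ξ hξ).trans (mul_le_mul_of_nonneg_right ?_ (hQ0 t ξ).le)
      simp
      linarith
    | succ n ih =>
      intro t ht ξ hξ
      refine (step _ (by positivity) ih t ht ξ hξ).trans (le_of_eq ?_)
      rw [pow_succ]
      ring
  have hlim : Tendsto (fun n : ℕ => (2 * S + P₀ * (1 / 2) ^ n) * Q T ξ) atTop
      (𝓝 ((2 * S + P₀ * 0) * Q T ξ)) :=
    (((tendsto_pow_atTop_nhds_zero_of_lt_one (by norm_num) (by norm_num)).const_mul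
      P₀).const_add _).mul_const _
  rw [mul_zero, add_zero] at hlim
  exact ge_of_tendsto' hlim (fun n => iter n T ⟨hT, le_rfl⟩ ξ hξ)

end

/-! ### Laplace transforms and integration by parts -/

section

variable {f : ℂ → ℂ} {U : Set ℂ} {σ C : ℝ} {u : ℂ}

theorem norm_cexp_neg_mul (u : ℂ) (t : ℝ) : ‖cexp (-u * t)‖ = Real.exp (-u.re * t) := by
  rw [Complex.norm_exp]
  simp

theorem integrableOn_laplace {g : ℝ → ℂ} (hg : ContinuousOn g (Ioi 0))
    (hb : ∀ t : ℝ, 0 ≤ t → ‖g t‖ ≤ C * Real.exp (σ * t)) (hu : σ < u.re) :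
    IntegrableOn (fun t : ℝ => cexp (-u * t) * g t) (Ioi 0) ∧
    ‖∫ t in Ioi (0 : ℝ), cexp (-u * t) * g t‖ ≤ C / (u.re - σ) := by
  obtain ⟨h1, h2⟩ := integral_exp_neg_mul (b := u.re - σ) (by linarith)
  have hle : ∀ᵐ (t : ℝ) ∂(volume.restrict (Ioi (0 : ℝ))),
      ‖cexp (-u * t) * g t‖ ≤ C * Real.exp (-(u.re - σ) * t) := by
    filter_upwards [ae_restrict_mem measurableSet_Ioi] with t ht
    rw [norm_mul, norm_cexp_neg_mul]
    calc Real.exp (-u.re * t) * ‖g t‖ ≤ Real.exp (-u.re * t) * (C * Real.exp (σ * t)) := by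
          gcongr
          exact hb t (mem_Ioi.1 ht).le
      _ = C * (Real.exp (-u.re * t) * Real.exp (σ * t)) := by ring
      _ = C * Real.exp (-(u.re - σ) * t) := by
          rw [← Real.exp_add]
          congr 2
          ring
  refine ⟨(h1.const_mul C).mono' ?_ hle, ?_⟩
  · refine ContinuousOn.aestronglyMeasurable (s := Ioi (0 : ℝ)) ?_ measurableSet_Ioi
    exact ContinuousOn.mul (by fun_prop) hg
  · refine (norm_integral_le_of_norm_le (h1.const_mul C) hle).trans (le_of_eq ?_)
    rw [integral_const_mul, h2]
    ring

theorem differentiableOn_iteratedDeriv_of_isOpen (hU : IsOpen U)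
    (hf : DifferentiableOn ℂ f U) (n : ℕ) :
    DifferentiableOn ℂ (iteratedDeriv n f) U := by
  induction n with
  | zero => simpa using hf
  | succ n ih =>
    rw [iteratedDeriv_succ]
    exact ih.deriv hU

theorem laplace_by_parts (hU : IsOpen U) (hUr : ∀ t : ℝ, 0 ≤ t → (t : ℂ) ∈ U)
    (hf : DifferentiableOn ℂ f U)
    (hb : ∀ t : ℝ, 0 ≤ t → ‖f t‖ ≤ C * Real.exp (σ * t))
    (hb' : ∀ t : ℝ, 0 ≤ t → ‖deriv f t‖ ≤ C * Real.exp (σ * t)) (hu : σ < u.re) :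
    u * ∫ t in Ioi (0 : ℝ), cexp (-u * t) * f t =
      f 0 + ∫ t in Ioi (0 : ℝ), cexp (-u * t) * deriv f t := by
  have hcont : ∀ {g : ℂ → ℂ}, DifferentiableOn ℂ g U →
      ContinuousOn (fun t : ℝ => g t) (Ioi 0) := fun hg =>
    hg.continuousOn.comp (by fun_prop) (fun t ht => hUr t (mem_Ioi.1 ht).le)
  obtain ⟨hi, -⟩ := integrableOn_laplace (u := u) (g := fun t : ℝ => f t) (hcont hf) hb hu
  obtain ⟨hi', -⟩ := integrableOn_laplace (u := u) (g := fun t : ℝ => deriv f t)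
    (hcont (hf.deriv hU)) hb' hu
  have hder : ∀ t ∈ Ici (0 : ℝ), HasDerivAt (fun t : ℝ => cexp (-u * t) * f t)
      (cexp (-u * t) * deriv f t - u * (cexp (-u * t) * f t)) t := by
    intro t ht
    have h0 : HasDerivAt (fun t : ℝ => (t : ℂ)) 1 t := Complex.ofRealCLM.hasDerivAt
    have h1 : HasDerivAt (fun t : ℝ => cexp (-u * t)) (cexp (-u * t) * (-u)) t := by
      simpa using (h0.const_mul (-u)).cexp
    have h2 := (hf.differentiableAt (hU.mem_nhds (hUr t ht))).hasDerivAt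
    have h3 := HasDerivAt.comp (h₂ := f) (h := fun t : ℝ => (t : ℂ)) t h2 h0
    refine (h1.mul h3).congr_deriv ?_
    simp only [Function.comp_apply]
    ring
  have hlim : Tendsto (fun t : ℝ => cexp (-u * t) * f t) atTop (𝓝 0) := by
    have h1 : Tendsto (fun t : ℝ => C * Real.exp (-((u.re - σ) * t))) atTop (𝓝 0) := by
      have h2 : Tendsto (fun t : ℝ => (u.re - σ) * t) atTop atTop :=
        tendsto_id.const_mul_atTop (by linarith)
      simpa using (Real.tendsto_exp_neg_atTop_nhds_zero.comp h2).const_mul C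
    refine squeeze_zero_norm' ?_ h1
    filter_upwards [eventually_ge_atTop 0] with t ht
    rw [norm_mul, norm_cexp_neg_mul]
    calc Real.exp (-u.re * t) * ‖f t‖ ≤ Real.exp (-u.re * t) * (C * Real.exp (σ * t)) := by
          gcongr
          exact hb t ht
      _ = C * (Real.exp (-u.re * t) * Real.exp (σ * t)) := by ring
      _ = C * Real.exp (-((u.re - σ) * t)) := by
          rw [← Real.exp_add]
          congr 2
          ring
  have h := integral_Ioi_of_hasDerivAt_of_tendsto' hder (hi'.sub (hi.const_mul u)) hlim
  rw [integral_sub hi' (hi.const_mul u), integral_const_mul] at h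
  simp only [Complex.ofReal_zero, mul_zero, Complex.exp_zero, one_mul] at h
  linear_combination -h

/-- Watson's lemma with exact remainder: repeated integration by parts. -/
theorem laplace_expansion (hU : IsOpen U) (hUr : ∀ t : ℝ, 0 ≤ t → (t : ℂ) ∈ U)
    (hf : DifferentiableOn ℂ f U)
    (hb : ∀ n : ℕ, ∃ C : ℝ, 0 ≤ C ∧ ∀ t : ℝ, 0 ≤ t →
      ‖iteratedDeriv n f t‖ ≤ C * Real.exp (σ * t)) (hu : σ < u.re) (hu0 : u ≠ 0)
    {A : ℕ → ℂ} (hA : ∀ n, A (n + 1) = iteratedDeriv n f 0) {N : ℕ} (hN : 1 ≤ N) :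
    (∫ t in Ioi (0 : ℝ), cexp (-u * t) * f t) - ∑ n ∈ Finset.Ico 1 N, A n / u ^ n =
      A N / u ^ N + (∫ t in Ioi (0 : ℝ), cexp (-u * t) * iteratedDeriv N f t) / u ^ N := by
  have step : ∀ n, u * ∫ t in Ioi (0 : ℝ), cexp (-u * t) * iteratedDeriv n f t =
      A (n + 1) + ∫ t in Ioi (0 : ℝ), cexp (-u * t) * iteratedDeriv (n + 1) f t := by
    intro n
    obtain ⟨C, hC, hCb⟩ := hb n
    obtain ⟨C', hC', hCb'⟩ := hb (n + 1)
    rw [iteratedDeriv_succ] at hCb'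
    rw [hA, iteratedDeriv_succ]
    refine laplace_by_parts hU hUr (differentiableOn_iteratedDeriv_of_isOpen hU hf n) (C := C + C')
      (fun t ht => (hCb t ht).trans ?_) (fun t ht => (hCb' t ht).trans ?_) hu
    · gcongr
      linarith
    · gcongr
      linarith
  induction N, hN using Nat.le_induction with
  | base =>
    have h := step 0
    rw [iteratedDeriv_zero, zero_add] at h
    rw [Finset.Ico_self, Finset.sum_empty, sub_zero, pow_one, ← add_div, eq_div_iff hu0, mul_comm]
    exact h
  | succ N hN ih =>
    rw [Finset.sum_Ico_succ_top hN, ← sub_sub, ih, add_sub_cancel_left]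
    rw [← add_div, ← step N, pow_succ, mul_comm (u ^ N) u, mul_div_mul_left _ _ hu0]

end

section

variable {φ ψ k : ℂ → ℂ} {Γ : Set ℂ} {ρ c d : ℝ} {F : ℂ → ℂ → ℂ}

/-- Cauchy's estimate on the circle of radius `2 r` about `t`, combined with the growth bound. -/
theorem BorelSol.norm_iteratedDeriv_le (h : BorelSol φ k Γ ρ d F) (hD : HasDecay φ k Γ ρ c)
    {p : ℂ → ℝ} {C σ a : ℝ} (hpc : ContinuousOn p Γ)
    (hp0 : ∀ s ∈ Γ, 0 ≤ p s) (hpb : ∀ s ∈ Γ, p s ≤ C * decayK ρ s.re) (hkp : ∀ s ∈ Γ, ‖k s‖ ≤ p s)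
    (hσ : 0 < σ) (ha : 0 < a)
    (hcase : ((∀ s ∈ Γ, ‖φ s‖ ^ 2 ≤ 4 * p s) ∧ a * σ = 6) ∨ ((∀ s ∈ Γ, φ s = 0) ∧ a * σ = 1))
    {r : ℝ} (hr : 0 < r) (hrd : r < d) {S : ℝ}
    (hS : ∀ w : ℂ, ‖w‖ = 2 * r → ∀ ξ ∈ Γ, weight 1 ρ ξ * ‖F w ξ‖ ≤ S) (n : ℕ) {t : ℝ} (ht : 0 ≤ t)
    {ξ : ℂ} (hξ : ξ ∈ Γ) :
    ‖iteratedDeriv n (fun t => F t ξ) t‖ ≤ n.factorial * (2 * S * (Real.exp (σ * t) *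
      Real.exp (a * tailIntegral p ξ) / weight 1 ρ ξ)) / (2 * r) ^ n := by
  have hr' : 0 < 2 * r := by positivity
  obtain ⟨r', hrr, hr'd⟩ := exists_between hrd
  refine Complex.norm_iteratedDeriv_le_of_forall_mem_sphere_norm_le n hr'
    (((h.differentiableOn_fst hξ).mono ?_).diffContOnCl) (fun s hs => ?_)
  · rw [closure_ball _ hr'.ne']
    intro s hs
    have h1 : s = (t : ℂ) + (s - t) := by ring
    rw [h1]
    refine add_mem_stripU (by simpa using ht) (Complex.ofReal_im _) (ball_subset_stripU _ ?_)
    rw [Metric.mem_closedBall, dist_eq_norm] at hs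
    rw [mem_ball_zero_iff]
    linarith
  · have h2 : ‖s - t‖ = 2 * r := by simpa [dist_eq_norm] using hs
    have h1 : s = (t : ℂ) + (s - t) := by ring
    rw [h1]
    refine h.growth_bound hD hpc hp0 hpb hkp hσ ha hcase (hr.trans hrr) hr'd (w := s - t)
      (ball_subset_stripU _ ?_) (hS _ h2) ht hξ
    rw [mem_ball_zero_iff]
    linarith

theorem BorelSol.weight_mul_norm_le (h : BorelSol φ k Γ ρ d F) (hρ : 0 < ρ) {r : ℝ} (hr : 0 < r)
    (hrd : r < d) : ∃ S : ℝ, ∀ w : ℂ, ‖w‖ = 2 * r → ∀ ξ ∈ Γ, weight 1 ρ ξ * ‖F w ξ‖ ≤ S := by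
  obtain ⟨r', hrr, hr'd⟩ := exists_between hrd
  obtain ⟨K, L, hK, hL, hb⟩ := h.bound r' (hr.trans hrr) hr'd
  refine ⟨K * Real.exp (L * (2 * r)), fun w hw ξ hξ => ?_⟩
  have hws : w ∈ stripU (2 * r') := by
    refine ball_subset_stripU _ ?_
    rw [mem_ball_zero_iff]
    linarith
  have h1 := hb w hws ξ hξ
  rw [hw] at h1
  have h2 := weight_mul_decayM_le hρ ξ
  have hW0 : 0 < weight 1 ρ ξ := one_pos.trans_le (one_le_weight _ _ _)
  calc weight 1 ρ ξ * ‖F w ξ‖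
      ≤ weight 1 ρ ξ * (K * Real.exp (L * (2 * r)) * decayM ρ ξ.re) := by gcongr
    _ = K * Real.exp (L * (2 * r)) * (weight 1 ρ ξ * decayM ρ ξ.re) := by ring
    _ ≤ K * Real.exp (L * (2 * r)) := mul_le_of_le_one_right (by positivity) h2

/-- Every derivative of the Borel transform has exponential type at most `σ` on the positive axis,
for every `σ > 0`, uniformly on `Γ`. -/
theorem BorelSol.exists_exp_bound (h : BorelSol φ k Γ ρ d F) (hd : 0 < d)
    (hD : HasDecay φ k Γ ρ c)
    {p : ℂ → ℝ} {C : ℝ} (hC : 0 ≤ C) (hpc : ContinuousOn p Γ) (hp0 : ∀ s ∈ Γ, 0 ≤ p s)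
    (hpb : ∀ s ∈ Γ, p s ≤ C * decayK ρ s.re) (hkp : ∀ s ∈ Γ, ‖k s‖ ≤ p s)
    (hφp : ∀ s ∈ Γ, ‖φ s‖ ^ 2 ≤ 4 * p s) {σ : ℝ} (hσ : 0 < σ) (n : ℕ) :
    ∃ B : ℝ, 0 ≤ B ∧ ∀ t : ℝ, 0 ≤ t → ∀ ξ ∈ Γ,
      ‖iteratedDeriv n (fun t => F t ξ) t‖ ≤ B * (weight 1 ρ ξ)⁻¹ * Real.exp (σ * t) := by
  obtain ⟨S, hS⟩ := h.weight_mul_norm_le hD.rho_pos (half_pos hd) (half_lt_self hd)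
  obtain ⟨C', hC', hCb'⟩ := exists_integral_decayK_le hD.rho_pos
  have hW0 : ∀ ξ, 0 < weight 1 ρ ξ := fun ξ => one_pos.trans_le (one_le_weight _ _ _)
  have hS' : ∀ w : ℂ, ‖w‖ = 2 * (d / 2) → ∀ ξ ∈ Γ, weight 1 ρ ξ * ‖F w ξ‖ ≤ |S| :=
    fun w hw ξ hξ => (hS w hw ξ hξ).trans (le_abs_self S)
  have hDle : ∀ ξ ∈ Γ, tailIntegral p ξ ≤ C * C' := by
    intro ξ hξ
    have h1 : tailIntegral p ξ ≤ ∫ x in Ioi (0 : ℝ), C * decayK ρ (ξ.re - x) := by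
      refine setIntegral_mono_on ?_ ((integrableOn_decayK_sub hD.rho_pos _).const_mul _)
        measurableSet_Ioi (fun x hx => ?_)
      · exact integrableOn_halfLine_of_norm_le hD.translate hpc hD.rho_pos
          (fun s hs => by rw [Real.norm_of_nonneg (hp0 s hs)]; exact hpb s hs) hξ
      · simpa using hpb _ (hD.translate ξ hξ x (mem_Ioi.1 hx).le)
    rw [integral_const_mul] at h1
    refine h1.trans (mul_le_mul_of_nonneg_left ?_ hC)
    exact (hCb' _).trans (mul_le_of_le_one_right hC'.le (decayM_le_one hD.rho_pos _))
  refine ⟨n.factorial * (2 * |S| * Real.exp (6 / σ * (C * C'))) / (2 * (d / 2)) ^ n,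
    by positivity, fun t ht ξ hξ => ?_⟩
  refine (h.norm_iteratedDeriv_le hD hpc hp0 hpb hkp hσ (a := 6 / σ) (by positivity)
    (Or.inl ⟨hφp, by field_simp⟩) (half_pos hd) (half_lt_self hd) hS' n ht hξ).trans ?_
  have := hW0 ξ
  calc n.factorial * (2 * |S| * (Real.exp (σ * t) * Real.exp (6 / σ * tailIntegral p ξ) /
        weight 1 ρ ξ)) / (2 * (d / 2)) ^ n
      ≤ n.factorial * (2 * |S| * (Real.exp (σ * t) * Real.exp (6 / σ * (C * C')) /
        weight 1 ρ ξ)) / (2 * (d / 2)) ^ n := by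
        gcongr
        exact hDle ξ hξ
    _ = _ := by
        rw [div_eq_mul_inv _ (weight 1 ρ ξ)]
        ring

end

/-! ### The Laplace transform of the Borel transform -/

/-- All `t`-derivatives of `F` grow on the positive axis slower than every exponential, and decay
in `ξ` like the reciprocal of the weight. -/
def SubexponentialOn (F : ℂ → ℂ → ℂ) (Γ : Set ℂ) (ρ : ℝ) : Prop :=
  ∀ σ : ℝ, 0 < σ → ∀ n : ℕ, ∃ B : ℝ, 0 ≤ B ∧ ∀ t : ℝ, 0 ≤ t → ∀ ξ ∈ Γ,
    ‖iteratedDeriv n (fun t => F t ξ) t‖ ≤ B * (weight 1 ρ ξ)⁻¹ * Real.exp (σ * t)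

/-- The Laplace transform `∫_0^∞ exp (-u t) F(t, ξ) dt` of the Borel transform. -/
def laplaceBorel (F : ℂ → ℂ → ℂ) (u ξ : ℂ) : ℂ :=
  ∫ t in Ioi (0 : ℝ), cexp (-u * t) * F t ξ

section

variable {φ ψ k : ℂ → ℂ} {Γ : Set ℂ} {ρ c d : ℝ} {F : ℂ → ℂ → ℂ}

theorem inv_weight_nonneg (ε ρ : ℝ) (ξ : ℂ) : 0 ≤ (weight ε ρ ξ)⁻¹ :=
  inv_nonneg.2 (zero_le_one.trans (one_le_weight _ _ _))

theorem inv_weight_le_one (ε ρ : ℝ) (ξ : ℂ) : (weight ε ρ ξ)⁻¹ ≤ 1 :=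
  inv_le_one_of_one_le₀ (one_le_weight _ _ _)

theorem BorelSol.continuousOn_axis (h : BorelSol φ k Γ ρ d F) (hd : 0 < d) {ξ : ℂ} (hξ : ξ ∈ Γ) :
    ContinuousOn (fun t : ℝ => F t ξ) (Ioi 0) :=
  (h.differentiableOn_fst hξ).continuousOn.comp (f := fun t : ℝ => (t : ℂ)) (by fun_prop)
    (fun _ ht => ofReal_mem_stripU (by positivity) (mem_Ioi.1 ht).le)

theorem SubexponentialOn.bound (hE : SubexponentialOn F Γ ρ) {σ : ℝ} (hσ : 0 < σ) :
    ∃ B : ℝ, 0 ≤ B ∧ ∀ t : ℝ, 0 ≤ t → ∀ ξ ∈ Γ,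
      ‖F t ξ‖ ≤ B * (weight 1 ρ ξ)⁻¹ * Real.exp (σ * t) := by
  simpa only [iteratedDeriv_zero] using hE σ hσ 0

theorem BorelSol.norm_laplaceBorel_le (h : BorelSol φ k Γ ρ d F) (hd : 0 < d)
    (hE : SubexponentialOn F Γ ρ) {u : ℂ} (hu : 0 < u.re) :
    ∃ B : ℝ, 0 ≤ B ∧ ∀ ξ ∈ Γ, IntegrableOn (fun t : ℝ => cexp (-u * t) * F t ξ) (Ioi 0) ∧
      ‖laplaceBorel F u ξ‖ ≤ B * (weight 1 ρ ξ)⁻¹ := by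
  obtain ⟨B, hB, hb⟩ := hE.bound (half_pos hu)
  refine ⟨B / (u.re - u.re / 2), div_nonneg hB (by linarith), fun ξ hξ => ?_⟩
  obtain ⟨h1, h2⟩ := integrableOn_laplace (u := u) (g := fun t : ℝ => F t ξ)
    (h.continuousOn_axis hd hξ) (fun t ht => hb t ht ξ hξ) (half_lt_self hu)
  exact ⟨h1, h2.trans (le_of_eq (by ring))⟩

/-- Near `u₀` the integrand of the Laplace transform is dominated uniformly on `Γ`. -/
theorem SubexponentialOn.exists_majorant (hE : SubexponentialOn F Γ ρ) {u₀ : ℂ} (hu : 0 < u₀.re) :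
    ∃ g : ℝ → ℝ, Integrable g (volume.restrict (Ioi 0)) ∧ ∀ t : ℝ, 0 ≤ t →
      ∀ u ∈ Metric.ball u₀ (u₀.re / 2), ∀ ξ ∈ Γ, ‖cexp (-u * t) * F t ξ‖ ≤ g t := by
  obtain ⟨B, hB, hb⟩ := hE.bound (σ := u₀.re / 4) (by linarith)
  obtain ⟨h1, -⟩ := integral_exp_neg_mul (b := u₀.re / 4) (by linarith)
  refine ⟨fun t => B * Real.exp (-(u₀.re / 4) * t), h1.const_mul B, fun t ht u hu' ξ hξ => ?_⟩
  rw [norm_mul, norm_cexp_neg_mul]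
  have h2 : u₀.re / 2 < u.re := by
    rw [Metric.mem_ball, dist_comm, dist_eq_norm] at hu'
    have := (Complex.re_le_norm (u₀ - u)).trans_lt hu'
    rw [Complex.sub_re] at this
    linarith
  calc Real.exp (-u.re * t) * ‖F t ξ‖
      ≤ Real.exp (-(u₀.re / 2) * t) * (B * 1 * Real.exp (u₀.re / 4 * t)) := by
        refine mul_le_mul (Real.exp_le_exp.2 ?_) ((hb t ht ξ hξ).trans ?_) (norm_nonneg _)
          (Real.exp_pos _).le
        · nlinarith
        · gcongr
          exact inv_weight_le_one _ _ _
    _ = B * (Real.exp (-(u₀.re / 2) * t) * Real.exp (u₀.re / 4 * t)) := by ring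
    _ = B * Real.exp (-(u₀.re / 4) * t) := by
        rw [← Real.exp_add]
        congr 2
        ring

theorem BorelSol.differentiableOn_laplaceBorel (h : BorelSol φ k Γ ρ d F) (hd : 0 < d)
    (hΓ : IsOpen Γ) (hE : SubexponentialOn F Γ ρ) :
    DifferentiableOn ℂ (fun p : ℂ × ℂ => laplaceBorel F p.1 p.2) ({u : ℂ | 0 < u.re} ×ˢ Γ) := by
  have hU : IsOpen {u : ℂ | 0 < u.re} := isOpen_lt continuous_const Complex.continuous_re
  refine differentiableOn_integral_of_locally_dominated (μ := volume.restrict (Ioi (0 : ℝ)))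
    (f := fun (p : ℂ × ℂ) (t : ℝ) => cexp (-p.1 * t) * F t p.2) (hU.prod hΓ) ?_
    (fun p hp => ?_) (fun p hp => ?_)
  · filter_upwards [ae_restrict_mem measurableSet_Ioi] with t ht
    refine DifferentiableOn.mul (by fun_prop) ?_
    exact (h.differentiableOn_snd (ofReal_mem_stripU (by positivity) (mem_Ioi.1 ht).le)).comp
      (f := fun p : ℂ × ℂ => p.2) (by fun_prop) (fun p hp => hp.2)
  · refine ContinuousOn.aestronglyMeasurable (s := Ioi (0 : ℝ)) ?_ measurableSet_Ioi
    exact ContinuousOn.mul (by fun_prop) (h.continuousOn_axis hd hp.2)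
  · obtain ⟨g, hg, hgb⟩ := hE.exists_majorant (u₀ := p.1) hp.1
    have hp1 : 0 < p.1.re := hp.1
    refine ⟨p.1.re / 2, half_pos hp1, g, hg, ?_⟩
    filter_upwards [ae_restrict_mem measurableSet_Ioi] with t ht
    intro q hq
    refine hgb t (mem_Ioi.1 ht).le q.1 ?_ q.2 hq.2.2
    exact (le_max_left _ _).trans_lt (Metric.mem_ball.1 hq.1)

theorem BorelSol.hasDerivAt_laplaceBorel (h : BorelSol φ k Γ ρ d F) (hd : 0 < d)
    (hΓ : IsOpen Γ) (hE : SubexponentialOn F Γ ρ) {u : ℂ} (hu : 0 < u.re) {ξ : ℂ} (hξ : ξ ∈ Γ) :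
    IntegrableOn (fun t : ℝ => cexp (-u * t) * deriv (F t) ξ) (Ioi 0) ∧
    HasDerivAt (laplaceBorel F u) (∫ t in Ioi (0 : ℝ), cexp (-u * t) * deriv (F t) ξ) ξ := by
  obtain ⟨g, hg, hgb⟩ := hE.exists_majorant hu
  have hdF : ∀ t : ℝ, 0 ≤ t → DifferentiableOn ℂ (F t) Γ := fun t ht =>
    h.differentiableOn_snd (ofReal_mem_stripU (by positivity) ht)
  obtain ⟨h1, h2⟩ := hasDerivAt_integral_of_locally_dominated (μ := volume.restrict (Ioi (0 : ℝ)))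
    (f := fun (ξ : ℂ) (t : ℝ) => cexp (-u * t) * F t ξ) hΓ
    (by
      filter_upwards [ae_restrict_mem measurableSet_Ioi] with t ht
      exact (hdF t (mem_Ioi.1 ht).le).const_mul _)
    (fun ξ hξ => ContinuousOn.aestronglyMeasurable (s := Ioi (0 : ℝ))
      (ContinuousOn.mul (by fun_prop) (h.continuousOn_axis hd hξ)) measurableSet_Ioi) hξ one_pos hg
    (by
      filter_upwards [ae_restrict_mem measurableSet_Ioi] with t ht
      exact fun y hy => hgb t (mem_Ioi.1 ht).le u (Metric.mem_ball_self (half_pos hu)) y hy.2)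
  have h3 : ∀ t ∈ Ioi (0 : ℝ), deriv (fun y => cexp (-u * t) * F t y) ξ =
      cexp (-u * t) * deriv (F t) ξ := by
    intro t ht
    exact deriv_const_mul _ ((hdF t (mem_Ioi.1 ht).le).differentiableAt (hΓ.mem_nhds hξ))
  exact ⟨IntegrableOn.congr_fun h1 h3 measurableSet_Ioi,
    h2.congr_deriv (setIntegral_congr_fun measurableSet_Ioi h3)⟩

/-- Fubini's theorem for the half-line integral and the Laplace transform. -/
theorem BorelSol.laplace_halfLine_integral (h : BorelSol φ k Γ ρ d F) (hd : 0 < d)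
    (hD : HasDecay φ k Γ ρ c) (hE : SubexponentialOn F Γ ρ) {u : ℂ} (hu : 0 < u.re) {ξ : ℂ}
    (hξ : ξ ∈ Γ) :
    IntegrableOn (fun t : ℝ => cexp (-u * t) *
      ∫ x in Ioi (0 : ℝ), k (ξ - x) * F t (ξ - x)) (Ioi 0) ∧
    ∫ t in Ioi (0 : ℝ), cexp (-u * t) * ∫ x in Ioi (0 : ℝ), k (ξ - x) * F t (ξ - x) =
      ∫ x in Ioi (0 : ℝ), k (ξ - x) * laplaceBorel F u (ξ - x) := by
  obtain ⟨g, hg, hgb⟩ := hE.exists_majorant hu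
  have hki : Integrable (fun x : ℝ => ‖k (ξ - x)‖) (volume.restrict (Ioi 0)) :=
    (integrableOn_halfLine_of_norm_le hD.translate hD.k_diff.continuousOn hD.rho_pos hD.k_le
      hξ).norm
  have hint : Integrable (Function.uncurry fun (t x : ℝ) =>
      cexp (-u * t) * (k (ξ - x) * F t (ξ - x)))
      ((volume.restrict (Ioi (0 : ℝ))).prod (volume.restrict (Ioi (0 : ℝ)))) := by
    refine (hg.mul_prod hki).mono' ?_ ?_
    · rw [Measure.prod_restrict]
      refine ContinuousOn.aestronglyMeasurable ?_ (measurableSet_Ioi.prod measurableSet_Ioi)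
      have hmem : ∀ p ∈ Ioi (0 : ℝ) ×ˢ Ioi (0 : ℝ), ξ - (p.2 : ℂ) ∈ Γ := fun p hp =>
        hD.translate ξ hξ _ (mem_Ioi.1 hp.2).le
      refine ContinuousOn.mul (by fun_prop) (ContinuousOn.mul ?_ ?_)
      · exact hD.k_diff.continuousOn.comp (f := fun p : ℝ × ℝ => ξ - (p.2 : ℂ)) (by fun_prop) hmem
      · exact h.holo.continuousOn.comp (f := fun p : ℝ × ℝ => ((p.1 : ℂ), ξ - (p.2 : ℂ)))
          (by fun_prop) (fun p hp =>
            ⟨ofReal_mem_stripU (by positivity) (mem_Ioi.1 hp.1).le, hmem p hp⟩)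
    · rw [Measure.prod_restrict]
      filter_upwards [ae_restrict_mem (measurableSet_Ioi.prod measurableSet_Ioi)] with p hp
      have h1 := hgb p.1 (mem_Ioi.1 hp.1).le u (Metric.mem_ball_self (half_pos hu)) _
        (hD.translate ξ hξ _ (mem_Ioi.1 hp.2).le)
      calc ‖cexp (-u * p.1) * (k (ξ - p.2) * F p.1 (ξ - p.2))‖
          = ‖cexp (-u * p.1) * F p.1 (ξ - p.2)‖ * ‖k (ξ - p.2)‖ := by
            simp only [norm_mul]
            ring
        _ ≤ g p.1 * ‖k (ξ - p.2)‖ := by gcongr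
  refine ⟨?_, ?_⟩
  · have := hint.integral_prod_left
    simp only [Function.uncurry_apply_pair, integral_const_mul] at this
    exact this
  · have h1 := integral_integral_swap hint
    simp only [integral_const_mul] at h1
    rw [h1]
    refine setIntegral_congr_fun measurableSet_Ioi (fun x _ => ?_)
    simp only [laplaceBorel]
    rw [← integral_const_mul]
    refine integral_congr_ae (ae_of_all _ fun t => ?_)
    ring

/-- The transport equation for `F` turns into a first-order equation for its Laplace transform. -/
theorem BorelSol.deriv_laplaceBorel (h : BorelSol φ k Γ ρ d F) (hd : 0 < d)
    (hD : HasDecay φ k Γ ρ c) (hE : SubexponentialOn F Γ ρ) {u : ℂ} (hu : 0 < u.re) {ξ : ℂ}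
    (hξ : ξ ∈ Γ) :
    HasDerivAt (laplaceBorel F u) (-(2 * u * laplaceBorel F u ξ)
      - φ ξ * (1 + laplaceBorel F u ξ)
      - ∫ x in Ioi (0 : ℝ), k (ξ - x) * (1 + laplaceBorel F u (ξ - x))) ξ := by
  obtain ⟨hi1, hder⟩ := h.hasDerivAt_laplaceBorel hd hD.isOpen hE hu hξ
  obtain ⟨hi2, hfub⟩ := h.laplace_halfLine_integral hd hD hE hu hξ
  obtain ⟨B0, hB0, hnorm⟩ := h.norm_laplaceBorel_le hd hE hu
  obtain ⟨hi3, -⟩ := hnorm ξ hξ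
  refine hder.congr_deriv ?_
  obtain ⟨B, hB, hb⟩ := hE.bound (half_pos hu)
  obtain ⟨B', hB', hb'⟩ := hE _ (half_pos hu) 1
  simp only [iteratedDeriv_one] at hb'
  have hw := inv_weight_nonneg 1 ρ ξ
  have hparts := laplace_by_parts (f := fun t => F t ξ) (u := u) (σ := u.re / 2)
    (C := (B + B') * (weight 1 ρ ξ)⁻¹) (isOpen_stripU (2 * d))
    (fun t ht => ofReal_mem_stripU (by positivity) ht) (h.differentiableOn_fst hξ)
    (fun t ht => (hb t ht ξ hξ).trans (by gcongr; linarith))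
    (fun t ht => (hb' t ht ξ hξ).trans (by gcongr; linarith)) (half_lt_self hu)
  have hL : ∫ t in Ioi (0 : ℝ), cexp (-u * t) * deriv (fun t => F t ξ) t =
      -(1 / 2) * ((∫ t in Ioi (0 : ℝ), cexp (-u * t) * deriv (F t) ξ) +
        φ ξ * (∫ t in Ioi (0 : ℝ), cexp (-u * t) * F t ξ) +
        ∫ t in Ioi (0 : ℝ), cexp (-u * t) * ∫ x in Ioi (0 : ℝ), k (ξ - x) * F t (ξ - x)) := by
    have hs1 := integral_add (hi1.add (hi3.const_mul (φ ξ))) hi2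
    have hs2 := integral_add hi1 (hi3.const_mul (φ ξ))
    simp only [Pi.add_apply] at hs1
    rw [integral_const_mul] at hs2
    rw [← hs2, ← hs1, ← integral_const_mul]
    refine setIntegral_congr_fun measurableSet_Ioi (fun t ht => ?_)
    have he := h.eq t (ofReal_mem_stripU (by positivity) (mem_Ioi.1 ht).le) ξ hξ
    linear_combination (1 / 2) * cexp (-u * t) * he
  have hK : ∫ x in Ioi (0 : ℝ), k (ξ - x) * (1 + laplaceBorel F u (ξ - x)) =
      (∫ x in Ioi (0 : ℝ), k (ξ - x)) +
        ∫ x in Ioi (0 : ℝ), k (ξ - x) * laplaceBorel F u (ξ - x) := by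
    have hk1 := integrableOn_halfLine_of_norm_le hD.translate hD.k_diff.continuousOn hD.rho_pos
      hD.k_le hξ
    have hη : DifferentiableOn ℂ (laplaceBorel F u) Γ := fun s hs =>
      (h.hasDerivAt_laplaceBorel hd hD.isOpen hE hu hs).2.differentiableAt.differentiableWithinAt
    have hk2 := integrableOn_halfLine_of_norm_le (f := fun s => k s * laplaceBorel F u s)
      (C := c * B0) hD.translate
      (hD.k_diff.mul hη).continuousOn hD.rho_pos (fun s hs => by
        have h1 := (hnorm s hs).2.trans (mul_le_of_le_one_right hB0 (inv_weight_le_one _ _ _))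
        rw [norm_mul]
        calc ‖k s‖ * ‖laplaceBorel F u s‖ ≤ c * decayK ρ s.re * B0 :=
              mul_le_mul (hD.k_le s hs) h1 (norm_nonneg _)
                (mul_nonneg hD.c_pos.le (decayK_pos _ _).le)
          _ = c * B0 * decayK ρ s.re := by ring) hξ
    have := integral_add hk1 hk2
    rw [← this]
    refine integral_congr_ae (ae_of_all _ fun t => ?_)
    simp only
    ring
  rw [hK, ← hfub]
  rw [hL] at hparts
  have hinit := h.init ξ hξ
  simp only [initialA] at hinit
  rw [hinit] at hparts
  simp only [laplaceBorel]
  linear_combination 2 * hparts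

end

/-! ### The differential equation for the re-summed solution -/

section

variable {φ ψ k : ℂ → ℂ} {Γ : Set ℂ} {ρ c d : ℝ} {F : ℂ → ℂ → ℂ}

theorem deriv_deriv_exp_mul_of_firstOrder (hΓ : IsOpen Γ) (hφ : DifferentiableOn ℂ φ Γ)
    {Φ η K : ℂ → ℂ} {u : ℂ} (hΦ : ∀ ξ ∈ Γ, HasDerivAt Φ (φ ξ) ξ)
    (hη : ∀ ξ ∈ Γ, HasDerivAt η (-(2 * u * η ξ) - φ ξ * (1 + η ξ) - K ξ) ξ)
    (hK : ∀ ξ ∈ Γ, HasDerivAt K (coeffKernel φ ψ 1 ξ * (1 + η ξ)) ξ) {ξ : ℂ} (hξ : ξ ∈ Γ) :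
    deriv (deriv fun ξ => cexp (u * ξ + 1 / 2 * Φ ξ) * (1 + η ξ)) ξ =
      (u ^ 2 + u * φ ξ + ψ ξ) * (cexp (u * ξ + 1 / 2 * Φ ξ) * (1 + η ξ)) := by
  have hE : ∀ ξ ∈ Γ, HasDerivAt (fun ξ => cexp (u * ξ + 1 / 2 * Φ ξ))
      (cexp (u * ξ + 1 / 2 * Φ ξ) * (u + 1 / 2 * φ ξ)) ξ := fun ξ hξ => by
    have h1 : HasDerivAt (fun ξ : ℂ => u * ξ) u ξ := by
      simpa using (hasDerivAt_id ξ).const_mul u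
    exact (h1.add ((hΦ ξ hξ).const_mul (1 / 2))).cexp
  have h1 : ∀ ξ ∈ Γ, deriv (fun ξ => cexp (u * ξ + 1 / 2 * Φ ξ) * (1 + η ξ)) ξ =
      cexp (u * ξ + 1 / 2 * Φ ξ) * (u - u * η ξ - 1 / 2 * φ ξ * (1 + η ξ) - K ξ) := by
    intro ξ hξ
    refine ((hE ξ hξ).mul ((hη ξ hξ).const_add 1)).deriv.trans ?_
    ring
  have h2 : deriv (fun ξ => cexp (u * ξ + 1 / 2 * Φ ξ) * (1 + η ξ)) =ᶠ[𝓝 ξ] fun ξ =>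
      cexp (u * ξ + 1 / 2 * Φ ξ) * (u - u * η ξ - 1 / 2 * φ ξ * (1 + η ξ) - K ξ) := by
    filter_upwards [hΓ.mem_nhds hξ] with s hs using h1 s hs
  have hφ' := (hφ.differentiableAt (hΓ.mem_nhds hξ)).hasDerivAt
  have h3 := (((((hη ξ hξ).const_mul u).const_sub u).sub
    ((hφ'.const_mul (1 / 2)).mul ((hη ξ hξ).const_add 1))).sub (hK ξ hξ))
  rw [h2.deriv_eq]
  refine ((hE ξ hξ).mul h3).deriv.trans ?_
  simp only [coeffKernel, Complex.ofReal_one, Pi.sub_apply, Pi.mul_apply]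
  ring

/-- On translates of a small ball, `φ` varies by an integrable amount. -/
theorem HasDecay.norm_sub_le (hD : HasDecay φ k Γ ρ c) {ξ₁ : ℂ} {r : ℝ} (hr : r ≤ 1)
    (hball : Metric.ball ξ₁ r ⊆ Γ) {ξ : ℂ} (hξ : ξ ∈ Metric.ball ξ₁ r) {x : ℝ} (hx : 0 ≤ x) :
    ‖φ (ξ - x) - φ (ξ₁ - x)‖ ≤ c * 2 ^ (1 + ρ) * decayK ρ (ξ₁.re - x) := by
  have hsub : ∀ s ∈ Metric.ball (ξ₁ - x : ℂ) r, s ∈ Γ := by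
    intro s hs
    have h1 : s + x ∈ Metric.ball ξ₁ r := by
      rw [Metric.mem_ball, dist_eq_norm] at hs ⊢
      rwa [show s + x - ξ₁ = s - (ξ₁ - x) by ring]
    simpa using hD.translate _ (hball h1) x hx
  have hK := mul_nonneg (mul_nonneg hD.c_pos.le (Real.rpow_nonneg zero_le_two (1 + ρ)))
    (decayK_pos ρ (ξ₁.re - x)).le
  have hr0 : 0 < r := Metric.pos_of_mem_ball hξ
  have h := (convex_ball (ξ₁ - x : ℂ) r).norm_image_sub_le_of_norm_deriv_le (f := φ)
    (C := c * 2 ^ (1 + ρ) * decayK ρ (ξ₁.re - x)) (x := ξ₁ - x) (y := ξ - x)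
    (fun s hs => hD.phi_diff.differentiableAt (hD.isOpen.mem_nhds (hsub s hs)))
    (fun s hs => ?_) (Metric.mem_ball_self hr0) (by simpa using hξ)
  · refine h.trans (mul_le_of_le_one_right hK ?_)
    rw [sub_sub_sub_cancel_right]
    rw [Metric.mem_ball, dist_eq_norm] at hξ
    linarith
  · have h1 : |(ξ₁.re - x) - s.re| ≤ 1 := by
      rw [Metric.mem_ball, dist_comm, dist_eq_norm] at hs
      have := (Complex.abs_re_le_norm (ξ₁ - x - s)).trans hs.le
      simp only [Complex.sub_re, Complex.ofReal_re] at this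
      exact this.trans hr
    refine (hD.dphi_le s (hsub s hs)).trans ?_
    rw [mul_assoc]
    exact mul_le_mul_of_nonneg_left (decayK_near hD.rho_pos h1) hD.c_pos.le

/-- The primitive is `∫_0^∞ (φ(ξ - x) - φ(ξ₀ - x)) dx`; the subtraction is needed because `φ`
itself need not be integrable along half-lines. -/
theorem HasDecay.exists_primitive (hD : HasDecay φ k Γ ρ c) (hΓ : IsConnected Γ) :
    ∃ Φ : ℂ → ℂ, ∀ ξ ∈ Γ, HasDerivAt Φ (φ ξ) ξ := by
  obtain ⟨ξ₀, hξ₀⟩ := hΓ.nonempty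
  have hcφ := hD.phi_diff.continuousOn
  have hm : ∀ ξ ∈ Γ, ∀ ξ' ∈ Γ, AEStronglyMeasurable (fun x : ℝ => φ (ξ - x) - φ (ξ' - x))
      (volume.restrict (Ioi 0)) := fun ξ hξ ξ' hξ' =>
    (((continuousOn_halfLine hD.translate hcφ hξ).sub
      (continuousOn_halfLine hD.translate hcφ hξ')).mono
      Ioi_subset_Ici_self).aestronglyMeasurable measurableSet_Ioi
  have hloc : ∀ ξ ∈ Γ, ∃ r : ℝ, 0 < r ∧ r ≤ 1 ∧ Metric.ball ξ r ⊆ Γ := by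
    intro ξ hξ
    obtain ⟨r, hr, hb⟩ := Metric.isOpen_iff.1 hD.isOpen ξ hξ
    exact ⟨min r 1, by positivity, min_le_right _ _,
      (Metric.ball_subset_ball (min_le_left _ _)).trans hb⟩
  have hint : ∀ ξ ∈ Γ, IntegrableOn (fun x : ℝ => φ (ξ - x) - φ (ξ₀ - x)) (Ioi 0) := by
    intro ξ hξ
    -- integrability of the difference is an equivalence relation with open classes
    refine hΓ.isPreconnected.induction₂
      (fun a b => IntegrableOn (fun x : ℝ => φ (b - x) - φ (a - x)) (Ioi 0)) (fun a ha => ?_)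
      (fun a b e _ _ _ h1 h2 => ?_) (fun a b _ _ h1 => ?_) hξ₀ hξ
    · obtain ⟨r, hr, hr1, hb⟩ := hloc a ha
      filter_upwards [mem_nhdsWithin_of_mem_nhds (Metric.ball_mem_nhds a hr)] with b hbr
      refine ((integrableOn_decayK_sub hD.rho_pos a.re).const_mul (c * 2 ^ (1 + ρ))).mono'
        (hm b (hb hbr) a ha) ?_
      filter_upwards [ae_restrict_mem measurableSet_Ioi] with x hx
      exact hD.norm_sub_le hr1 hb hbr (mem_Ioi.1 hx).le
    · refine (h1.add h2).congr (ae_of_all _ fun x => ?_)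
      simp
    · refine h1.neg.congr (ae_of_all _ fun x => ?_)
      simp
  refine ⟨fun ξ => ∫ x in Ioi (0 : ℝ), (φ (ξ - x) - φ (ξ₀ - x)), fun ξ hξ => ?_⟩
  obtain ⟨r, hr, hr1, hb⟩ := hloc ξ hξ
  obtain ⟨h1, h2⟩ := hasDerivAt_integral_of_locally_dominated (μ := volume.restrict (Ioi (0 : ℝ)))
    (f := fun (ξ : ℂ) (x : ℝ) => φ (ξ - x) - φ (ξ₀ - x)) hD.isOpen
    (by
      filter_upwards [ae_restrict_mem measurableSet_Ioi] with x hx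
      exact (hD.phi_diff.comp (f := fun ξ : ℂ => ξ - x) (by fun_prop)
        (fun s hs => hD.translate s hs x (mem_Ioi.1 hx).le)).sub_const _)
    (fun s hs => hm s hs ξ₀ hξ₀) hξ hr
    ((hint ξ hξ).norm.add
      ((integrableOn_decayK_sub hD.rho_pos ξ.re).const_mul (c * 2 ^ (1 + ρ))))
    (by
      filter_upwards [ae_restrict_mem measurableSet_Ioi] with x hx
      intro s hs
      have h3 := hD.norm_sub_le hr1 hb hs.1 (mem_Ioi.1 hx).le
      calc ‖φ (s - x) - φ (ξ₀ - x)‖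
          = ‖(φ (ξ - x) - φ (ξ₀ - x)) + (φ (s - x) - φ (ξ - x))‖ := by
            congr 1
            ring
        _ ≤ _ := (norm_add_le _ _).trans (add_le_add le_rfl h3))
  refine h2.congr_deriv ?_
  have h4 : ∀ x ∈ Ici (0 : ℝ), HasDerivAt (fun x : ℝ => -φ (ξ - x))
      (deriv (fun y : ℂ => φ (y - x) - φ (ξ₀ - x)) ξ) x := by
    intro x hx
    have h5 := (hD.phi_diff.differentiableAt
      (hD.isOpen.mem_nhds (hD.translate ξ hξ x hx))).hasDerivAt
    have h6 : HasDerivAt (fun x : ℝ => ξ - (x : ℂ)) (-1) x := by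
      simpa using (Complex.ofRealCLM.hasDerivAt (x := x)).const_sub ξ
    have h7 := (HasDerivAt.comp (h₂ := φ) (h := fun x : ℝ => ξ - (x : ℂ)) x h5 h6).neg
    refine h7.congr_deriv ?_
    rw [deriv_sub_const, deriv_comp_sub_const]
    simp
  have h8 : Tendsto (fun x : ℝ => -φ (ξ - x)) atTop (𝓝 0) := by
    have h9 : Tendsto (fun x : ℝ => c * decayM ρ (ξ.re - x)) atTop (𝓝 0) := by
      have : Tendsto (fun x : ℝ => ξ.re - x) atTop atBot := by
        simpa [sub_eq_add_neg] using tendsto_atBot_add_const_left atTop ξ.re tendsto_neg_atTop_atBot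
      simpa using ((tendsto_decayM_atBot hD.rho_pos).comp this).const_mul c
    refine squeeze_zero_norm' ?_ h9
    filter_upwards [eventually_ge_atTop 0] with x hx
    simpa using hD.phi_le _ (hD.translate ξ hξ x hx)
  -- `∫_0^∞ φ'(ξ - x) dx = φ(ξ)`, as `φ` vanishes at the left end of the half-line
  have h := integral_Ioi_of_hasDerivAt_of_tendsto' h4 h1 h8
  simpa using h

theorem BorelSol.tendsto_laplaceBorel (h : BorelSol φ k Γ ρ d F) (hd : 0 < d) (hρ : 0 < ρ)
    (hE : SubexponentialOn F Γ ρ) {u : ℂ} (hu : 0 < u.re) :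
    Tendsto (laplaceBorel F u) (comap (fun ξ : ℂ => -1 * ξ.re) atTop ⊓ 𝓟 Γ) (𝓝 0) := by
  obtain ⟨B, hB, hb⟩ := h.norm_laplaceBorel_le hd hE hu
  have h1 : comap (fun ξ : ℂ => -1 * ξ.re) atTop = comap Complex.re atBot := by
    rw [show (fun ξ : ℂ => -1 * ξ.re) = (fun y : ℝ => -y) ∘ Complex.re by ext; simp,
      ← comap_comap, comap_neg_atTop]
  rw [h1]
  have h2 : Tendsto (fun ξ => B * (weight 1 ρ ξ)⁻¹) (comap Complex.re atBot ⊓ 𝓟 Γ) (𝓝 0) := by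
    simpa using ((tendsto_inv_weight hρ).mono_left inf_le_left).const_mul B
  refine squeeze_zero_norm' ?_ h2
  filter_upwards [mem_inf_of_right (mem_principal_self Γ)] with ξ hξ using (hb ξ hξ).2

/-- The Laplace transform of a solution of the transport equation, with its Borel transform,
has all the required properties. -/
theorem BorelSol.isBorelPair (h : BorelSol φ (coeffKernel φ ψ 1) Γ ρ d F) (hd : 0 < d)
    (hΓ : IsConnected Γ) (hD : HasDecay φ (coeffKernel φ ψ 1) Γ ρ c)
    (hE : SubexponentialOn F Γ ρ) : IsBorelPair φ ψ Γ 1 d (laplaceBorel F) F where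
  eta_holo := h.differentiableOn_laplaceBorel hd hD.isOpen hE
  ode := by
    obtain ⟨Φ, hΦ⟩ := hD.exists_primitive hΓ
    refine ⟨Φ, hΦ, fun u hu ξ hξ => ?_⟩
    have hη := fun ξ hξ => h.deriv_laplaceBorel (ξ := ξ) hd hD hE hu hξ
    obtain ⟨B, hB, hb⟩ := h.norm_laplaceBorel_le hd hE hu
    have hηd : DifferentiableOn ℂ (laplaceBorel F u) Γ := fun s hs =>
      (hη s hs).differentiableAt.differentiableWithinAt
    have hK := fun ξ hξ => hasDerivAt_halfLine_integral (ξ := ξ)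
      (f := fun s => coeffKernel φ ψ 1 s * (1 + laplaceBorel F u s)) (c := c * (1 + B)) hD.rho_pos
      (mul_pos hD.c_pos (by linarith)) hD.isOpen hD.translate
      (hD.k_diff.mul (hηd.const_add 1)) (fun s hs => by
        have h1 := (hb s hs).2.trans (mul_le_of_le_one_right hB (inv_weight_le_one _ _ _))
        have h2 : ‖1 + laplaceBorel F u s‖ ≤ 1 + B :=
          (norm_add_le _ _).trans (by simpa using h1)
        rw [norm_mul]
        calc ‖coeffKernel φ ψ 1 s‖ * ‖1 + laplaceBorel F u s‖ ≤ c * decayK ρ s.re * (1 + B) :=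
              mul_le_mul (hD.k_le s hs) h2 (norm_nonneg _)
                (mul_nonneg hD.c_pos.le (decayK_pos _ _).le)
          _ = c * (1 + B) * decayK ρ s.re := by ring) hξ
    have h1 : solutionW Φ 1 (laplaceBorel F) u = fun ξ =>
        cexp (u * ξ + 1 / 2 * Φ ξ) * (1 + laplaceBorel F u ξ) := by
      ext ξ
      simp [solutionW]
    rw [h1]
    exact deriv_deriv_exp_mul_of_firstOrder hD.isOpen hD.phi_diff hΦ hη hK hξ
  eta_lim u hu := h.tendsto_laplaceBorel hd hD.rho_pos hE hu
  F_holo := h.holo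
  F_series t ht ξ hξ := h.hasSum_coeffA hd hD ht hξ
  laplace u hu ξ hξ := by
    obtain ⟨B, hB, hb⟩ := h.norm_laplaceBorel_le hd hE hu
    exact ⟨(hb ξ hξ).1, rfl⟩

/-! ### The error bound -/

/-- The error bound in terms of any admissible density `p` and any bound `S` for the weighted values
of `F` on the circle `|w| = 2 r`. -/
theorem BorelSol.norm_laplaceBorel_sub_sum_le (h : BorelSol φ k Γ ρ d F) (hd : 0 < d)
    (hD : HasDecay φ k Γ ρ c)
    {p : ℂ → ℝ} {C σ a : ℝ} (hpc : ContinuousOn p Γ)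
    (hp0 : ∀ s ∈ Γ, 0 ≤ p s) (hpb : ∀ s ∈ Γ, p s ≤ C * decayK ρ s.re) (hkp : ∀ s ∈ Γ, ‖k s‖ ≤ p s)
    (hσ : 0 < σ) (ha : 0 < a)
    (hcase : ((∀ s ∈ Γ, ‖φ s‖ ^ 2 ≤ 4 * p s) ∧ a * σ = 6) ∨ ((∀ s ∈ Γ, φ s = 0) ∧ a * σ = 1))
    {r : ℝ} (hr : 0 < r) (hrd : r < d) {S : ℝ}
    (hS : ∀ w : ℂ, ‖w‖ = 2 * r → ∀ ξ ∈ Γ, weight 1 ρ ξ * ‖F w ξ‖ ≤ S) {ξ : ℂ} (hξ : ξ ∈ Γ)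
    {A : ℕ → ℂ} (hA : ∀ n, A (n + 1) = iteratedDeriv n (fun t => F t ξ) 0) {N : ℕ} (hN : 1 ≤ N)
    {u : ℂ} (hu : σ < u.re) :
    ‖laplaceBorel F u ξ - ∑ n ∈ Finset.Ico 1 N, A n / u ^ n‖ ≤
      2 * S * (2 * r / N + 1 / (u.re - σ)) *
        (Real.exp (a * tailIntegral p ξ) / weight 1 ρ ξ) * (N.factorial / (2 * r * ‖u‖) ^ N) := by
  have hW0 : 0 < weight 1 ρ ξ := one_pos.trans_le (one_le_weight _ _ _)
  have hS0 : 0 ≤ S := (mul_nonneg hW0.le (norm_nonneg _)).trans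
    (hS ((2 * r : ℝ) : ℂ) (by rw [Complex.norm_real, Real.norm_of_nonneg (by positivity)]) ξ hξ)
  have hu0 : u ≠ 0 := by
    rintro rfl
    simp only [Complex.zero_re] at hu
    linarith
  have hun : 0 < ‖u‖ := norm_pos_iff.2 hu0
  have hV : 1 ≤ Real.exp (a * tailIntegral p ξ) :=
    Real.one_le_exp (mul_nonneg ha.le (tailIntegral_nonneg hD.translate hp0 hξ))
  have hder : ∀ n : ℕ, ∀ t : ℝ, 0 ≤ t → ‖iteratedDeriv n (fun t => F t ξ) t‖ ≤
      n.factorial * (2 * S * (Real.exp (a * tailIntegral p ξ) / weight 1 ρ ξ)) / (2 * r) ^ n *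
        Real.exp (σ * t) := fun n t ht =>
    (h.norm_iteratedDeriv_le hD hpc hp0 hpb hkp hσ ha hcase hr hrd hS n ht hξ).trans
      (le_of_eq (by ring))
  have haxis : ∀ t : ℝ, 0 ≤ t → (t : ℂ) ∈ stripU (2 * d) := fun t ht =>
    ofReal_mem_stripU (by positivity) ht
  have hexp := laplace_expansion (u := u) (σ := σ) (isOpen_stripU (2 * d)) haxis
    (h.differentiableOn_fst hξ) (fun n => ⟨_, by positivity, hder n⟩) hu hu0 hA hN
  have hrem := (integrableOn_laplace (u := u)
    (g := fun t : ℝ => iteratedDeriv N (fun t => F t ξ) t)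
    ((differentiableOn_iteratedDeriv_of_isOpen (isOpen_stripU _) (h.differentiableOn_fst hξ)
      N).continuousOn.comp (f := fun t : ℝ => (t : ℂ)) (by fun_prop)
      (fun t ht => haxis t (mem_Ioi.1 ht).le)) (hder N) hu).2
  -- `A N` is a derivative of order `N - 1`, whence the factor `2 r / N` in the bound
  have hcoef : ‖A N‖ ≤ N.factorial / N * (2 * r) * (S / weight 1 ρ ξ) / (2 * r) ^ N := by
    obtain ⟨m, rfl⟩ := Nat.exists_eq_add_of_le' hN
    rw [hA]
    refine (Complex.norm_iteratedDeriv_le_of_forall_mem_sphere_norm_le m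
      (C := S / weight 1 ρ ξ) (by positivity : 0 < 2 * r)
      (((h.differentiableOn_fst hξ).mono ?_).diffContOnCl) (fun s hs => ?_)).trans (le_of_eq ?_)
    · rw [closure_ball _ (by positivity)]
      intro s hs
      refine ball_subset_stripU _ ?_
      rw [mem_closedBall_zero_iff] at hs
      rw [mem_ball_zero_iff]
      linarith
    · rw [le_div_iff₀' hW0]
      exact hS s (by simpa using hs) ξ hξ
    · rw [Nat.factorial_succ]
      push_cast
      field_simp
      ring
  have hσu : 0 < u.re - σ := by linarith
  change ‖(∫ t in Ioi (0 : ℝ), cexp (-u * t) * F t ξ) - _‖ ≤ _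
  rw [hexp, ← add_div, norm_div, norm_pow, div_le_iff₀ (by positivity)]
  refine (norm_add_le _ _).trans ((add_le_add hcoef hrem).trans ?_)
  have hNpos : (0 : ℝ) < N := by exact_mod_cast hN
  have h1 : N.factorial / N * (2 * r) * (S / weight 1 ρ ξ) / (2 * r) ^ N ≤
      N.factorial / N * (2 * r) * (2 * S * Real.exp (a * tailIntegral p ξ) / weight 1 ρ ξ) /
        (2 * r) ^ N := by
    gcongr
    nlinarith
  refine (add_le_add h1 le_rfl).trans (le_of_eq ?_)
  field_simp
  ring

end

/-! ### From the decay conditions on `Δ` to rates on translation-invariant sets -/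

theorem ball_subset_of_le_dist_frontier {Δ : Set ℂ} (hΔ : IsOpen Δ) {ξ : ℂ} (hξ : ξ ∈ Δ) {d : ℝ}
    (h : ∀ b ∈ frontier Δ, d ≤ dist ξ b) : Metric.ball ξ d ⊆ Δ := by
  intro s hs
  have hd : 0 < d := Metric.pos_of_mem_ball hs
  by_contra hsΔ
  have hpre : IsPreconnected (Metric.ball ξ d) := (convex_ball ξ d).isPreconnected
  have hcov : Metric.ball ξ d ⊆ Δ ∪ (closure Δ)ᶜ := by
    intro x hx
    by_contra hx'
    rw [mem_union, not_or, mem_compl_iff, not_not] at hx'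
    have hxf : x ∈ frontier Δ := by
      rw [hΔ.frontier_eq]
      exact ⟨hx'.2, hx'.1⟩
    rw [Metric.mem_ball, dist_comm] at hx
    linarith [h x hxf]
  obtain ⟨x, -, hx1, hx2⟩ := hpre Δ (closure Δ)ᶜ hΔ isClosed_closure.isOpen_compl hcov
    ⟨ξ, Metric.mem_ball_self hd, hξ⟩ ⟨s, hs, (hcov hs).resolve_left hsΔ⟩
  exact hx2 (subset_closure hx1)

theorem div_one_add_rpow_le {c q x y : ℝ} (hc : 0 ≤ c) (hq : 0 < q) (hy : |y| ≤ x) :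
    c / (1 + x ^ q) ≤ c * 2 ^ q * (1 + |y|) ^ (-q) := by
  have hx : 0 ≤ x := (abs_nonneg y).trans hy
  have h1 : (1 + |y|) ^ q ≤ 2 ^ q * (1 + x ^ q) := by
    rcases le_total x 1 with h | h
    · calc (1 + |y|) ^ q ≤ 2 ^ q := Real.rpow_le_rpow (by positivity) (by linarith) hq.le
        _ ≤ 2 ^ q * (1 + x ^ q) := le_mul_of_one_le_right (by positivity)
            (by linarith [Real.rpow_nonneg hx q])
    · calc (1 + |y|) ^ q ≤ (2 * x) ^ q := Real.rpow_le_rpow (by positivity) (by linarith) hq.le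
        _ = 2 ^ q * x ^ q := Real.mul_rpow (by norm_num) hx
        _ ≤ 2 ^ q * (1 + x ^ q) := by
            gcongr
            linarith
  have hx' := Real.rpow_nonneg hx q
  rw [Real.rpow_neg (by positivity), ← div_eq_mul_inv,
    div_le_div_iff₀ (by positivity) (by positivity)]
  calc c * (1 + |y|) ^ q ≤ c * (2 ^ q * (1 + x ^ q)) := by gcongr
    _ = _ := by ring

theorem one_add_abs_rpow_le_decayM {ρ q : ℝ} (hρ : 0 < ρ) (hq : ρ ≤ q) (y : ℝ) :
    (1 + |y|) ^ (-q) ≤ decayM ρ y := by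
  have h1 : max 0 (-y) ≤ |y| := max_le (abs_nonneg y) (neg_le_abs y)
  calc (1 + |y|) ^ (-q) ≤ (1 + |y|) ^ (-ρ) :=
        Real.rpow_le_rpow_of_exponent_le (by linarith [abs_nonneg y]) (by linarith)
    _ ≤ decayM ρ y := Real.rpow_le_rpow_of_nonpos (by linarith [one_le_one_add_max y])
        (by linarith) (by linarith)

theorem sq_one_add_abs_rpow_le_decayK {ρ q : ℝ} (hq : 1 + ρ ≤ 2 * q) (y : ℝ) :
    ((1 + |y|) ^ (-q)) ^ 2 ≤ decayK ρ y := by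
  rw [← Real.rpow_natCast, ← Real.rpow_mul (by positivity)]
  refine Real.rpow_le_rpow_of_exponent_le (by linarith [abs_nonneg y]) ?_
  push_cast
  linarith

/-- Either decay condition bounds `φ`, `φ²` and `ψ`, and one of `φ`, `φ'`, by the rates. -/
theorem exists_rates_of_condition {φ ψ : ℂ → ℂ} {Δ : Set ℂ} {c ρ : ℝ} (hc : 0 < c) (hρ : 0 < ρ)
    (hcond : Condition1 φ ψ Δ c ρ ∨ Condition2 φ ψ Δ c ρ) :
    ∃ b : ℝ, 0 < b ∧ (∀ s ∈ Δ, ‖φ s‖ ≤ b * decayM ρ s.re) ∧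
      (∀ s ∈ Δ, ‖φ s‖ ^ 2 ≤ b * decayK ρ s.re) ∧ (∀ s ∈ Δ, ‖ψ s‖ ≤ b * decayK ρ s.re) ∧
      ((∀ s ∈ Δ, ‖φ s‖ ≤ b * decayK ρ s.re) ∨ (∀ s ∈ Δ, ‖deriv φ s‖ ≤ b * decayK ρ s.re)) := by
  have hconv : ∀ q : ℝ, 0 < q → ∀ s : ℂ,
      c / (1 + ‖s‖ ^ q) ≤ c * 2 ^ q * (1 + |s.re|) ^ (-q) := fun q hq s =>
    div_one_add_rpow_le hc.le hq (Complex.abs_re_le_norm s)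
  have key : ∀ q : ℝ, ρ ≤ q → 1 + ρ ≤ 2 * q → (∀ s ∈ Δ, ‖φ s‖ ≤ c / (1 + ‖s‖ ^ q)) →
      (∀ s ∈ Δ, ‖φ s‖ ≤ c * 2 ^ q * decayM ρ s.re) ∧
      (∀ s ∈ Δ, ‖φ s‖ ^ 2 ≤ (c * 2 ^ q) ^ 2 * decayK ρ s.re) := by
    intro q hq1 hq2 hb
    have h1 : ∀ s ∈ Δ, ‖φ s‖ ≤ c * 2 ^ q * (1 + |s.re|) ^ (-q) := fun s hs =>
      (hb s hs).trans (hconv q (hρ.trans_le hq1) s)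
    refine ⟨fun s hs => (h1 s hs).trans ?_, fun s hs => ?_⟩
    · gcongr
      exact one_add_abs_rpow_le_decayM hρ hq1 _
    · refine (pow_le_pow_left₀ (norm_nonneg _) (h1 s hs) 2).trans ?_
      rw [mul_pow]
      gcongr
      exact sq_one_add_abs_rpow_le_decayK hq2 _
  have hKle : ∀ {f : ℂ → ℂ}, (∀ s ∈ Δ, ‖f s‖ ≤ c / (1 + ‖s‖ ^ (1 + ρ))) →
      ∀ s ∈ Δ, ‖f s‖ ≤ c * 2 ^ (1 + ρ) * decayK ρ s.re := fun hf s hs =>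
    (hf s hs).trans (hconv (1 + ρ) (by linarith) s)
  have hdM := decayM_pos ρ
  have hdK := decayK_pos ρ
  rcases hcond with h | h
  · obtain ⟨h1, h2⟩ := key (1 + ρ) (by linarith) (by linarith) (fun s hs => (h s hs).1)
    have h3 := hKle (fun s hs => (h s hs).2)
    have h4 := hKle (fun s hs => (h s hs).1)
    have hb : 0 < c * 2 ^ (1 + ρ) := by positivity
    refine ⟨c * 2 ^ (1 + ρ) + (c * 2 ^ (1 + ρ)) ^ 2, by positivity,
      fun s hs => (h1 s hs).trans ?_, fun s hs => (h2 s hs).trans ?_,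
      fun s hs => (h3 s hs).trans ?_, Or.inl fun s hs => (h4 s hs).trans ?_⟩
    · exact mul_le_mul_of_nonneg_right (by nlinarith) (hdM _).le
    all_goals exact mul_le_mul_of_nonneg_right (by nlinarith) (hdK _).le
  · obtain ⟨h1, h2⟩ := key (1 / 2 + ρ) (by linarith) (by linarith) (fun s hs => (h s hs).1)
    have h3 := hKle (fun s hs => (h s hs).2.2)
    have h4 := hKle (fun s hs => (h s hs).2.1)
    have hb : 0 < c * 2 ^ (1 + ρ) := by positivity
    have hb' : 0 < c * 2 ^ (1 / 2 + ρ) := by positivity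
    refine ⟨c * 2 ^ (1 + ρ) + c * 2 ^ (1 / 2 + ρ) + (c * 2 ^ (1 / 2 + ρ)) ^ 2, by positivity,
      fun s hs => (h1 s hs).trans ?_, fun s hs => (h2 s hs).trans ?_,
      fun s hs => (h3 s hs).trans ?_, Or.inr fun s hs => (h4 s hs).trans ?_⟩
    · exact mul_le_mul_of_nonneg_right (by nlinarith) (hdM _).le
    all_goals exact mul_le_mul_of_nonneg_right (by nlinarith) (hdK _).le

section

variable {φ ψ : ℂ → ℂ} {Δ Γ : Set ℂ} {c ρ d : ℝ}

theorem norm_coeffKernel_le_density (φ ψ : ℂ → ℂ) (s : ℂ) :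
    ‖coeffKernel φ ψ 1 s‖ ≤ density φ ψ 1 s := by
  have h1 : coeffKernel φ ψ 1 s =
      1 / 4 * φ s ^ 2 - (1 / 2 * deriv φ s + ((1 : ℝ) : ℂ) * ψ s) := by
    simp only [coeffKernel, Complex.ofReal_one]
    ring
  rw [h1]
  refine (norm_sub_le _ _).trans (add_le_add (le_of_eq ?_) le_rfl)
  rw [norm_mul]
  norm_num

theorem density_le_add (φ ψ : ℂ → ℂ) (s : ℂ) :
    density φ ψ 1 s ≤ ‖φ s‖ ^ 2 + ‖deriv φ s‖ + ‖ψ s‖ := by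
  unfold density
  have h1 := norm_add_le (1 / 2 * deriv φ s) (((1 : ℝ) : ℂ) * ψ s)
  have h2 : ‖1 / 2 * deriv φ s‖ = 1 / 2 * ‖deriv φ s‖ := by
    rw [norm_mul]
    norm_num
  rw [h2, Complex.ofReal_one, one_mul] at h1
  rw [Complex.ofReal_one, one_mul, norm_pow]
  nlinarith [norm_nonneg (deriv φ s), sq_nonneg ‖φ s‖]

theorem IsGamma.translate_one (hΓ : IsGamma Δ 1 d Γ) : ∀ s ∈ Γ, ∀ x : ℝ, 0 ≤ x → s - x ∈ Γ := by
  intro s hs x hx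
  rcases hx.eq_or_lt with rfl | hx
  · simpa using hs
  · simpa using hΓ.translate s hs x hx

/-- Every `r`-neighbourhood of `Γ` with `r < d` stays away from the boundary of `Δ`, so all the
rates hold there. -/
theorem hasDecay_thickening_of_condition (hΔ : IsOpen Δ) (hφ : AnalyticOnNhd ℂ φ Δ)
    (hψ : AnalyticOnNhd ℂ ψ Δ) (hc : 0 < c) (hρ : 0 < ρ)
    (hcond : Condition1 φ ψ Δ c ρ ∨ Condition2 φ ψ Δ c ρ) (hΓ : IsGamma Δ 1 d Γ)
    {r : ℝ} (hrd : r < d) :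
    ∃ c', HasDecay φ (coeffKernel φ ψ 1) (Metric.thickening r Γ) ρ c' ∧
      ∀ s ∈ Metric.thickening r Γ, ‖ψ s‖ ≤ c' * decayK ρ s.re := by
  obtain ⟨b, hb, h1, h2, h3, h4⟩ := exists_rates_of_condition hc hρ hcond
  have hball : ∀ s ∈ Metric.thickening r Γ, Metric.ball s (d - r) ⊆ Δ := by
    intro s hs
    obtain ⟨γ, hγ, hsγ⟩ := Metric.mem_thickening_iff.1 hs
    refine (Metric.ball_subset_ball' ?_).trans
      (ball_subset_of_le_dist_frontier hΔ (hΓ.subset hγ) (hΓ.le_dist γ hγ))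
    linarith
  have hsub : Metric.thickening r Γ ⊆ Δ := fun s hs =>
    hball s hs (Metric.mem_ball_self (by linarith))
  -- under the first condition, `φ'` is controlled by Cauchy's estimate on discs inside `Δ`
  have h5 : ∃ b', 0 ≤ b' ∧ ∀ s ∈ Metric.thickening r Γ, ‖deriv φ s‖ ≤ b' * decayK ρ s.re := by
    rcases h4 with h4 | h4
    · set δ : ℝ := min (d - r) 1 with hδ
      have hδ0 : 0 < δ := lt_min (by linarith) one_pos
      refine ⟨2 * (b * 2 ^ (1 + ρ)) / δ, by positivity, fun s hs => ?_⟩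
      have hs' : Metric.ball s δ ⊆ Δ := (Metric.ball_subset_ball (min_le_left _ _)).trans
        (hball s hs)
      have h6 := norm_fderiv_le_of_norm_le_ball (f := φ) (M := b * (2 ^ (1 + ρ) * decayK ρ s.re))
        hδ0 (hφ.differentiableOn.mono hs') (fun y hy => by
          refine (h4 y (hs' hy)).trans (mul_le_mul_of_nonneg_left (decayK_near hρ ?_) hb.le)
          rw [Metric.mem_ball, dist_comm, dist_eq_norm] at hy
          have := (Complex.abs_re_le_norm (s - y)).trans (hy.le.trans (min_le_right _ _))
          simpa using this)
      rw [norm_deriv_eq_norm_fderiv]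
      exact h6.trans (le_of_eq (by ring))
    · exact ⟨b, hb.le, fun s hs => h4 s (hsub hs)⟩
  obtain ⟨b', hb', h5⟩ := h5
  have hdM := decayM_pos ρ
  have hdK := decayK_pos ρ
  have hφd : DifferentiableOn ℂ φ (Metric.thickening r Γ) := hφ.differentiableOn.mono hsub
  refine ⟨2 * b + b', ⟨hρ, by positivity, Metric.isOpen_thickening,
    thickening_translate hΓ.translate_one r, hφd, ?_, fun s hs => (h1 s (hsub hs)).trans ?_,
    fun s hs => (h2 s (hsub hs)).trans ?_, fun s hs => (h5 s hs).trans ?_, fun s hs => ?_⟩,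
    fun s hs => (h3 s (hsub hs)).trans ?_⟩
  · exact (((hφd.pow 2).const_mul _).sub ((hφd.deriv Metric.isOpen_thickening).const_mul _)).sub
      (hψ.differentiableOn.mono hsub)
  · exact mul_le_mul_of_nonneg_right (by linarith) (hdM _).le
  · exact mul_le_mul_of_nonneg_right (by linarith) (hdK _).le
  · exact mul_le_mul_of_nonneg_right (by linarith) (hdK _).le
  · refine (norm_coeffKernel_le_density φ ψ s).trans ((density_le_add φ ψ s).trans ?_)
    linarith [h2 s (hsub hs), h5 s hs, h3 s (hsub hs)]
  · exact mul_le_mul_of_nonneg_right (by linarith) (hdK _).le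

/-! ### The upper signs -/

/-- The assertion about the coefficients, the re-summed solution and its error bounds. -/
def Resummable (φ ψ : ℂ → ℂ) (Δ Γ : Set ℂ) (ε ρ d : ℝ) : Prop :=
  (∀ n : ℕ, DifferentiableOn ℂ (coeffA φ ψ ε n) Γ ∧
    ∀ ξ ∈ Γ, IntegrableOn (fun s : ℝ =>
      coeffKernel φ ψ ε (ξ - ε * s) * coeffA φ ψ ε n (ξ - ε * s)) (Ioi 0)) ∧
  (∀ ξ ∈ Γ, IntegrableOn (fun s : ℝ => ‖ψ (ξ - ε * s)‖) (Ioi 0) ∧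
    IntegrableOn (fun s : ℝ => density φ ψ ε (ξ - ε * s)) (Ioi 0)) ∧
  (∃ η F : ℂ → ℂ → ℂ, IsBorelPair φ ψ Γ ε d η F) ∧
  ∀ η F : ℂ → ℂ → ℂ, IsBorelPair φ ψ Γ ε d η F →
    ∀ r : ℝ, 0 < r → r < d →
      BddAbove (constSet F Γ ε ρ r) ∧
      ∀ N : ℕ, 1 ≤ N → ∀ σ : ℝ, 0 < σ → ∀ u : ℂ, σ < u.re → ∀ ξ ∈ Γ,
        ‖η u ξ - ∑ n ∈ Finset.Ico 1 N, coeffA φ ψ ε n ξ / u ^ n‖ ≤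
          constC F Γ ε ρ r * (2 * r / N + 1 / (u.re - σ)) *
            (Real.exp (V φ ψ Δ ε σ ξ) / weight ε ρ ξ) *
            ((N.factorial : ℝ) / (2 * r * ‖u‖) ^ N)

theorem resummable_one (hΔ : IsOpen Δ) (hφ : AnalyticOnNhd ℂ φ Δ)
    (hψ : AnalyticOnNhd ℂ ψ Δ) (hc : 0 < c) (hρ : 0 < ρ)
    (hcond : Condition1 φ ψ Δ c ρ ∨ Condition2 φ ψ Δ c ρ) (hd : 0 < d) (hΓ : IsGamma Δ 1 d Γ) :
    Resummable φ ψ Δ Γ 1 ρ d := by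
  have hthick : ∀ r, 0 < r → r < d → ∃ c',
      HasDecay φ (coeffKernel φ ψ 1) (Metric.thickening r Γ) ρ c' := fun r _ hrd =>
    (hasDecay_thickening_of_condition hΔ hφ hψ hc hρ hcond hΓ hrd).imp fun _ h => h.1
  obtain ⟨b, hDb, hψb⟩ :=
    hasDecay_thickening_of_condition hΔ hφ hψ hc hρ hcond hΓ (half_lt_self hd)
  have hΓT : Γ ⊆ Metric.thickening (d / 2) Γ := Metric.self_subset_thickening (half_pos hd) _
  have htr := hΓ.translate_one
  have hD := hDb.mono hΓ.isOpen htr hΓT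
  have hψd : DifferentiableOn ℂ ψ Γ := hψ.differentiableOn.mono hΓ.subset
  have hpc : ContinuousOn (density φ ψ 1) Γ :=
    (continuousOn_const.mul (hD.phi_diff.continuousOn.pow 2).norm).add
      ((continuousOn_const.mul (hD.phi_diff.deriv hΓ.isOpen).continuousOn).add
        (continuousOn_const.mul hψd.continuousOn)).norm
  have hp0 : ∀ s, 0 ≤ density φ ψ 1 s := fun s => by
    unfold density
    positivity
  have hpb : ∀ s ∈ Γ, density φ ψ 1 s ≤ 3 * b * decayK ρ s.re := fun s hs =>
    (density_le_add φ ψ s).trans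
      (by linarith [hD.phi_sq_le s hs, hD.dphi_le s hs, hψb s (hΓT hs)])
  have hkp : ∀ s ∈ Γ, ‖coeffKernel φ ψ 1 s‖ ≤ density φ ψ 1 s := fun s _ =>
    norm_coeffKernel_le_density φ ψ s
  have hφp : ∀ s ∈ Γ, ‖φ s‖ ^ 2 ≤ 4 * density φ ψ 1 s := fun s _ => by
    unfold density
    rw [norm_pow]
    linarith [norm_nonneg (1 / 2 * deriv φ s + ((1 : ℝ) : ℂ) * ψ s)]
  obtain ⟨F₀, h₀⟩ := exists_borelSol hd hD hthick
  have hE : SubexponentialOn F₀ Γ ρ := fun σ hσ n =>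
    h₀.exists_exp_bound hd hD (by linarith [hD.c_pos]) hpc (fun s _ => hp0 s) hpb hkp hφp hσ n
  refine ⟨fun n => ?_, fun ξ hξ => ⟨?_, ?_⟩,
    ⟨_, _, h₀.isBorelPair hd hΓ.isConnected hD hE⟩, fun η F hF r hr hrd => ?_⟩
  · simpa using h₀.coeffA_properties hd hD n
  · have : IntegrableOn (fun x : ℝ => ‖ψ (ξ - x)‖) (Ioi 0) :=
      (integrableOn_halfLine_of_norm_le htr hψd.continuousOn hρ
        (fun s hs => hψb s (hΓT hs)) hξ).norm
    simpa using this
  · have := integrableOn_halfLine_of_norm_le htr hpc hρ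
      (fun s hs => by rw [Real.norm_of_nonneg (hp0 s)]; exact hpb s hs) hξ
    simpa using this
  -- the power series determines `F`, and the Laplace integral then determines `η`
  have hFF : ∀ ξ ∈ Γ, EqOn (fun t => F t ξ) (fun t => F₀ t ξ) (stripU (2 * d)) := fun ξ hξ =>
    eqOn_stripU_of_hasSum (r' := 2 * d) (by positivity) (by positivity)
      (hF.F_holo.comp (f := fun t : ℂ => (t, ξ)) (by fun_prop) (fun t ht => ⟨ht, hξ⟩))
      (h₀.differentiableOn_fst hξ) (fun t ht => hF.F_series t ht ξ hξ)
      (fun t ht => h₀.hasSum_coeffA hd hD ht hξ)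
  have hηη : ∀ u : ℂ, 0 < u.re → ∀ ξ ∈ Γ, η u ξ = laplaceBorel F₀ u ξ := by
    intro u hu ξ hξ
    rw [(hF.laplace u hu ξ hξ).2]
    refine setIntegral_congr_fun measurableSet_Ioi (fun t ht => ?_)
    have := hFF ξ hξ (ofReal_mem_stripU (r := 2 * d) (by positivity) (mem_Ioi.1 ht).le)
    simp only at this ⊢
    rw [this]
  have hmem : ∀ w : ℂ, ‖w‖ = 2 * r → w ∈ stripU (2 * d) := fun w hw =>
    ball_subset_stripU _ (by rw [mem_ball_zero_iff]; linarith)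
  have hbdd : BddAbove (constSet F Γ 1 ρ r) := by
    obtain ⟨S, hS⟩ := h₀.weight_mul_norm_le hρ hr hrd
    refine ⟨S, ?_⟩
    rintro x ⟨w, ξ, hw, hξ, rfl⟩
    have := hFF ξ hξ (hmem w hw)
    simp only at this
    rw [this]
    exact hS w hw ξ hξ
  refine ⟨hbdd, fun N hN σ hσ u hu ξ hξ => ?_⟩
  have hS : ∀ w : ℂ, ‖w‖ = 2 * r → ∀ ξ ∈ Γ,
      weight 1 ρ ξ * ‖F₀ w ξ‖ ≤ sSup (constSet F Γ 1 ρ r) := fun w hw ξ hξ => by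
    have := hFF ξ hξ (hmem w hw)
    simp only at this
    rw [← this]
    exact le_csSup hbdd ⟨w, ξ, hw, hξ, rfl⟩
  rw [hηη u (hσ.trans hu) ξ hξ]
  have hA := fun n => h₀.coeffA_succ_eq hd hD n ξ hξ
  -- if `φ = 0`, then `k = -ψ`, and the smaller density `|ψ|` already controls the growth
  by_cases hzero : ∀ t ∈ Δ, φ t = 0
  · have hdφ : ∀ s ∈ Γ, deriv φ s = 0 := fun s hs => by
      have h1 : φ =ᶠ[𝓝 s] fun _ => 0 := by
        filter_upwards [hΔ.mem_nhds (hΓ.subset hs)] with t ht using hzero t ht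
      rw [h1.deriv_eq, deriv_const]
    have hV : V φ ψ Δ 1 σ ξ = 1 / σ * tailIntegral (fun s => ‖ψ s‖) ξ := by
      simp [V, if_pos hzero, halfLineArcIntegral, tailIntegral]
    rw [hV]
    exact h₀.norm_laplaceBorel_sub_sum_le hd hD hψd.continuousOn.norm
      (fun s _ => norm_nonneg _) (fun s hs => hψb s (hΓT hs))
      (fun s hs => by simp [coeffKernel, hzero s (hΓ.subset hs), hdφ s hs]) hσ (by positivity)
      (Or.inr ⟨fun s hs => hzero s (hΓ.subset hs), by field_simp⟩) hr hrd hS hξ hA hN hu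
  · have hV : V φ ψ Δ 1 σ ξ = 6 / σ * tailIntegral (density φ ψ 1) ξ := by
      simp [V, if_neg hzero, halfLineArcIntegral, tailIntegral]
    rw [hV]
    exact h₀.norm_laplaceBorel_sub_sum_le hd hD hpc (fun s _ => hp0 s) hpb hkp hσ (by positivity)
      (Or.inl ⟨hφp, by field_simp⟩) hr hrd hS hξ hA hN hu

end

/-! ### Reflection `ξ ↦ -ξ` and the lower signs -/

section

variable {φ ψ : ℂ → ℂ} {Δ Γ : Set ℂ} {ε c ρ d : ℝ}

theorem coeffKernel_reflect (φ ψ : ℂ → ℂ) (ε : ℝ) (t : ℂ) :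
    coeffKernel (fun s => φ (-s)) (fun s => ψ (-s)) ε t = coeffKernel φ ψ (-ε) (-t) := by
  simp only [coeffKernel, deriv_comp_neg, Complex.ofReal_neg]
  ring

theorem coeffA_reflect (φ ψ : ℂ → ℂ) (ε : ℝ) (n : ℕ) (ξ : ℂ) :
    coeffA (fun s => φ (-s)) (fun s => ψ (-s)) ε n ξ = coeffA φ ψ (-ε) n (-ξ) := by
  induction n generalizing ξ with
  | zero => rfl
  | succ n ih =>
    have h1 : coeffA (fun s => φ (-s)) (fun s => ψ (-s)) ε n =
        fun ξ => coeffA φ ψ (-ε) n (-ξ) := funext ih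
    have h2 : ∀ s : ℝ, -(ξ - ε * s) = -ξ - ((-ε : ℝ) : ℂ) * s := fun s => by
      push_cast
      ring
    simp only [coeffA, h1, deriv_comp_neg, halfLineIntegral, coeffKernel_reflect, h2]
    push_cast
    ring

theorem weight_reflect (ε ρ : ℝ) (ξ : ℂ) : weight ε ρ ξ = weight (-ε) ρ (-ξ) := by
  simp [weight, Real.sign_neg]

theorem density_reflect (φ ψ : ℂ → ℂ) (ε : ℝ) (t : ℂ) :
    density (fun s => φ (-s)) (fun s => ψ (-s)) ε t = density φ ψ (-ε) (-t) := by
  simp only [density, deriv_comp_neg, Complex.ofReal_neg]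
  rw [← norm_neg (1 / 2 * -deriv φ (-t) + ε * ψ (-t))]
  congr 2
  ring

theorem V_reflect (φ ψ : ℂ → ℂ) (Δ : Set ℂ) (ε σ : ℝ) (ξ : ℂ) :
    V (fun s => φ (-s)) (fun s => ψ (-s)) (-Δ) ε σ ξ = V φ ψ Δ (-ε) σ (-ξ) := by
  have h1 : (∀ t ∈ -Δ, φ (-t) = 0) ↔ ∀ t ∈ Δ, φ t = 0 :=
    ⟨fun h t ht => by simpa using h (-t) (by simpa using ht), fun h t ht => h (-t) ht⟩
  have h2 : ∀ s : ℝ, -(ξ - ε * s) = -ξ - ((-ε : ℝ) : ℂ) * s := fun s => by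
    push_cast
    ring
  by_cases hz : ∀ t ∈ Δ, φ t = 0
  · rw [V, V, if_pos (h1.2 hz), if_pos hz]
    simp only [halfLineArcIntegral, h2]
  · rw [V, V, if_neg (mt h1.1 hz), if_neg hz]
    simp only [halfLineArcIntegral, density_reflect, h2]

theorem constSet_reflect (F : ℂ → ℂ → ℂ) (Γ : Set ℂ) (ε ρ r : ℝ) :
    constSet (fun t ξ => F t (-ξ)) (-Γ) ε ρ r = constSet F Γ (-ε) ρ r := by
  ext x
  constructor
  · rintro ⟨t, ξ, ht, hξ, rfl⟩
    exact ⟨t, -ξ, ht, hξ, by rw [weight_reflect]⟩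
  · rintro ⟨t, ξ, ht, hξ, rfl⟩
    exact ⟨t, -ξ, ht, by simpa using hξ, by simp [weight_reflect ε]⟩

theorem differentiableOn_reflect {f : ℂ → ℂ} (hf : DifferentiableOn ℂ f Γ) :
    DifferentiableOn ℂ (fun ξ => f (-ξ)) (-Γ) :=
  hf.comp (f := fun ξ : ℂ => -ξ) (by fun_prop) (fun _ h => h)

theorem IsGamma.reflect (h : IsGamma Δ ε d Γ) : IsGamma (-Δ) (-ε) d (-Γ) where
  isOpen := h.isOpen.neg
  isConnected := by
    rw [← image_neg_eq_neg]
    exact h.isConnected.image _ (by fun_prop)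
  subset := neg_subset_neg.2 h.subset
  le_dist ξ hξ b hb := by
    have hb' : -b ∈ frontier Δ := by
      have h1 := (Homeomorph.neg ℂ).preimage_frontier Δ
      have h2 : b ∈ (Homeomorph.neg ℂ) ⁻¹' frontier Δ := by
        rw [h1]
        exact hb
      exact h2
    simpa [dist_neg_neg] using h.le_dist (-ξ) hξ (-b) hb'
  translate ξ hξ x hx := by
    have := h.translate (-ξ) hξ x hx
    rw [Set.mem_neg]
    convert this using 1
    push_cast
    ring

theorem IsBorelPair.reflect {η F : ℂ → ℂ → ℂ} (h : IsBorelPair φ ψ Γ ε d η F) :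
    IsBorelPair (fun s => φ (-s)) (fun s => ψ (-s)) (-Γ) (-ε) d
      (fun u ξ => η u (-ξ)) (fun t ξ => F t (-ξ)) where
  eta_holo := h.eta_holo.comp (f := fun p : ℂ × ℂ => (p.1, -p.2)) (by fun_prop)
    (fun _ hp => ⟨hp.1, hp.2⟩)
  ode := by
    obtain ⟨Φ, hΦ, hW⟩ := h.ode
    refine ⟨fun ξ => -Φ (-ξ), fun ξ hξ => ?_, fun u hu ξ hξ => ?_⟩
    · have := ((hΦ (-ξ) hξ).scomp ξ (hasDerivAt_neg ξ)).neg
      refine this.congr_deriv ?_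
      simp
    · have h1 : solutionW (fun ξ => -Φ (-ξ)) (-ε) (fun u ξ => η u (-ξ)) u =
          fun ξ => solutionW Φ ε η u (-ξ) := by
        ext ξ
        simp only [solutionW]
        congr 2
        push_cast
        ring
      have h2 : deriv (fun ξ => solutionW Φ ε η u (-ξ)) =
          fun ξ => -deriv (solutionW Φ ε η u) (-ξ) := funext fun ξ => deriv_comp_neg _ _
      have h3 : deriv (fun ξ => -deriv (solutionW Φ ε η u) (-ξ)) ξ =
          deriv (deriv (solutionW Φ ε η u)) (-ξ) := by
        rw [deriv.fun_neg, deriv_comp_neg (deriv (solutionW Φ ε η u)), neg_neg]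
      rw [h1, h2, h3]
      exact hW u hu (-ξ) hξ
  eta_lim u hu := by
    refine (h.eta_lim u hu).comp (tendsto_inf.2 ⟨?_, ?_⟩)
    · refine tendsto_comap_iff.2 (Tendsto.congr (fun ξ => ?_) (tendsto_comap.mono_left inf_le_left))
      simp
    · exact tendsto_principal.2 (mem_inf_of_right (fun ξ hξ => hξ))
  F_holo := h.F_holo.comp (f := fun p : ℂ × ℂ => (p.1, -p.2)) (by fun_prop)
    (fun _ hp => ⟨hp.1, hp.2⟩)
  F_series t ht ξ hξ := by
    simpa only [coeffA_reflect, neg_neg] using h.F_series t ht (-ξ) hξ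
  laplace u hu ξ hξ := h.laplace u hu (-ξ) hξ

theorem Resummable.reflect (h : Resummable φ ψ Δ Γ ε ρ d) :
    Resummable (fun s => φ (-s)) (fun s => ψ (-s)) (-Δ) (-Γ) (-ε) ρ d := by
  obtain ⟨h1, h2, ⟨η₀, F₀, h3⟩, h4⟩ := h
  have hs : ∀ (ξ : ℂ) (s : ℝ), -(ξ - ((-ε : ℝ) : ℂ) * s) = -ξ - ε * s := fun ξ s => by
    push_cast
    ring
  refine ⟨fun n => ⟨?_, fun ξ hξ => ?_⟩, fun ξ hξ => ⟨?_, ?_⟩, ⟨_, _, h3.reflect⟩,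
    fun η F hp r hr hrd => ?_⟩
  · rw [show coeffA (fun s => φ (-s)) (fun s => ψ (-s)) (-ε) n =
        fun ξ => coeffA φ ψ ε n (-ξ) from funext fun ξ => by rw [coeffA_reflect, neg_neg]]
    exact differentiableOn_reflect (h1 n).1
  · simpa only [coeffKernel_reflect, coeffA_reflect, neg_neg, hs] using (h1 n).2 (-ξ) hξ
  · simpa only [hs] using (h2 (-ξ) hξ).1
  · simpa only [density_reflect, neg_neg, hs] using (h2 (-ξ) hξ).2
  have hp' := hp.reflect
  simp only [neg_neg] at hp'
  obtain ⟨h5, h6⟩ := h4 _ _ hp' r hr hrd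
  have hset : constSet F (-Γ) (-ε) ρ r = constSet (fun t ξ => F t (-ξ)) Γ ε ρ r := by
    have := constSet_reflect F (-Γ) ε ρ r
    rw [neg_neg] at this
    exact this.symm
  refine ⟨hset ▸ h5, fun N hN σ hσ u hu ξ hξ => ?_⟩
  have h7 := h6 N hN σ hσ u hu (-ξ) hξ
  simp only [neg_neg] at h7
  simp only [constC, hset, V_reflect, coeffA_reflect, weight_reflect (-ε), neg_neg]
  exact h7

end

end WKB

end

theorem theorem1p2
    (φ ψ : ℂ → ℂ) (Δ : Set ℂ) (hΔo : IsOpen Δ) (hΔc : IsConnected Δ)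
    (hφ : AnalyticOnNhd ℂ φ Δ) (hψ : AnalyticOnNhd ℂ ψ Δ)
    (c ρ : ℝ) (hc : 0 < c) (hρ : 0 < ρ)
    (hcond : WKB.Condition1 φ ψ Δ c ρ ∨ WKB.Condition2 φ ψ Δ c ρ)
    (ε : ℝ) (hε : ε = 1 ∨ ε = -1)
    (d : ℝ) (hd : 0 < d) (Γ : Set ℂ) (hΓ : WKB.IsGamma Δ ε d Γ) :
    -- the coefficients are well defined: holomorphic, with convergent integrals
    (∀ n : ℕ, DifferentiableOn ℂ (WKB.coeffA φ ψ ε n) Γ ∧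
      ∀ ξ ∈ Γ, IntegrableOn (fun s : ℝ =>
        WKB.coeffKernel φ ψ ε (ξ - ε * s) * WKB.coeffA φ ψ ε n (ξ - ε * s)) (Ioi 0)) ∧
    -- the integrals that define `V` converge
    (∀ ξ ∈ Γ, IntegrableOn (fun s : ℝ => ‖ψ (ξ - ε * s)‖) (Ioi 0) ∧
      IntegrableOn (fun s : ℝ => WKB.density φ ψ ε (ξ - ε * s)) (Ioi 0)) ∧
    -- the re-summed solution and its Borel transform exist
    (∃ η F : ℂ → ℂ → ℂ, WKB.IsBorelPair φ ψ Γ ε d η F) ∧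
    -- and they satisfy the error bounds
    ∀ η F : ℂ → ℂ → ℂ, WKB.IsBorelPair φ ψ Γ ε d η F →
      ∀ r : ℝ, 0 < r → r < d →
        BddAbove (WKB.constSet F Γ ε ρ r) ∧
        ∀ N : ℕ, 1 ≤ N → ∀ σ : ℝ, 0 < σ → ∀ u : ℂ, σ < u.re → ∀ ξ ∈ Γ,
          ‖η u ξ - ∑ n ∈ Finset.Ico 1 N, WKB.coeffA φ ψ ε n ξ / u ^ n‖ ≤
            WKB.constC F Γ ε ρ r * (2 * r / N + 1 / (u.re - σ)) *
              (Real.exp (WKB.V φ ψ Δ ε σ ξ) / WKB.weight ε ρ ξ) *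
              ((N.factorial : ℝ) / (2 * r * ‖u‖) ^ N) := by
  rcases hε with rfl | rfl
  · exact WKB.resummable_one hΔo hφ hψ hc hρ hcond hd hΓ
  · have hφ' : AnalyticOnNhd ℂ (fun s => φ (-s)) (-Δ) :=
      hφ.comp (g := φ) (f := fun s : ℂ => -s) analyticOnNhd_id.neg (fun _ h => h)
    have hψ' : AnalyticOnNhd ℂ (fun s => ψ (-s)) (-Δ) :=
      hψ.comp (g := ψ) (f := fun s : ℂ => -s) analyticOnNhd_id.neg (fun _ h => h)
    have hcond' : WKB.Condition1 (fun s => φ (-s)) (fun s => ψ (-s)) (-Δ) c ρ ∨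
        WKB.Condition2 (fun s => φ (-s)) (fun s => ψ (-s)) (-Δ) c ρ := by
      refine hcond.imp (fun h ξ hξ => ?_) (fun h ξ hξ => ?_)
      · simpa only [norm_neg] using h (-ξ) hξ
      · simpa only [norm_neg, deriv_comp_neg] using h (-ξ) hξ
    have hΓ' := hΓ.reflect
    rw [neg_neg] at hΓ'
    have h := (WKB.resummable_one hΔo.neg hφ' hψ' hc hρ hcond' hd hΓ').reflect
    simp only [neg_neg] at h
    exact h
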